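/- A Ferrers diagram is a bottom-justified array of cells whose column heights $\lambda_1\ge\lambda_2\ge\dots\ge\lambda_m\ge 0$ are non-increasing from left to right (columns of height $0$ are allowed); rows are numbered from bottom to top. A partial filling of a Ferrers diagram consists of a set $H$ of its columns (the hole-columns) and an assignment of a symbol to each cell: the hole symbol $\diamond$ to every cell of a column in $H$, and $0$ or $1$ to every cell of the other (standard) columns. It is a partial transversal if every row and every standard column contains exactly one $1$-cell. A substitution into a hole-column $j$ of height $h$ chooses $i$ with $1\le i\le h+1$ and inserts a new row between rows $i-1$ and $i$, which reaches column $j$, is not longer than row $i-1$ and not shorter than row $i$ (if $i=1$, it meets all $m$ columns); the cells of column $j$ are filled with $0$, except for a $1$ in the new row, and $j$ becomes a standard column; the other cells of the new row get $0$ in standard columns and $\diamond$ in hole-columns. An extension of a partial filling is a filling without hole-columns obtained from it by a sequence of substitutions. A filling without hole-columns contains a permutation $p$ of $\{1,\dots,\ell\}$ if there are $\ell$ rows and $\ell$ columns, all of whose intersections are cells of the diagram, that induce the permutation matrix of $p$ (with a $1$ in row $p_j$ of column $j$). A partial filling avoids $p$ if none of its extensions contains $p$. Permutations $p,q$ are shape-$\star$-Wilf-equivalent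 if for every Ferrers diagram $D$ there is a bijection between the $p$-avoiding and the $q$-avoiding partial transversals of $D$ that preserves the set of hole-columns. A partial permutation of length $n$ with $k$ holes is a word of length $n$ in which each of $1,\dots,n-k$ appears exactly once and the other $k$ letters are holes $\diamond$. An extension of it is a permutation $\sigma$ of $\{1,\dots,n\}$ whose subword at the non-hole positions is order-isomorphic to the word of non-hole letters. It avoids a permutation $p$ if none of its extensions has a subword order-isomorphic to $p$. For $H\subseteq\{1,\dots,n\}$, let $s_n^H(p)$ be the number of $p$-avoiding partial permutations of length $n$ whose set of hole positions is exactly $H$. Permutations $p,q$ are strongly $\star$-Wilf-equivalent if $s_n^H(p)=s_n^H(q)$ for all $n\ge 0$ and all $H\subseteq\{1,\dots,n\}$. **Theorem.** The permutations $312$ and $231$ are shape-$\star$-Wilf-equivalent. Moreover, for every $m\ge 3$ and every permutation $X$ of the set $\{4,5,\dots,m\}$, the permutations $312X$ and $231X$ are strongly $\star$-Wilf-equivalent. -/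

import Mathlib

/-! ### Partial permutations and pattern avoidance

Permutations of `{1, …, n}` are modelled by `Equiv.Perm (Fin n)`; positions and values are shifted
down by one. -/

/-- The standardization of a word with distinct letters: each letter is replaced by its rank among
the letters of the word (ranks start at `0`). -/
def standardization {ι α : Type} [Fintype ι] [LinearOrder α] (w : ι → α) : ι → ℕ :=
  fun i => (Finset.univ.filter (fun j => w j < w i)).card

/-- A permutation `σ` contains the pattern `p` if some subword of `σ` standardizes to `p`. -/
def PermContains {n l : ℕ} (σ : Equiv.Perm (Fin n)) (p : Equiv.Perm (Fin l)) : Prop :=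
  ∃ f : Fin l → Fin n, StrictMono f ∧
    standardization (fun a => σ (f a)) = fun a => (p a : ℕ)

/-- A partial permutation of length `n` with `k` holes: a word of length `n` in which each of the
`n - k` symbols appears exactly once, and the remaining `k` letters are holes (`none`).
There are none when `n < k`. -/
structure PartialPerm (n k : ℕ) where
  word : Fin n → Option (Fin (n - k))
  existsUnique_symbol : ∀ v, ∃! i, word i = some v
  card_holes : (Finset.univ.filter (fun i => word i = none)).card = k

/-- `σ` is an extension of `π`: the subword of `σ` at the non-hole positions of `π` standardizes
to the word of non-hole letters of `π`. -/
def PartialPerm.IsExtension {n k : ℕ} (π : PartialPerm n k) (σ : Equiv.Perm (Fin n)) : Prop :=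
  ∀ i : {i : Fin n // π.word i ≠ none},
    (π.word i).map Fin.val =
      some (standardization (fun j : {j : Fin n // π.word j ≠ none} => σ j) i)

/-- A partial permutation avoids `p` if each of its extensions avoids `p`. -/
def PartialPerm.Avoids {n k l : ℕ} (π : PartialPerm n k) (p : Equiv.Perm (Fin l)) : Prop :=
  ∀ σ : Equiv.Perm (Fin n), π.IsExtension σ → ¬ PermContains σ p

/-- The number of `p`-avoiding partial permutations of length `n` whose set of hole positions is
exactly `H`. -/
noncomputable def numAvoiding {n l : ℕ} (H : Finset (Fin n)) (p : Equiv.Perm (Fin l)) : ℕ :=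
  Nat.card {π : PartialPerm n H.card // (∀ i, π.word i = none ↔ i ∈ H) ∧ π.Avoids p}

/-- Strong `k`-Wilf-equivalence. -/
def StronglyWilfEquivalent (k : ℕ) {l l' : ℕ}
    (p : Equiv.Perm (Fin l)) (q : Equiv.Perm (Fin l')) : Prop :=
  ∀ (n : ℕ) (H : Finset (Fin n)), H.card = k → numAvoiding H p = numAvoiding H q

/-- Strong `⋆`-Wilf-equivalence. -/
def StronglyStarWilfEquivalent {l l' : ℕ}
    (p : Equiv.Perm (Fin l)) (q : Equiv.Perm (Fin l')) : Prop :=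
  ∀ k : ℕ, StronglyWilfEquivalent k p q

/-! ### Partial fillings of Ferrers diagrams -/

/-- A Ferrers diagram with `m` bottom-justified columns of non-increasing heights; columns of
height zero are allowed. Rows are numbered from bottom to top and columns from left to right,
starting at `0`, so that row `i` meets column `j` exactly when `i < height j`. -/
structure FerrersDiagram (m : ℕ) where
  height : Fin m → ℕ
  antitone_height : Antitone height

/-- The number of cells in row `i` (which is `0` if there is no such row). -/
def FerrersDiagram.rowLength {m : ℕ} (D : FerrersDiagram m) (i : ℕ) : ℕ :=
  (Finset.univ.filter (fun j => i < D.height j)).card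

/-- A partial 01-filling of a Ferrers diagram with `m` columns. It is recorded by its diagram, its
set `holes` of hole-columns, and its set `ones` of 1-cells, given as pairs (row, column): a cell
carries the hole symbol if its column is in `holes`, the symbol `1` if it is in `ones`, and the
symbol `0` otherwise. -/
structure PartialFilling (m : ℕ) where
  diagram : FerrersDiagram m
  holes : Finset (Fin m)
  ones : Finset (ℕ × Fin m)
  mem_diagram : ∀ i j, (i, j) ∈ ones → i < diagram.height j
  not_mem_holes : ∀ i j, (i, j) ∈ ones → j ∉ holes

namespace PartialFilling

/-- A partial transversal: every row and every standard (non-hole) column contains exactly one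
1-cell. -/
def IsTransversal {m : ℕ} (F : PartialFilling m) : Prop :=
  (∀ i : ℕ, (∃ j, i < F.diagram.height j) → ∃! j, (i, j) ∈ F.ones) ∧
    ∀ j : Fin m, j ∉ F.holes → ∃! i, (i, j) ∈ F.ones

/-- `G` arises from `F` by a substitution into the hole-column `j`: a new row of length `len` is
inserted directly below the old row `i` (directly above the old row `i - 1`), where `i` is at most
the height of column `j`. The new row is not shorter than the old row `i` and not longer than the
old row `i - 1`, it has full length `m` if `i = 0`, and it reaches column `j`. Column `j` becomes a
standard column whose only 1-cell is in the new row, which contains no other 1-cell. The old rows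
`i, i + 1, …` move up by one. -/
def IsSubstitution {m : ℕ} (F : PartialFilling m) (j : Fin m) (G : PartialFilling m) : Prop :=
  j ∈ F.holes ∧
  ∃ i len : ℕ, i ≤ F.diagram.height j ∧ (j : ℕ) < len ∧
    F.diagram.rowLength i ≤ len ∧
    (i = 0 → len = m) ∧
    (0 < i → len ≤ F.diagram.rowLength (i - 1)) ∧
    (∀ c : Fin m, G.diagram.height c =
      if (c : ℕ) < len then F.diagram.height c + 1 else F.diagram.height c) ∧
    G.holes = F.holes.erase j ∧
    ∀ (r : ℕ) (c : Fin m), (r, c) ∈ G.ones ↔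
      (r = i ∧ c = j) ∨ (r < i ∧ (r, c) ∈ F.ones) ∨ (i < r ∧ (r - 1, c) ∈ F.ones)

/-- `G` is an extension of `F`: it has no hole-columns and arises from `F` by a sequence of
substitutions. -/
def IsExtension {m : ℕ} (F G : PartialFilling m) : Prop :=
  Relation.ReflTransGen (fun A B => ∃ j, IsSubstitution A j B) F G ∧ G.holes = ∅

/-- A filling without hole-columns contains the permutation matrix of `p`: there are rows
`r 0 < r 1 < …` and columns `c 0 < c 1 < …` all of whose intersections are cells of the diagram,
and the subfilling on these cells is the permutation matrix, which has its 1-cell of column `b` in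
row `p b`. -/
def Contains {m l : ℕ} (G : PartialFilling m) (p : Equiv.Perm (Fin l)) : Prop :=
  ∃ (r : Fin l → ℕ) (c : Fin l → Fin m), StrictMono r ∧ StrictMono c ∧
    (∀ a b, r a < G.diagram.height (c b)) ∧
    ∀ a b, (r a, c b) ∈ G.ones ↔ p b = a

/-- A partial filling avoids `p` if each of its extensions avoids `p`. -/
def Avoids {m l : ℕ} (F : PartialFilling m) (p : Equiv.Perm (Fin l)) : Prop :=
  ∀ G : PartialFilling m, F.IsExtension G → ¬ G.Contains p

end PartialFilling

/-- The `p`-avoiding partial transversals of the Ferrers diagram `D` (with any set of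
hole-columns). -/
def AvoidingTransversal {m l : ℕ} (D : FerrersDiagram m) (p : Equiv.Perm (Fin l)) : Type :=
  {F : PartialFilling m // F.diagram = D ∧ F.IsTransversal ∧ F.Avoids p}

/-- Shape-`⋆`-Wilf-equivalence: for every Ferrers diagram there is a bijection between the
`p`-avoiding and the `q`-avoiding partial transversals which preserves the set of hole-columns. -/
def ShapeStarWilfEquivalent {l l' : ℕ}
    (p : Equiv.Perm (Fin l)) (q : Equiv.Perm (Fin l')) : Prop :=
  ∀ (m : ℕ) (D : FerrersDiagram m),
    ∃ e : AvoidingTransversal D p ≃ AvoidingTransversal D q,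
      ∀ F : AvoidingTransversal D p, (e F).1.holes = F.1.holes

/-! ### The patterns -/

/-- The permutation `312`. -/
def perm312 : Equiv.Perm (Fin 3) := ⟨![2, 0, 1], ![1, 2, 0], by decide, by decide⟩

/-- The permutation `231`. -/
def perm231 : Equiv.Perm (Fin 3) := ⟨![1, 2, 0], ![2, 0, 1], by decide, by decide⟩

/-- The word `p` followed by the word of `x` with all its letters raised by `a`, where `a` is the
length of `p`. For `a = 3` and `x` ranging over all permutations of length `m - 3`, these are the
permutations `p X` with `X` a permutation of `{4, …, m}`. -/
def appendShift {a b : ℕ} (p : Equiv.Perm (Fin a)) (x : Equiv.Perm (Fin b)) :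
    Equiv.Perm (Fin (a + b)) :=
  finSumFinEquiv.permCongr (Equiv.sumCongr p x)

/-!
# Why `312` and `231` cannot be told apart

**Holes as flexible entries.** A row inserted below row `i` contributes an entry whose height lies
strictly between two old rows. Give the old row `r` the level `2 r + 1` and the gap below row `i`
the level `2 i`. Entries inserted in one gap can be arranged in any order, so some extension of a
partial filling contains `p` if and only if `p` occurs with levels that are prescribed in standard
columns, arbitrary even numbers in hole-columns, and only weakly ordered
(`PartialFilling.avoids_iff_not_hasOccurrence`, `PartialPerm.avoids_iff_not_occurs`). Both halves of
the theorem thereby become statements about transversals `f`, functions from columns to rows, and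
about `Occurs`.

**At most one hole-column matters.** Three hole-columns always produce both patterns. Two of them do
so too, unless the right one lies to the right of all standard columns and below all 1-cells, in
which case it takes part in no occurrence of a pattern of length three. So let there be one
hole-column (`EssentiallyOneHole`).

**Reading along the border.** Walk along the border of the shape from the top left to the bottom
right corner and keep the list of the columns that have begun and whose 1-cells are still ahead,
ordered by decreasing row. At a row, the first column of the list leaves it; at a new column `j`,
the list is split and `j`, its largest entry, is put in between. A transversal avoids `312` when,
left of the hole-column, every split `p, s` satisfies `p > s`, and the list is decreasing when the
hole-column begins; it avoids `231` when, left of the hole-column, every prefix `p` is increasing,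
and the list is increasing when the hole-column begins. Thereafter all insertions are forced in both
cases (`encard_readable_eq_forcedCount`).

**Comparing the two walks.** For `312`, the number of continuations depends only on the list's word
of marks, which records the ascents and the entries after which a new largest entry may be put. For
`231` it depends only on the ascent word. These two words evolve in different ways, but sum both
numbers over all lattice paths from `0` to the top that stay weakly below a ceiling, a path being
read once as a word of marks (an up-step that starts on the ceiling is a cut) and once as an ascent
word.
The two sums obey the same recursion along the border (`markSum_markCount_eq`). For the empty list
there is a single path, and this gives equality of the two counts (`encard_not_occurs_eq`).

**Appending `X`.** A partial permutation is a transversal of a rectangle. An occurrence of `p X` is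
an occurrence of `p` inside the region of the cells that have an occurrence of `X` above and to the
right. This region is a Ferrers shape, and it does not change when the 1-cells inside it are
rearranged (`occursAbove_congr`). So the transversals fall into classes that fix everything outside
the region, and on each class the result for `312` and `231` in Ferrers shapes applies
(`encard_not_occurs_appendShift_eq`).
-/

/-! ### Counting walks on words of marks -/

/-- A step along the border of a Ferrers diagram, from its top left to its bottom right corner:
a column begins, a row ends, or the hole-column begins. -/
inductive BorderStep (α : Type) where
  | col (j : α) : BorderStep α
  | row (r : ℕ) : BorderStep α
  | hole : BorderStep α

/-- The mark of an entry of a list: `asc` if the next entry is larger, `cut` if this entry and all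
entries before it exceed all entries after it, and `desc` otherwise. -/
inductive Mark where
  | asc : Mark
  | desc : Mark
  | cut : Mark

namespace Mark

/-- The mark of an entry after a larger entry has been inserted somewhere behind it. -/
def uncut : Mark → Mark
  | asc => asc
  | desc => desc
  | cut => desc

/-- The words of marks that arise when a new largest entry is inserted at a cut. -/
def insertions : List Mark → List (List Mark)
  | [] => []
  | m :: s => (match m with | cut => [asc :: cut :: s] | _ => []) ++
      (insertions s).map (m.uncut :: ·)

/-- A word of marks without ascents. -/
def NoAsc (s : List Mark) : Prop := ∀ m ∈ s, m ≠ asc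

end Mark

/-- The ascent words that arise when a new largest entry is inserted into the initial increasing
run of a list, anywhere but at the end of the run. -/
def ascentInsertions : List Bool → List (List Bool)
  | [] => []
  | b :: s => (false :: b :: s) ::
      (match b with | true => (ascentInsertions s).map (true :: ·) | false => [])

/-- The number (`0` or `1`) of ways to run through a word when every insertion is forced and the
list has length `k`. -/
def forcedCount {α : Type} : List (BorderStep α) → ℕ → ℕ∞
  | [], k => if k = 0 then 1 else 0
  | .row _ :: _, 0 => 0
  | .row _ :: w, k + 1 => forcedCount w k
  | .col _ :: w, k => forcedCount w (k + 1)
  | .hole :: w, k => forcedCount w k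

open Classical in
/-- The number of ways to run through a border word, for the pattern `312`, starting from a list
with the given word of marks. -/
noncomputable def markCount {α : Type} : List (BorderStep α) → List Mark → ℕ∞
  | [], _ => 0
  | .row _ :: _, [] => 0
  | .row _ :: w, _ :: s => markCount w s
  | .col _ :: w, s => markCount w (.cut :: s) + ((Mark.insertions s).map (markCount w)).sum
  | .hole :: w, s => if Mark.NoAsc s then forcedCount w s.length else 0

open Classical in
/-- The number of ways to run through a border word, for the pattern `231`, starting from a list
with the given ascent word. -/
noncomputable def ascentCount {α : Type} : List (BorderStep α) → List Bool → ℕ∞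
  | [], _ => 0
  | .row _ :: _, [] => 0
  | .row _ :: w, _ :: s => ascentCount w s
  | .col _ :: w, s => ascentCount w (true :: s) + ((ascentInsertions s).map (ascentCount w)).sum
  | .hole :: w, s => if ∀ b ∈ s, b = true then forcedCount w s.length else 0

/-- A ceiling: a list of heights `x_n, …, x_1` with `x_{i+1} ≤ x_i + 1` and `x_1 ≤ 1`. -/
def IsCeiling : List ℕ → Prop
  | [] => True
  | a :: x => a ≤ x.headD 0 + 1 ∧ IsCeiling x

/-- The sum of `g` over the words of marks that describe lattice paths with steps `0` and `1` from
height `0` to height `y`, with first step `1`, that stay weakly below the ceiling `x`: a step `0`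
is marked `asc`; a step `1` is marked `cut` if it starts on the ceiling and `desc` otherwise. -/
def markSum : List ℕ → ℕ → (List Mark → ℕ∞) → ℕ∞
  | [], y, g => if y = 0 then g [] else 0
  | a :: x, y, g => if y ≤ a then
      (if x = [] then 0 else markSum x y (fun s => g (.asc :: s))) +
      (match y with
        | 0 => 0
        | k + 1 => markSum x k (fun s => g ((if k = x.headD 0 then .cut else .desc) :: s)))
      else 0

/-- The sum of `g` over the 01-words of the lattice paths with steps `0` and `1` from height `0` to
height `y`, with first step `1`, that stay weakly below the ceiling `x`. -/
def ascentSum : List ℕ → ℕ → (List Bool → ℕ∞) → ℕ∞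
  | [], y, g => if y = 0 then g [] else 0
  | a :: x, y, g => if y ≤ a then
      (if x = [] then 0 else ascentSum x y (fun s => g (false :: s))) +
      (match y with
        | 0 => 0
        | k + 1 => ascentSum x k (fun s => g (true :: s)))
      else 0

theorem markSum_add (x : List ℕ) : ∀ (y : ℕ) (g g' : List Mark → ℕ∞),
    markSum x y (fun s => g s + g' s) = markSum x y g + markSum x y g' := by
  induction x with
  | nil => intro y g g'; simp only [markSum]; split_ifs <;> simp
  | cons a x ih =>
    intro y g g'
    rcases y with _ | k
    · simp only [markSum]
      split_ifs <;> simp [ih]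
    · simp only [markSum, ih]
      split_ifs <;> ring

theorem ascentSum_add (x : List ℕ) : ∀ (y : ℕ) (g g' : List Bool → ℕ∞),
    ascentSum x y (fun s => g s + g' s) = ascentSum x y g + ascentSum x y g' := by
  induction x with
  | nil => intro y g g'; simp only [ascentSum]; split_ifs <;> simp
  | cons a x ih =>
    intro y g g'
    rcases y with _ | k
    · simp only [ascentSum]
      split_ifs <;> simp [ih]
    · simp only [ascentSum, ih]
      split_ifs <;> ring

theorem markSum_zero (x : List ℕ) : ∀ y, markSum x y (fun _ => 0) = 0 := by
  induction x with
  | nil => intro y; simp [markSum]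
  | cons a x ih => intro y; rcases y with _ | k <;> simp [markSum, ih]

theorem ascentSum_zero (x : List ℕ) : ∀ y, ascentSum x y (fun _ => 0) = 0 := by
  induction x with
  | nil => intro y; simp [ascentSum]
  | cons a x ih => intro y; rcases y with _ | k <;> simp [ascentSum, ih]

theorem markSum_cons_height_zero (x : List ℕ) : ∀ (a : ℕ) (g : List Mark → ℕ∞),
    markSum (a :: x) 0 g = 0 := by
  induction x with
  | nil => intro a g; simp [markSum]
  | cons b x ih => intro a g; rw [markSum]; simp [ih]

theorem ascentSum_cons_height_zero (x : List ℕ) : ∀ (a : ℕ) (g : List Bool → ℕ∞),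
    ascentSum (a :: x) 0 g = 0 := by
  induction x with
  | nil => intro a g; simp [ascentSum]
  | cons b x ih => intro a g; rw [ascentSum]; simp [ih]

theorem markSum_of_headD_lt {x : List ℕ} {y : ℕ} (h : x.headD 0 < y) (g : List Mark → ℕ∞) :
    markSum x y g = 0 := by
  rcases x with _ | ⟨a, x⟩
  · simp at h; simp [markSum]; omega
  · simp at h
    rcases y with _ | k
    · omega
    · rw [markSum, if_neg (by omega)]

theorem ascentSum_of_headD_lt {x : List ℕ} {y : ℕ} (h : x.headD 0 < y) (g : List Bool → ℕ∞) :
    ascentSum x y g = 0 := by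
  rcases x with _ | ⟨a, x⟩
  · simp at h; simp [ascentSum]; omega
  · simp at h
    rcases y with _ | k
    · omega
    · rw [ascentSum, if_neg (by omega)]

theorem markSum_lower {a b : ℕ} (x : List ℕ) (h : a ≤ b) (g : List Mark → ℕ∞) :
    markSum (b :: x) a g = markSum (a :: x) a g := by
  rcases a with _ | k <;> simp [markSum, h]

theorem ascentSum_lower {a b : ℕ} (x : List ℕ) (h : a ≤ b) (g : List Bool → ℕ∞) :
    ascentSum (b :: x) a g = ascentSum (a :: x) a g := by
  rcases a with _ | k <;> simp [ascentSum, h]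

/-- Inserting a new largest entry at a cut amounts to adding a last step to a lattice path below
the ceiling, without changing its final height. -/
theorem markSum_insertions (x : List ℕ) : IsCeiling x → ∀ (k : ℕ) (g : List Mark → ℕ∞),
    k + 1 ≤ x.headD 0 →
    markSum x (k + 1) (fun s => ((Mark.insertions s).map g).sum) =
      markSum x (k + 1) (fun s => g (.asc :: s)) + markSum x k (fun s => g (.desc :: s)) := by
  induction x with
  | nil => intro _ k g h; simp at h
  | cons a x ih =>
    rintro ⟨ha, hx⟩ k g h
    replace h : k + 1 ≤ a := h
    have ih' : ∀ g : List Mark → ℕ∞, k ≤ x.headD 0 →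
        markSum x k (fun s => ((Mark.insertions s).map (fun s => g (.desc :: s))).sum) =
          markSum (a :: x) k (fun s => g (.desc :: s)) := by
      intro g hk
      rcases k with _ | k
      · rw [markSum_cons_height_zero]
        rcases x with _ | ⟨b, x⟩
        · simp [markSum, Mark.insertions]
        · rw [markSum_cons_height_zero]
      · have hx0 : x ≠ [] := by rintro rfl; simp at hk
        rw [ih hx k _ hk, markSum, if_pos (by omega), if_neg hx0, if_neg (by omega)]
    have hkx : k ≤ x.headD 0 := by omega
    rw [← ih' g hkx]
    rw [markSum, markSum, if_pos h, if_pos h]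
    -- the last step of a path that ends with a step `1` is a cut if and only if `k = x.headD 0`
    by_cases hk : k = x.headD 0
    · have h1 : ∀ g, (if x = [] then 0 else markSum x (k + 1) g) = 0 := by
        intro g; split_ifs
        · rfl
        · exact markSum_of_headD_lt (by omega) g
      rw [h1, h1, if_pos hk]
      simp only [Mark.insertions, List.map_append, List.sum_append, List.map_map,
        List.map_cons, List.map_nil, List.sum_cons, List.sum_nil, Function.comp_def, Mark.uncut]
      rw [markSum_add]
      simp
    · have hx0 : x ≠ [] := by rintro rfl; simp at hkx; simp [hkx] at hk
      rw [if_neg hx0, if_neg hx0, if_neg hk]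
      simp only [Mark.insertions, List.map_map, List.nil_append, Function.comp_def, Mark.uncut]
      rw [ih hx k (fun s => g (.asc :: s)) (by omega)]

/-- Prolonging or breaking the initial increasing run of a list by a new largest entry likewise
amounts to adding a last step to a lattice path below the ceiling. -/
theorem ascentSum_insertions (x : List ℕ) : IsCeiling x → ∀ (k : ℕ) (g : List Bool → ℕ∞),
    k + 1 ≤ x.headD 0 →
    ascentSum x (k + 1) (fun s => ((ascentInsertions s).map g).sum) =
      ascentSum x (k + 1) (fun s => g (false :: s)) + ascentSum x k (fun s => g (true :: s)) := by
  induction x with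
  | nil => intro _ k g h; simp at h
  | cons a x ih =>
    rintro ⟨ha, hx⟩ k g h
    replace h : k + 1 ≤ a := h
    have ih' : ∀ g : List Bool → ℕ∞, k ≤ x.headD 0 →
        ascentSum x k (fun s => ((ascentInsertions s).map (fun s => g (true :: s))).sum) =
          ascentSum (a :: x) k (fun s => g (true :: s)) := by
      intro g hk
      rcases k with _ | k
      · rw [ascentSum_cons_height_zero]
        rcases x with _ | ⟨b, x⟩
        · simp [ascentSum, ascentInsertions]
        · rw [ascentSum_cons_height_zero]
      · have hx0 : x ≠ [] := by rintro rfl; simp at hk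
        rw [ih hx k _ hk, ascentSum, if_pos (by omega), if_neg hx0]
    have hkx : k ≤ x.headD 0 := by omega
    rw [← ih' g hkx]
    rw [ascentSum, ascentSum, if_pos h, if_pos h]
    simp only [ascentInsertions, List.map_cons, List.map_nil, List.sum_cons, List.sum_nil,
      add_zero, List.map_map, Function.comp_def]
    rw [ascentSum_add, add_assoc]

/-- Both sums see the same unique lattice path all of whose steps are `1`. -/
theorem markSum_noAsc_eq (x : List ℕ) : ∀ (y : ℕ) (c : ℕ → ℕ∞) [DecidablePred Mark.NoAsc]
    [DecidablePred fun s : List Bool => ∀ b ∈ s, b = true],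
    markSum x y (fun s => if Mark.NoAsc s then c s.length else 0) =
      ascentSum x y (fun s => if ∀ b ∈ s, b = true then c s.length else 0) := by
  induction x with
  | nil => intro y c _ _; simp [markSum, ascentSum, Mark.NoAsc]
  | cons a x ih =>
    intro y c _ _
    rcases y with _ | k
    · simp [markSum, ascentSum, Mark.NoAsc, markSum_zero, ascentSum_zero]
    · rw [markSum, ascentSum]
      have h1 : ∀ s, Mark.NoAsc (.asc :: s) ↔ False := by simp [Mark.NoAsc]
      have h2 : ∀ s, Mark.NoAsc ((if k = x.headD 0 then .cut else .desc) :: s) ↔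
          Mark.NoAsc s := by intro s; split_ifs <;> simp [Mark.NoAsc]
      simp only [h1, h2, if_false, markSum_zero, List.length_cons, List.forall_mem_cons,
        Bool.false_eq_true, false_and, ascentSum_zero, true_and]
      rw [ih k (fun n => c (n + 1))]

/-- Summed over the lattice paths below any ceiling, the two counts agree: both sums obey the same
recursion along the border word. -/
theorem markSum_markCount_eq {α : Type} (w : List (BorderStep α)) : ∀ x : List ℕ, IsCeiling x →
    markSum x (x.headD 0) (markCount w) = ascentSum x (x.headD 0) (ascentCount w) := by
  induction w with
  | nil =>
    intro x _
    rw [show markCount ([] : List (BorderStep α)) = fun _ => 0 from rfl,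
      show ascentCount ([] : List (BorderStep α)) = fun _ => 0 from rfl,
      markSum_zero, ascentSum_zero]
  | cons st w ih =>
    intro x hx
    rcases st with j | r | _
    · rw [show markCount (.col j :: w) = fun s => markCount w (.cut :: s) +
          ((Mark.insertions s).map (markCount w)).sum from rfl,
        show ascentCount (.col j :: w) = fun s => ascentCount w (true :: s) +
          ((ascentInsertions s).map (ascentCount w)).sum from rfl, markSum_add, ascentSum_add]
      -- a new column in front of the list prolongs the ceiling by a step up; summed over the other
      -- places, it prolongs the ceiling horizontally
      have h1 := ih ((x.headD 0 + 1) :: x) ⟨le_rfl, hx⟩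
      have h2 := ih (x.headD 0 :: x) ⟨Nat.le_succ _, hx⟩
      simp only [List.headD_cons] at h1 h2
      rw [markSum, ascentSum] at h1
      have e1 : ∀ g, (if x = [] then 0 else markSum x (x.headD 0 + 1) g) = 0 := by
        intro g; split_ifs
        · rfl
        · exact markSum_of_headD_lt (Nat.lt_succ_self _) g
      have e2 : ∀ g, (if x = [] then 0 else ascentSum x (x.headD 0 + 1) g) = 0 := by
        intro g; split_ifs
        · rfl
        · exact ascentSum_of_headD_lt (Nat.lt_succ_self _) g
      simp only [e1, e2, le_refl, if_true, zero_add] at h1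
      rw [h1]
      congr 1
      rcases x with _ | ⟨a, x⟩
      · simp [markSum, ascentSum, Mark.insertions, ascentInsertions]
      rcases a with _ | k
      · simp only [List.headD_cons, markSum_cons_height_zero, ascentSum_cons_height_zero]
      · simp only [List.headD_cons] at h2 ⊢
        rw [markSum_insertions _ hx k _ (by simp), ascentSum_insertions _ hx k _ (by simp)]
        rw [markSum, ascentSum] at h2
        simpa using h2
    · rcases x with _ | ⟨a, x⟩
      · simp [markSum, ascentSum, markCount, ascentCount]
      -- a row removes the last step, and the ceiling may be lowered to the end of the path
      have key : ∀ y, markSum x y (markCount w) = ascentSum x y (ascentCount w) := by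
        intro y
        rcases x with _ | ⟨b, x⟩
        · have h0 : markCount w [] = ascentCount w [] := by
            simpa [markSum, ascentSum] using ih [] trivial
          simp [markSum, ascentSum, h0]
        · by_cases hy : y ≤ b
          · rw [markSum_lower x hy, ascentSum_lower x hy]
            exact ih (y :: x) ⟨hy.trans hx.2.1, hx.2.2⟩
          · rw [markSum_of_headD_lt (by simpa using hy), ascentSum_of_headD_lt (by simpa using hy)]
      rcases a with _ | k
      · simp [markSum, ascentSum, markCount, ascentCount, key]
      · simp [markSum, ascentSum, markCount, ascentCount, key]
    · classical
      simp only [markCount, ascentCount]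
      convert markSum_noAsc_eq x _ (forcedCount w)

/-- From the empty list, the two counts agree. -/
theorem markCount_nil_eq {α : Type} (w : List (BorderStep α)) :
    markCount w [] = ascentCount w [] := by
  simpa [markSum, ascentSum] using markSum_markCount_eq w [] trivial

/-! ### Marks and ascents of lists -/

/-- The ways to split a list into a nonempty prefix and a suffix. -/
def properSplits {α : Type} : List α → List (List α × List α)
  | [] => []
  | a :: l => ([a], l) :: (properSplits l).map (fun q => (a :: q.1, q.2))

/-- The ways to split a list into a prefix and a suffix. -/
def splits {α : Type} (l : List α) : List (List α × List α) :=
  ([], l) :: properSplits l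

theorem mem_properSplits {α : Type} {l : List α} : ∀ {q : List α × List α},
    q ∈ properSplits l ↔ q.1 ≠ [] ∧ q.1 ++ q.2 = l := by
  induction l with
  | nil => rintro ⟨q1, q2⟩; simp [properSplits]; tauto
  | cons a l ih =>
    rintro ⟨q1, q2⟩
    simp only [properSplits, List.mem_cons, List.mem_map, ih]
    constructor
    · rintro (h | ⟨⟨p1, p2⟩, ⟨_, h2⟩, h⟩)
      · simp at h; simp [h.1, h.2]
      · simp at h; obtain ⟨rfl, rfl⟩ := h; simpa using h2
    · rintro ⟨h1, h2⟩
      rcases q1 with _ | ⟨b, q1⟩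
      · simp at h1
      · simp only [List.cons_append, List.cons.injEq] at h2
        obtain ⟨rfl, h2⟩ := h2
        rcases q1 with _ | ⟨c, q1⟩
        · left; simpa using h2
        · right; exact ⟨(c :: q1, q2), ⟨by simp, h2⟩, rfl⟩

theorem mem_splits {α : Type} {l : List α} {q : List α × List α} :
    q ∈ splits l ↔ q.1 ++ q.2 = l := by
  rw [splits, List.mem_cons, mem_properSplits]
  rcases q with ⟨q1, q2⟩
  rcases q1 with _ | ⟨a, q1⟩ <;> simp

theorem nodup_properSplits {α : Type} (l : List α) : (properSplits l).Nodup := by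
  induction l with
  | nil => simp [properSplits]
  | cons a l ih =>
    rw [properSplits, List.nodup_cons]
    refine ⟨?_, ih.map ?_⟩
    · rw [List.mem_map]
      rintro ⟨q, hq, h⟩
      have := (mem_properSplits.1 hq).1
      simp at h
      exact this h.1
    · rintro ⟨a, b⟩ ⟨c, d⟩ h
      simpa using h

theorem nodup_splits {α : Type} (l : List α) : (splits l).Nodup := by
  rw [splits, List.nodup_cons]
  refine ⟨fun h => ?_, nodup_properSplits l⟩
  exact (mem_properSplits.1 h).1 rfl

theorem sum_map_ite_unique {ι : Type} (C : ι → Prop) [DecidablePred C] (F : ι → ℕ∞) (q₀ : ι) :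
    ∀ L : List ι, L.Nodup → q₀ ∈ L → (∀ q ∈ L, C q ↔ q = q₀) →
      (L.map (fun q => if C q then F q else 0)).sum = F q₀ := by
  intro L hL h0 hC
  classical
  have : (L.map (fun q => if C q then F q else 0)) =
      L.map (fun q => if q = q₀ then F q else 0) := by
    apply List.map_congr_left
    intro q hq
    simp only [hC q hq]
  rw [this, ← List.sum_toFinset _ hL, Finset.sum_ite_eq' L.toFinset q₀ F]
  simp [h0]

open Classical in
/-- The marks of a list, preceded by the entries of `acc`. -/
noncomputable def marks {α : Type} [LinearOrder α] : List α → List α → List Mark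
  | _, [] => []
  | acc, b :: l =>
      (if ∀ a ∈ b :: acc, ∀ c ∈ l, c < a then Mark.cut
        else if ∃ c ∈ l.head?, b < c then Mark.asc else Mark.desc) :: marks (b :: acc) l

/-- The ascent word of a list; the last entry counts as an ascent. -/
def ascents {α : Type} [LinearOrder α] : List α → List Bool
  | [] => []
  | b :: l => decide (∀ c ∈ l.head?, b < c) :: ascents l

section

variable {α : Type} [LinearOrder α]

theorem length_marks (l : List α) : ∀ acc, (marks acc l).length = l.length := by
  induction l with
  | nil => simp [marks]
  | cons b l ih => simp [marks, ih]

theorem length_ascents (l : List α) : (ascents l).length = l.length := by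
  induction l with
  | nil => simp [ascents]
  | cons b l ih => simp [ascents, ih]

theorem marks_congr (l : List α) : ∀ acc acc' : List α,
    (∀ c ∈ l, (∀ a ∈ acc, c < a) ↔ (∀ a ∈ acc', c < a)) → marks acc l = marks acc' l := by
  induction l with
  | nil => intros; rfl
  | cons b l ih =>
    intro acc acc' h
    simp only [marks]
    rw [ih (b :: acc) (b :: acc')]
    · have : (∀ a ∈ b :: acc, ∀ c ∈ l, c < a) ↔ (∀ a ∈ b :: acc', ∀ c ∈ l, c < a) := by
        simp only [List.forall_mem_cons]
        apply and_congr_right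
        intro _
        constructor
        · intro H a ha c hc
          exact (h c (by simp [hc])).1 (fun a ha => H a ha c hc) a ha
        · intro H a ha c hc
          exact (h c (by simp [hc])).2 (fun a ha => H a ha c hc) a ha
      simp only [this]
    · intro c hc
      simp only [List.forall_mem_cons, h c (by simp [hc])]

theorem noAsc_marks (l : List α) : ∀ acc, l.Nodup →
    (Mark.NoAsc (marks acc l) ↔ l.Pairwise (fun a b => b < a)) := by
  induction l with
  | nil => simp [marks, Mark.NoAsc]
  | cons b l ih =>
    intro acc hl
    rw [List.nodup_cons] at hl
    rw [marks, Mark.NoAsc, List.forall_mem_cons, ← Mark.NoAsc, ih _ hl.2, List.pairwise_cons]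
    apply and_congr_left
    intro hp
    split_ifs with h1 h2
    · simp only [ne_eq, reduceCtorEq, not_false_eq_true, true_iff]
      exact h1 b (by simp)
    · simp only [ne_eq, not_true_eq_false, false_iff]
      obtain ⟨c, hc, hbc⟩ := h2
      intro H
      exact lt_asymm hbc (H c (List.mem_of_mem_head? hc))
    · simp only [ne_eq, reduceCtorEq, not_false_eq_true, true_iff]
      rcases l with _ | ⟨c, l⟩
      · simp
      · simp only [List.head?_cons, Option.mem_def, Option.some.injEq, exists_eq_left',
          not_lt] at h2
        have hcb : c < b := lt_of_le_of_ne h2 (by rintro rfl; simp at hl)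
        rw [List.pairwise_cons] at hp
        intro d hd
        rcases List.mem_cons.1 hd with rfl | hd
        · exact hcb
        · exact (hp.1 d hd).trans hcb

theorem ascents_all_true (l : List α) :
    (∀ b ∈ ascents l, b = true) ↔ l.Pairwise (· < ·) := by
  rw [← List.isChain_iff_pairwise]
  induction l with
  | nil => simp [ascents]
  | cons b l ih =>
    rw [ascents, List.forall_mem_cons, ih, List.isChain_cons]
    simp

open Classical in
/-- Inserting a new largest entry `j` into a list at its proper cuts changes its marks by
`Mark.insertions`. -/
theorem sum_properSplits_marks (j : α) (l : List α) : ∀ (acc : List α) (g : List Mark → ℕ∞),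
    (∀ a ∈ l, a < j) →
    ((properSplits l).map (fun q => if ∀ a ∈ acc ++ q.1, ∀ c ∈ q.2, c < a then
      g (marks acc (q.1 ++ j :: q.2)) else 0)).sum =
    ((Mark.insertions (marks acc l)).map g).sum := by
  induction l with
  | nil => intro acc g _; simp [properSplits, marks, Mark.insertions]
  | cons b l ih =>
    intro acc g hj
    rw [List.forall_mem_cons] at hj
    simp only [properSplits, List.map_cons, List.sum_cons, List.map_map, Function.comp_def, marks,
      Mark.insertions, List.map_append, List.sum_append]
    congr 1
    · have e : (∀ a ∈ acc ++ [b], ∀ c ∈ l, c < a) ↔ (∀ a ∈ b :: acc, ∀ c ∈ l, c < a) := by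
        simp only [List.mem_append, List.mem_cons, List.not_mem_nil, or_false, or_comm (b := _ = b)]
      by_cases hc : ∀ a ∈ b :: acc, ∀ c ∈ l, c < a
      · rw [if_pos (e.2 hc), if_pos hc]
        have h1 : ¬ ∀ a ∈ b :: acc, ∀ c ∈ j :: l, c < a := fun H =>
          lt_asymm hj.1 (H b (by simp) j (by simp))
        have h3 : ∀ a ∈ j :: b :: acc, ∀ c ∈ l, c < a := by
          rw [List.forall_mem_cons]; exact ⟨hj.2, hc⟩
        simp only [List.cons_append, List.nil_append, marks]
        rw [if_neg h1, if_pos (by simpa using hj.1), if_pos h3,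
          marks_congr l (j :: b :: acc) (b :: acc)]
        · simp
        · intro c hc'
          simp [hj.2 c hc']
      · rw [if_neg (fun h => hc (e.1 h)), if_neg hc]
        split_ifs <;> simp
    · rw [← ih (b :: acc) _ hj.2]
      congr 1
      apply List.map_congr_left
      rintro ⟨q1, q2⟩ hq
      obtain ⟨hq1, hq2⟩ := mem_properSplits.1 hq
      simp only at hq1 hq2
      rcases q1 with _ | ⟨c, q1⟩
      · simp at hq1
      subst hq2
      have e : (∀ a ∈ acc ++ b :: c :: q1, ∀ d ∈ q2, d < a) ↔
          (∀ a ∈ b :: acc ++ c :: q1, ∀ d ∈ q2, d < a) := by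
        simp only [List.mem_append, List.mem_cons]
        constructor
        · intro H a ha; exact H a (by tauto)
        · intro H a ha; exact H a (by tauto)
      simp only [e, List.cons_append, marks]
      have h1 : ¬ ∀ a ∈ b :: acc, ∀ d ∈ c :: (q1 ++ j :: q2), d < a := fun H =>
        lt_asymm hj.1 (H b (by simp) j (by simp))
      rw [if_neg h1]
      simp only [List.head?_cons, Option.mem_def, Option.some.injEq, exists_eq_left']
      by_cases hbc : b < c
      · have h2 : ¬ ∀ a ∈ b :: acc, ∀ d ∈ c :: (q1 ++ q2), d < a := fun H =>
          lt_asymm hbc (H b (by simp) c (by simp))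
        simp [hbc, Mark.uncut, -List.mem_cons, h2]
      · simp only [hbc, if_false]
        split_ifs <;> simp_all [Mark.uncut]

open Classical in
theorem sum_splits_marks (j : α) (l : List α) (g : List Mark → ℕ∞) (hj : ∀ a ∈ l, a < j) :
    ((splits l).map (fun q => if ∀ a ∈ q.1, ∀ c ∈ q.2, c < a then
      g (marks [] (q.1 ++ j :: q.2)) else 0)).sum =
    g (.cut :: marks [] l) + ((Mark.insertions (marks [] l)).map g).sum := by
  rw [← sum_properSplits_marks j l [] g hj]
  simp only [splits, List.map_cons, List.sum_cons, List.nil_append]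
  congr 1
  rw [if_pos (by simp), marks, if_pos (by simpa using hj), marks_congr l [j] []]
  intro c hc
  simpa using hj c hc

open Classical in
/-- Inserting a new largest entry `j` into the initial increasing run of a list prolongs the run
or changes the ascent word by `ascentInsertions`. -/
theorem sum_splits_ascents (j : α) (l : List α) : ∀ (g : List Bool → ℕ∞), (∀ a ∈ l, a < j) →
    ((splits l).map (fun q => if q.1.Pairwise (· < ·) then
      g (ascents (q.1 ++ j :: q.2)) else 0)).sum =
    g (true :: ascents l) + ((ascentInsertions (ascents l)).map g).sum := by
  simp only [← List.isChain_iff_pairwise]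
  induction l with
  | nil => intro g _; simp [splits, properSplits, ascents, ascentInsertions]
  | cons b l ih =>
    intro g hj
    rw [List.forall_mem_cons] at hj
    have ih' := ih (fun s => g (true :: s)) hj.2
    have hja : ascents (j :: b :: l) = false :: ascents (b :: l) := by
      rw [ascents]; simp [hj.1.le]
    simp only [splits, properSplits, List.map_cons, List.sum_cons, List.map_map, Function.comp_def,
      List.nil_append, List.isChain_nil, if_true, hja, List.isChain_singleton,
      List.cons_append] at ih' ⊢
    have hbj : ascents (b :: j :: l) = true :: ascents (j :: l) := by
      rw [ascents]; simp [hj.1]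
    rw [hbj]
    by_cases hb : ∀ c ∈ l.head?, b < c
    · have e1 : ascents (b :: l) = true :: ascents l := by rw [ascents, decide_eq_true hb]
      rw [e1]
      simp only [ascentInsertions, List.map_cons, List.sum_cons, List.map_map, Function.comp_def]
      have e2 : ((properSplits l).map (fun q => if (b :: q.1).IsChain (· < ·) then
          g (ascents (b :: (q.1 ++ j :: q.2))) else 0)) =
          (properSplits l).map (fun q => if q.1.IsChain (· < ·) then
            g (true :: ascents (q.1 ++ j :: q.2)) else 0) := by
        apply List.map_congr_left
        rintro ⟨q1, q2⟩ hq
        obtain ⟨hq1, hq2⟩ := mem_properSplits.1 hq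
        simp only at hq1 hq2
        rcases q1 with _ | ⟨c, q1⟩
        · simp at hq1
        subst hq2
        have hbc : b < c := hb c (by simp)
        simp only [List.cons_append, List.isChain_cons_cons, hbc, true_and]
        rw [ascents]
        simp [hbc]
      rw [e2, ih', add_left_comm]
    · have e1 : ascents (b :: l) = false :: ascents l := by rw [ascents, decide_eq_false hb]
      have e2 : ascents (j :: l) = false :: ascents l := by
        rw [ascents]
        rcases l with _ | ⟨c, l⟩
        · simp at hb
        · have := hj.2 c (by simp)
          simp [this.le]
      rw [e1, e2]
      simp only [ascentInsertions, List.map_cons, List.sum_cons, List.map_nil, List.sum_nil]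
      rw [add_left_comm]
      congr 1
      congr 1
      rw [List.sum_eq_zero]
      intro z hz
      obtain ⟨⟨q1, q2⟩, hq, rfl⟩ := List.mem_map.1 hz
      obtain ⟨hq1, hq2⟩ := mem_properSplits.1 hq
      simp only at hq1 hq2
      rcases q1 with _ | ⟨c, q1⟩
      · simp at hq1
      subst hq2
      have hbc : ¬ b < c := by simpa using hb
      simp [hbc]

end

/-! ### Reading a transversal along the border -/

section

variable {α : Type}

/-- Reading a filling `f` (which gives the row of the 1-cell of each column) along a border word,
starting from the list `l` of the columns whose 1-cells are still ahead, in order of decreasing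
rows. A row must be the row of the first column of the list; a new column `j` splits the list into
the columns with larger rows and the columns with smaller rows, this splitting must satisfy
`cond j`, and `j` is put in between; at the hole-column, the list must satisfy `hc`. -/
def Reads (cond : α → List α → List α → Prop) (hc : List α → Prop) :
    List (BorderStep α) → List α → (α → ℕ) → Prop
  | [], l, _ => l = []
  | .row r :: w, l, f => ∃ a l', l = a :: l' ∧ f a = r ∧ Reads cond hc w l' f
  | .col j :: w, l, f =>
      l.filter (f j < f ·) ++ l.filter (f · < f j) = l ∧
      cond j (l.filter (f j < f ·)) (l.filter (f · < f j)) ∧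
      Reads cond hc w (l.filter (f j < f ·) ++ j :: l.filter (f · < f j)) f
  | .hole :: w, l, f => hc l ∧ Reads cond hc w l f

/-- The fillings that can be read along `w` from the list `l` and agree with `f₀` on all columns
that occur neither in `w` nor in `l`. -/
def readable (cond : α → List α → List α → Prop) (hc : List α → Prop)
    (w : List (BorderStep α)) (l : List α) (f₀ : α → ℕ) : Set (α → ℕ) :=
  {f | (∀ j, j ∉ l → .col j ∉ w → f j = f₀ j) ∧ l.Pairwise (fun a b => f b < f a) ∧
    Reads cond hc w l f}

variable {cond : α → List α → List α → Prop} {hc : List α → Prop}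

theorem Reads.row_mem {w : List (BorderStep α)} : ∀ {l : List α} {f : α → ℕ},
    Reads cond hc w l f → ∀ a ∈ l, .row (f a) ∈ w := by
  induction w with
  | nil => intro l f h a ha; rw [Reads] at h; simp [h] at ha
  | cons s w ih =>
    intro l f h a ha
    rcases s with j | r | _
    · obtain ⟨h1, _, h3⟩ := h
      rw [← h1, List.mem_append] at ha
      refine List.mem_cons_of_mem _ (ih h3 a ?_)
      rw [List.mem_append, List.mem_cons]
      tauto
    · obtain ⟨b, l', rfl, rfl, h3⟩ := h
      rcases List.mem_cons.1 ha with rfl | ha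
      · simp
      · exact List.mem_cons_of_mem _ (ih h3 a ha)
    · exact List.mem_cons_of_mem _ (ih h.2 a ha)

theorem readable_row_nil (w : List (BorderStep α)) (r : ℕ) (f₀ : α → ℕ) :
    readable cond hc (.row r :: w) [] f₀ = ∅ := by
  ext f
  simp [readable, Reads]

theorem encard_eq_sum_fibers {ι β : Type} (S : Set β) (φ : β → ι) :
    ∀ L : List ι, L.Nodup → (∀ f ∈ S, φ f ∈ L) →
      S.encard = (L.map (fun q => {f ∈ S | φ f = q}.encard)).sum := by
  intro L
  induction L generalizing S with
  | nil =>
    intro _ h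
    have : S = ∅ := Set.eq_empty_of_forall_notMem fun f hf => by simpa using h f hf
    simp [this]
  | cons q L ih =>
    intro hL h
    rw [List.nodup_cons] at hL
    have hS : S = {f ∈ S | φ f = q} ∪ {f ∈ S | φ f ≠ q} := by
      ext f; by_cases hf : φ f = q <;> simp [hf]
    have hd : Disjoint {f ∈ S | φ f = q} {f ∈ S | φ f ≠ q} := by
      rw [Set.disjoint_left]; rintro f ⟨_, h1⟩ ⟨_, h2⟩; exact h2 h1
    rw [List.map_cons, List.sum_cons]
    conv_lhs => rw [hS, Set.encard_union_eq hd]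
    congr 1
    rw [ih {f ∈ S | φ f ≠ q} hL.2]
    · congr 1
      apply List.map_congr_left
      intro p hp
      congr 1
      ext f
      constructor
      · rintro ⟨⟨h1, _⟩, h2⟩; exact ⟨h1, h2⟩
      · rintro ⟨h1, h2⟩; exact ⟨⟨h1, by rintro h3; apply hL.1; rwa [← h3, h2]⟩, h2⟩
    · rintro f ⟨h1, h2⟩
      exact (List.mem_cons.1 (h f h1)).resolve_left h2

open Classical in
/-- At a new column, the fillings are sorted by the place at which the column enters the list. -/
theorem encard_readable_col (w : List (BorderStep α)) (j : α) (l : List α) (f₀ : α → ℕ) :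
    (readable cond hc (.col j :: w) l f₀).encard =
      ((splits l).map (fun q => if cond j q.1 q.2 then
        (readable cond hc w (q.1 ++ j :: q.2) f₀).encard else 0)).sum := by
  rw [encard_eq_sum_fibers _ (fun f => (l.filter (f j < f ·), l.filter (f · < f j))) (splits l)
    (nodup_splits l)]
  · congr 1
    apply List.map_congr_left
    rintro ⟨q1, q2⟩ hq
    rw [mem_splits] at hq
    simp only at hq ⊢
    have : {f ∈ readable cond hc (.col j :: w) l f₀ |
        (l.filter (f j < f ·), l.filter (f · < f j)) = (q1, q2)} =
        if cond j q1 q2 then readable cond hc w (q1 ++ j :: q2) f₀ else ∅ := by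
      ext f
      constructor
      · rintro ⟨⟨h1, h2, h3, h4, h5⟩, h6⟩
        obtain ⟨e1, e2⟩ := Prod.mk.inj h6
        rw [e1, e2] at h4 h5
        rw [if_pos h4]
        refine ⟨fun k hk hkw => ?_, ?_, h5⟩
        · rw [List.mem_append, List.mem_cons, ← or_assoc, or_right_comm, ← List.mem_append, hq,
            not_or] at hk
          exact h1 k hk.1 (by simp [hkw, hk.2])
        · rw [← hq, List.pairwise_append] at h2
          rw [List.pairwise_append, List.pairwise_cons]
          have m1 : ∀ a ∈ q1, f j < f a := by
            intro a ha; rw [← e1] at ha; simpa using (List.mem_filter.1 ha).2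
          have m2 : ∀ a ∈ q2, f a < f j := by
            intro a ha; rw [← e2] at ha; simpa using (List.mem_filter.1 ha).2
          refine ⟨h2.1, ⟨m2, h2.2.1⟩, fun a ha b hb => ?_⟩
          rcases List.mem_cons.1 hb with rfl | hb
          · exact m1 a ha
          · exact h2.2.2 a ha b hb
      · intro h
        by_cases hcq : cond j q1 q2
        swap
        · rw [if_neg hcq] at h; exact h.elim
        rw [if_pos hcq] at h
        obtain ⟨h1, h2, h3⟩ := h
        rw [List.pairwise_append, List.pairwise_cons] at h2
        have m1 : ∀ a ∈ q1, f j < f a := fun a ha => h2.2.2 a ha j (by simp)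
        have m2 : ∀ a ∈ q2, f a < f j := h2.2.1.1
        have e1 : l.filter (f j < f ·) = q1 := by
          rw [← hq, List.filter_append, List.filter_eq_self.2 (by simpa using m1),
            List.filter_eq_nil_iff.2 (by simpa using fun a ha => (m2 a ha).le), List.append_nil]
        have e2 : l.filter (f · < f j) = q2 := by
          rw [← hq, List.filter_append, List.filter_eq_nil_iff.2
            (by simpa using fun a ha => (m1 a ha).le),
            List.filter_eq_self.2 (by simpa using m2), List.nil_append]
        refine ⟨⟨fun k hk hkw => ?_, ?_, ?_⟩, by rw [e1, e2]⟩
        · rw [List.mem_cons, not_or] at hkw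
          refine h1 k ?_ hkw.2
          rw [List.mem_append, List.mem_cons, ← or_assoc, or_right_comm, ← List.mem_append, hq,
            not_or]
          exact ⟨hk, fun e => hkw.1 (by rw [e])⟩
        · rw [← hq, List.pairwise_append]
          exact ⟨h2.1, h2.2.1.2, fun a ha b hb => h2.2.2 a ha b (by simp [hb])⟩
        · rw [Reads, e1, e2]
          exact ⟨hq, hcq, h3⟩
    rw [this]
    split_ifs <;> simp
  · rintro f ⟨_, _, h, _⟩
    exact mem_splits.2 h

theorem encard_readable_nil (l : List α) (f₀ : α → ℕ) :
    (readable cond hc [] l f₀).encard = if l.length = 0 then 1 else 0 := by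
  rcases l with _ | ⟨a, l⟩
  · have : readable cond hc [] [] f₀ = {f₀} := by
      ext f
      simp [readable, Reads, funext_iff]
    simp [this]
  · have : readable cond hc [] (a :: l) f₀ = ∅ := by
      ext f
      simp [readable, Reads]
    simp [this]

theorem encard_readable_hole (w : List (BorderStep α)) (l : List α) (f₀ : α → ℕ)
    [Decidable (hc l)] : (readable cond hc (.hole :: w) l f₀).encard =
      if hc l then (readable cond hc w l f₀).encard else 0 := by
  split_ifs with h
  · congr 1
    ext f
    simp [readable, Reads, h]
  · have : readable cond hc (.hole :: w) l f₀ = ∅ := by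
      ext f
      simp [readable, Reads, h]
    simp [this]

theorem mem_insert_append {j a : α} {p s : List α} :
    a ∈ p ++ j :: s ↔ a ∈ p ++ s ∨ a = j := by
  simp only [List.mem_append, List.mem_cons]; tauto

variable [LinearOrder α]

/-- The order of two steps of a border word: columns from left to right, rows from top to
bottom. -/
def BorderStep.Before : BorderStep α → BorderStep α → Prop
  | .col i, .col j => i < j
  | .row r, .row s => s < r
  | _, _ => True

theorem readable_row {w : List (BorderStep α)} {r : ℕ} {a : α} {l : List α} (f₀ : α → ℕ)
    (hw : (BorderStep.row r :: w).Pairwise BorderStep.Before) (ha : a ∉ l) (haw : .col a ∉ w) :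
    readable cond hc (.row r :: w) (a :: l) f₀ =
      readable cond hc w l (Function.update f₀ a r) := by
  ext f
  constructor
  · rintro ⟨h1, h2, b, l', h, hr, h3⟩
    obtain ⟨rfl, rfl⟩ := List.cons.inj h
    refine ⟨fun j hj hjw => ?_, h2.of_cons, h3⟩
    by_cases hja : j = a
    · subst hja; simpa using hr
    · rw [Function.update_of_ne hja]
      exact h1 j (by simp [hja, hj]) (by simpa using hjw)
  · rintro ⟨h1, h2, h3⟩
    have hfa : f a = r := by simpa using h1 a ha haw
    refine ⟨fun j hj hjw => ?_, List.pairwise_cons.2 ⟨fun b hb => ?_, h2⟩, a, l, rfl, hfa, h3⟩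
    · rw [List.mem_cons, not_or] at hj
      rw [h1 j hj.2 (fun h => hjw (List.mem_cons_of_mem _ h)), Function.update_of_ne hj.1]
    · rw [hfa]
      exact (List.pairwise_cons.1 hw).1 _ (h3.row_mem b hb)

/-- The splitting condition for the pattern `312`; `B` holds for the columns to the left of the
hole-column. -/
def cond312 (B : α → Prop) (j : α) (p s : List α) : Prop :=
  (B j → ∀ a ∈ p, ∀ b ∈ s, b < a) ∧ (¬ B j → (∀ a ∈ p, ¬ B a) ∧ ∀ b ∈ s, B b)

/-- The splitting condition for the pattern `231`; `B` holds for the columns to the left of the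
hole-column. -/
def cond231 (B : α → Prop) (j : α) (p _s : List α) : Prop :=
  (B j → p.Pairwise (· < ·)) ∧ (¬ B j → p = [])

/-- A list and a border word that describe a stage of reading. -/
structure IsStage (w : List (BorderStep α)) (l : List α) : Prop where
  pairwise : w.Pairwise BorderStep.Before
  nodup : l.Nodup
  lt_of_mem : ∀ a ∈ l, ∀ j, .col j ∈ w → a < j

theorem IsStage.row {w : List (BorderStep α)} {r : ℕ} {a : α} {l : List α}
    (h : IsStage (.row r :: w) (a :: l)) : IsStage w l where
  pairwise := h.pairwise.of_cons
  nodup := h.nodup.of_cons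
  lt_of_mem b hb j hj := h.lt_of_mem b (by simp [hb]) j (by simp [hj])

theorem IsStage.col {w : List (BorderStep α)} {j : α} {p s : List α}
    (h : IsStage (.col j :: w) (p ++ s)) : IsStage w (p ++ j :: s) where
  pairwise := h.pairwise.of_cons
  nodup := by
    rw [List.nodup_middle, List.nodup_cons]
    exact ⟨fun hj => lt_irrefl j (h.lt_of_mem j hj j (by simp)), h.nodup⟩
  lt_of_mem a ha k hk := by
    rw [List.mem_append, List.mem_cons, ← or_assoc, or_right_comm, ← List.mem_append] at ha
    rcases ha with ha | rfl
    · exact h.lt_of_mem a ha k (by simp [hk])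
    · exact (List.pairwise_cons.1 h.pairwise).1 _ hk

theorem IsStage.hole {w : List (BorderStep α)} {l : List α}
    (h : IsStage (.hole :: w) l) : IsStage w l where
  pairwise := h.pairwise.of_cons
  nodup := h.nodup
  lt_of_mem b hb j hj := h.lt_of_mem b hb j (by simp [hj])

theorem IsStage.readable_row {w : List (BorderStep α)} {r : ℕ} {a : α} {l : List α}
    (h : IsStage (.row r :: w) (a :: l)) (f₀ : α → ℕ) :
    readable cond hc (.row r :: w) (a :: l) f₀ =
      readable cond hc w l (Function.update f₀ a r) :=
  _root_.readable_row f₀ h.pairwise (List.nodup_cons.1 h.nodup).1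
    fun ha => lt_irrefl a (h.lt_of_mem a (by simp) a (by simp [ha]))

open Classical in
/-- If every insertion is forced, there is at most one way to read. -/
theorem encard_readable_eq_forcedCount (I : List α → Prop)
    (hrow : ∀ a l, I (a :: l) → I l) (w : List (BorderStep α)) :
    ∀ (l : List α) (f₀ : α → ℕ), IsStage w l → .hole ∉ w → I l →
    (∀ j, .col j ∈ w → ∀ l, I l → ∃ q₀ ∈ splits l, (∀ q ∈ splits l, cond j q.1 q.2 ↔ q = q₀) ∧
      I (q₀.1 ++ j :: q₀.2)) →
    (readable cond hc w l f₀).encard = forcedCount w l.length := by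
  induction w with
  | nil => intro l f₀ _ _ _ _; rw [encard_readable_nil, forcedCount]
  | cons s w ih =>
    intro l f₀ hs hh hI H
    rcases s with j | r | _
    · obtain ⟨q₀, hq₀, hq, hI'⟩ := H j (by simp) l hI
      rw [encard_readable_col, sum_map_ite_unique _ _ q₀ _ (nodup_splits l) hq₀ hq]
      rw [mem_splits] at hq₀
      rw [ih _ _ (IsStage.col (by rwa [hq₀])) (fun h => hh (by simp [h])) hI'
        (fun k hk => H k (by simp [hk])), forcedCount]
      congr 1
      simp [← hq₀]; omega
    · rcases l with _ | ⟨a, l⟩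
      · rw [readable_row_nil]; simp [forcedCount]
      · rw [hs.readable_row, ih _ _ hs.row (fun h => hh (by simp [h])) (hrow a l hI)
          (fun k hk => H k (by simp [hk]))]
        rfl
    · simp at hh

/-- Right of the hole-column, the list consists of columns right of the hole followed by columns
left of it, and a new column must be put in between. -/
theorem encard_readable_forced312 (B : α → Prop) (w : List (BorderStep α)) (l : List α)
    (f₀ : α → ℕ) (hs : IsStage w l) (hh : .hole ∉ w) (hw : ∀ j, .col j ∈ w → ¬ B j)
    (hl : ∀ a ∈ l, B a) :
    (readable (cond312 B) hc w l f₀).encard = forcedCount w l.length := by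
  refine encard_readable_eq_forcedCount
    (fun l => ∃ p s, l = p ++ s ∧ (∀ a ∈ p, ¬ B a) ∧ ∀ b ∈ s, B b) ?_ w l f₀ hs hh
    ⟨[], l, rfl, by simp, hl⟩ ?_
  · rintro a l ⟨p, s, h, hp, hs⟩
    rcases p with _ | ⟨c, p⟩
    · exact ⟨[], l, rfl, by simp, fun b hb => hs b (by rw [List.nil_append] at h; simp [← h, hb])⟩
    · obtain ⟨rfl, rfl⟩ := List.cons.inj h
      exact ⟨p, s, rfl, fun a ha => hp a (by simp [ha]), hs⟩
  · rintro j hj l ⟨p, s, rfl, hp, hs⟩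
    refine ⟨(p, s), mem_splits.2 rfl, ?_, p ++ [j], s, by simp, ?_, hs⟩
    · rintro ⟨p', s'⟩ hq
      rw [mem_splits] at hq
      simp only [cond312, hw j hj, false_imp_iff, not_false_eq_true, true_imp_iff, true_and]
      constructor
      · rintro ⟨hp', hs'⟩
        rcases List.append_eq_append_iff.1 hq with ⟨t, rfl, rfl⟩ | ⟨t, rfl, rfl⟩
        · rcases t with _ | ⟨a, t⟩
          · simp
          · exact absurd (hs' a (by simp)) (hp a (by simp))
        · rcases t with _ | ⟨a, t⟩
          · simp
          · exact absurd (hs a (by simp)) (hp' a (by simp))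
      · intro h
        obtain ⟨rfl, rfl⟩ := Prod.mk.inj h
        exact ⟨hp, hs⟩
    · intro a ha
      rw [List.mem_append, List.mem_singleton] at ha
      rcases ha with ha | rfl
      · exact hp a ha
      · exact hw a hj

/-- Right of the hole-column, a new column must be put in front of the list. -/
theorem encard_readable_forced231 (B : α → Prop) (w : List (BorderStep α)) (l : List α)
    (f₀ : α → ℕ) (hs : IsStage w l) (hh : .hole ∉ w) (hw : ∀ j, .col j ∈ w → ¬ B j) :
    (readable (cond231 B) hc w l f₀).encard = forcedCount w l.length := by
  refine encard_readable_eq_forcedCount (fun _ => True) (fun _ _ _ => trivial) w l f₀ hs hh trivial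
    ?_
  rintro j hj l _
  refine ⟨([], l), mem_splits.2 rfl, ?_, trivial⟩
  rintro ⟨p, s⟩ hq
  rw [mem_splits] at hq
  simp only [cond231, hw j hj, false_imp_iff, not_false_eq_true, true_imp_iff, true_and,
    Prod.mk.injEq]
  constructor
  · rintro rfl; exact ⟨rfl, hq⟩
  · exact fun h => h.1

/-- A list avoids the pattern `132`. -/
def ListAvoids132 : List α → Prop
  | [] => True
  | a :: l => l.Pairwise (fun b c => ¬ (a < c ∧ c < b)) ∧ ListAvoids132 l

theorem ListAvoids132.insert {j : α} {s : List α} : ∀ {p : List α},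
    ListAvoids132 (p ++ s) → (∀ a ∈ p ++ s, a < j) → (∀ a ∈ p, ∀ b ∈ s, b < a) →
    ListAvoids132 (p ++ j :: s) := by
  intro p
  induction p with
  | nil =>
    intro h hj _
    refine ⟨List.pairwise_of_forall_mem_list fun b hb c hc => ?_, h⟩
    rintro ⟨h1, _⟩
    exact lt_asymm h1 (hj c (by simpa using hc))
  | cons a p ih =>
    rw [List.cons_append, List.cons_append]
    rintro ⟨h1, h2⟩ hj hc
    rw [List.forall_mem_cons] at hj
    refine ⟨?_, ih h2 hj.2 fun a ha => hc a (by simp [ha])⟩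
    rw [List.pairwise_append] at h1
    rw [List.pairwise_append, List.pairwise_cons]
    refine ⟨h1.1, ⟨fun c hcs h => ?_, h1.2.1⟩, fun b hb c hcs => ?_⟩
    · exact lt_asymm h.1 (hc a (by simp) c hcs)
    · rcases List.mem_cons.1 hcs with rfl | hcs
      · exact fun h => lt_asymm h.2 (hj.2 b (by simp [hb]))
      · exact h1.2.2 b hb c hcs

/-- In a list that avoids `132`, the first entry plays no role for the marks of the others. -/
theorem marks_tail {a : α} (l : List α) : ∀ (acc acc' : List α),
    (∀ x, x ∈ acc' ↔ x = a ∨ x ∈ acc) → l.Pairwise (fun b c => ¬ (a < c ∧ c < b)) → a ∉ l →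
    marks acc' l = marks acc l := by
  induction l with
  | nil => intros; rfl
  | cons b l ih =>
    intro acc acc' h hp ha
    rw [List.pairwise_cons] at hp
    rw [List.mem_cons, not_or] at ha
    rw [marks, marks, ih (b :: acc) (b :: acc') (by simp only [List.mem_cons, h]; tauto) hp.2 ha.2]
    have e : (∀ x ∈ b :: acc', ∀ c ∈ l, c < x) ↔ (∀ x ∈ b :: acc, ∀ c ∈ l, c < x) := by
      constructor
      · intro H x hx
        exact H x (by simp only [List.mem_cons, h] at hx ⊢; tauto)
      · intro H x hx c hc
        have hbc := H b (by simp) c hc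
        simp only [List.mem_cons, h] at hx
        rcases hx with rfl | rfl | hx
        · exact hbc
        · have := hp.1 c hc
          rcases lt_trichotomy x c with h1 | rfl | h1
          · exact absurd ⟨h1, hbc⟩ this
          · exact absurd hc ha.2
          · exact h1
        · exact H x (by simp [hx]) c hc
    simp only [e]

/-- For `312`, the number of continuations depends only on the word of marks. All lists that arise
avoid `132`, so that removing the first entry leaves the other marks unchanged. -/
theorem encard_readable312 (B : α → Prop) (w₁ w₂ : List (BorderStep α))
    (h₁ : ∀ j, .col j ∈ w₁ → B j) (h₂ : ∀ j, .col j ∈ w₂ → ¬ B j)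
    (hh₁ : .hole ∉ w₁) (hh₂ : .hole ∉ w₂) : ∀ (l : List α) (f₀ : α → ℕ),
    IsStage (w₁ ++ .hole :: w₂) l → (∀ a ∈ l, B a) → ListAvoids132 l →
    (readable (cond312 B) (fun l => l.Pairwise fun a b => b < a) (w₁ ++ .hole :: w₂) l f₀).encard =
      markCount (w₁ ++ .hole :: w₂) (marks [] l) := by
  classical
  induction w₁ with
  | nil =>
    intro l f₀ hs hl _
    rw [List.nil_append] at hs ⊢
    rw [encard_readable_hole, markCount, encard_readable_forced312 B w₂ l f₀ hs.hole hh₂ h₂ hl,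
      length_marks]
    simp only [noAsc_marks l [] hs.nodup]
  | cons s w ih =>
    intro l f₀ hs hl hav
    rw [List.cons_append] at hs ⊢
    have ih' := ih (fun j hj => h₁ j (by simp [hj])) (fun h => hh₁ (by simp [h]))
    rcases s with j | r | _
    · have hBj : B j := h₁ j (by simp)
      have hj : ∀ a ∈ l, a < j := fun a ha => hs.lt_of_mem a ha j (by simp)
      rw [encard_readable_col, markCount, ← sum_splits_marks j l _ hj]
      congr 1
      apply List.map_congr_left
      rintro ⟨p, s⟩ hq
      rw [mem_splits] at hq
      simp only at hq ⊢
      have e : cond312 B j p s ↔ ∀ a ∈ p, ∀ c ∈ s, c < a := by simp [cond312, hBj]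
      by_cases hps : ∀ a ∈ p, ∀ c ∈ s, c < a
      · rw [if_pos (e.2 hps), if_pos hps]
        subst hq
        refine ih' _ _ hs.col ?_ (hav.insert hj hps)
        intro a ha
        rcases mem_insert_append.1 ha with ha | rfl
        · exact hl a ha
        · exact hBj
      · rw [if_neg (fun h => hps (e.1 h)), if_neg hps]
    · rcases l with _ | ⟨a, l⟩
      · rw [readable_row_nil]; simp [marks, markCount]
      · rw [hs.readable_row, ih' _ _ hs.row (fun b hb => hl b (by simp [hb])) hav.2, marks,
          markCount, marks_tail l [] [a] (by simp) hav.1 (List.nodup_cons.1 hs.nodup).1]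
    · simp at hh₁

/-- For `231`, the number of continuations depends only on the ascent word. -/
theorem encard_readable231 (B : α → Prop) (w₁ w₂ : List (BorderStep α))
    (h₁ : ∀ j, .col j ∈ w₁ → B j) (h₂ : ∀ j, .col j ∈ w₂ → ¬ B j)
    (hh₁ : .hole ∉ w₁) (hh₂ : .hole ∉ w₂) : ∀ (l : List α) (f₀ : α → ℕ),
    IsStage (w₁ ++ .hole :: w₂) l →
    (readable (cond231 B) (fun l => l.Pairwise (· < ·)) (w₁ ++ .hole :: w₂) l f₀).encard =
      ascentCount (w₁ ++ .hole :: w₂) (ascents l) := by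
  classical
  induction w₁ with
  | nil =>
    intro l f₀ hs
    rw [List.nil_append] at hs ⊢
    rw [encard_readable_hole, ascentCount, encard_readable_forced231 B w₂ l f₀ hs.hole hh₂ h₂,
      length_ascents]
    simp only [ascents_all_true l]
  | cons s w ih =>
    intro l f₀ hs
    rw [List.cons_append] at hs ⊢
    have ih' := ih (fun j hj => h₁ j (by simp [hj])) (fun h => hh₁ (by simp [h]))
    rcases s with j | r | _
    · have hBj : B j := h₁ j (by simp)
      rw [encard_readable_col, ascentCount, ← sum_splits_ascents j l _
        (fun a ha => hs.lt_of_mem a ha j (by simp))]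
      congr 1
      apply List.map_congr_left
      rintro ⟨p, s⟩ hq
      rw [mem_splits] at hq
      simp only at hq ⊢
      have e : cond231 B j p s ↔ p.Pairwise (· < ·) := by simp [cond231, hBj]
      simp only [e]
      subst hq
      rw [ih' _ _ hs.col]
    · rcases l with _ | ⟨a, l⟩
      · rw [readable_row_nil]; simp [ascents, ascentCount]
      · rw [hs.readable_row, ih' _ _ hs.row, ascents, ascentCount]
    · simp at hh₁

/-- Along a border word, as many fillings can be read under the conditions for `312` as under the
conditions for `231`. -/
theorem encard_readable_eq (B : α → Prop) (w₁ w₂ : List (BorderStep α))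
    (h₁ : ∀ j, .col j ∈ w₁ → B j) (h₂ : ∀ j, .col j ∈ w₂ → ¬ B j)
    (hh₁ : .hole ∉ w₁) (hh₂ : .hole ∉ w₂) (f₀ : α → ℕ)
    (hw : (w₁ ++ .hole :: w₂).Pairwise BorderStep.Before) :
    (readable (cond312 B) (fun l => l.Pairwise fun a b => b < a)
      (w₁ ++ .hole :: w₂) [] f₀).encard =
    (readable (cond231 B) (fun l => l.Pairwise (· < ·)) (w₁ ++ .hole :: w₂) [] f₀).encard := by
  have hs : IsStage (w₁ ++ .hole :: w₂) [] := ⟨hw, by simp, by simp⟩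
  rw [encard_readable312 B w₁ w₂ h₁ h₂ hh₁ hh₂ [] f₀ hs (by simp) trivial,
    encard_readable231 B w₁ w₂ h₁ h₂ hh₁ hh₂ [] f₀ hs, marks, ascents, markCount_nil_eq]

end

/-! ### Reading conditions in terms of the filling -/

section

variable {α κ : Type} [LinearOrder κ]

/-- The columns that are active at the step `s` of the border word `w`: their step lies before `s`
(or they belong to the initial list `l`), and the row of their 1-cell ends after `s`. -/
def activeSet (key : BorderStep α → κ) (w : List (BorderStep α)) (l : List α) (f : α → ℕ)
    (s : BorderStep α) : Set α :=
  {i | (i ∈ l ∨ (.col i ∈ w ∧ key (.col i) < key s)) ∧ .row (f i) ∈ w ∧ key s < key (.row (f i))}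

/-- A filling satisfies the given conditions on the sets of active columns, and all its 1-cells lie
below the border. -/
def SatisfiesAlong (key : BorderStep α → κ) (condS : (α → ℕ) → α → Set α → Prop)
    (hcS : (α → ℕ) → Set α → Prop) (w : List (BorderStep α)) (l : List α) (f : α → ℕ) : Prop :=
  (∀ j, .col j ∈ w → .row (f j) ∈ w ∧ key (.col j) < key (.row (f j))) ∧
  (∀ j, .col j ∈ w → condS f j (activeSet key w l f (.col j))) ∧
  (.hole ∈ w → hcS f (activeSet key w l f .hole))

theorem filter_append_filter_of_pairwise {f : α → ℕ} {c : ℕ} : ∀ {l : List α},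
    l.Pairwise (fun a b => f b < f a) → (∀ a ∈ l, f a ≠ c) →
    l.filter (c < f ·) ++ l.filter (f · < c) = l := by
  intro l
  induction l with
  | nil => simp
  | cons a l ih =>
    intro h hc
    rw [List.pairwise_cons] at h
    rw [List.forall_mem_cons] at hc
    rcases lt_or_gt_of_ne hc.1 with h1 | h1
    · have e1 : (a :: l).filter (c < f ·) = [] := by
        rw [List.filter_eq_nil_iff]
        simp only [decide_eq_true_eq, List.forall_mem_cons, not_lt]
        exact ⟨h1.le, fun b hb => ((h.1 b hb).trans h1).le⟩
      have e2 : (a :: l).filter (f · < c) = a :: l := by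
        rw [List.filter_eq_self]
        simp only [decide_eq_true_eq, List.forall_mem_cons]
        exact ⟨h1, fun b hb => (h.1 b hb).trans h1⟩
      rw [e1, e2, List.nil_append]
    · rw [List.filter_cons_of_pos (by simpa using h1),
        List.filter_cons_of_neg (by simpa using h1.le), List.cons_append, ih h.2 hc.2]

/-- Reading a filling along a border word in order amounts to conditions on the sets of active
columns. -/
theorem reads_iff {cond : α → List α → List α → Prop} {hc : List α → Prop}
    {condS : (α → ℕ) → α → Set α → Prop} {hcS : (α → ℕ) → Set α → Prop}
    (key : BorderStep α → κ) (hrow : ∀ r s, key (.row r) < key (.row s) ↔ s < r) (f : α → ℕ)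
    (hcond : ∀ (l : List α) (j : α), l.Pairwise (fun a b => f b < f a) →
      (cond j (l.filter (f j < f ·)) (l.filter (f · < f j)) ↔ condS f j {a | a ∈ l}))
    (hhole : ∀ l : List α, l.Pairwise (fun a b => f b < f a) → (hc l ↔ hcS f {a | a ∈ l}))
    (w : List (BorderStep α)) : ∀ l : List α,
    w.Pairwise (fun a b => key a < key b) → l.Pairwise (fun a b => f b < f a) →
    (∀ r, .row r ∈ w ↔ ∃ a, (a ∈ l ∨ .col a ∈ w) ∧ f a = r) →
    (∀ a b, (a ∈ l ∨ .col a ∈ w) → (b ∈ l ∨ .col b ∈ w) → f a = f b → a = b) →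
    (∀ a ∈ l, .col a ∉ w) →
    (Reads cond hc w l f ↔ SatisfiesAlong key condS hcS w l f) := by
  induction w with
  | nil =>
    intro l _ _ hb _ _
    have : l = [] := List.eq_nil_iff_forall_not_mem.2 fun a ha => by
      simpa using (hb (f a)).2 ⟨a, Or.inl ha, rfl⟩
    simp [Reads, SatisfiesAlong, this]
  | cons s w ih =>
    intro l hw hl hb hinj hd
    rw [List.pairwise_cons] at hw
    have hsw : s ∉ w := fun h => lt_irrefl _ (hw.1 s h)
    rcases s with j | r | _
    · -- the new column `j` is the only active column that is not in `l`
      have hjl : j ∉ l := fun h => hd j h (by simp)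
      have hne : ∀ a ∈ l, f a ≠ f j := fun a ha h =>
        hjl (hinj a j (Or.inl ha) (Or.inr (by simp)) h ▸ ha)
      have hfl := filter_append_filter_of_pairwise hl hne
      have hmem : ∀ a, a ∈ l.filter (f j < f ·) ++ j :: l.filter (f · < f j) ↔ a ∈ l ∨ a = j := by
        intro a; rw [mem_insert_append, hfl]
      have hor : ∀ a, (a ∈ l.filter (f j < f ·) ++ j :: l.filter (f · < f j) ∨ .col a ∈ w) ↔
          (a ∈ l ∨ .col a ∈ BorderStep.col j :: w) := by
        intro a; rw [hmem, List.mem_cons, BorderStep.col.injEq, or_assoc]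
      have hl' : (l.filter (f j < f ·) ++ j :: l.filter (f · < f j)).Pairwise
          (fun a b => f b < f a) := by
        rw [← hfl, List.pairwise_append] at hl
        rw [List.pairwise_append, List.pairwise_cons]
        refine ⟨hl.1, ⟨fun a ha => by simpa using (List.mem_filter.1 ha).2, hl.2.1⟩, ?_⟩
        intro a ha b hb
        have h1 : f j < f a := by simpa using (List.mem_filter.1 ha).2
        rcases List.mem_cons.1 hb with rfl | hb
        · exact h1
        · exact hl.2.2 a ha b hb
      have ih' := ih _ hw.2 hl' (by intro r; simp only [hor, ← hb]; simp)
        (by simpa only [hor] using hinj)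
        (by
          intro a ha h
          rcases (hmem a).1 ha with ha | rfl
          · exact hd a ha (by simp [h])
          · exact hsw h)
      have hact : activeSet key (.col j :: w) l f (.col j) = {a | a ∈ l} := by
        ext i
        simp only [activeSet, Set.mem_ofPred_eq, List.mem_cons, BorderStep.col.injEq, reduceCtorEq,
          false_or]
        constructor
        · rintro ⟨h | ⟨rfl | h, h'⟩, _⟩
          · exact h
          · exact absurd h' (lt_irrefl _)
          · exact absurd h' (hw.1 _ h).asymm
        · intro h
          have h2 : BorderStep.row (f i) ∈ w := by simpa using (hb (f i)).2 ⟨i, Or.inl h, rfl⟩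
          exact ⟨Or.inl h, h2, hw.1 _ h2⟩
      have hact' : ∀ s ∈ w, activeSet key (.col j :: w) l f s =
          activeSet key w (l.filter (f j < f ·) ++ j :: l.filter (f · < f j)) f s := by
        intro s hs
        ext i
        simp only [activeSet, Set.mem_ofPred_eq, List.mem_cons, BorderStep.col.injEq, reduceCtorEq,
          false_or, hmem]
        have := hw.1 s hs
        apply and_congr_left
        intro _
        constructor
        · rintro (h | ⟨rfl | h, h'⟩) <;> tauto
        · rintro ((h | rfl) | h) <;> tauto
      rw [Reads, ih', hcond l j hl]
      simp only [SatisfiesAlong, List.mem_cons, BorderStep.col.injEq, reduceCtorEq, false_or,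
        forall_eq_or_imp, hact]
      have hj : BorderStep.row (f j) ∈ w := by
        simpa using (hb (f j)).2 ⟨j, Or.inr (by simp), rfl⟩
      constructor
      · rintro ⟨_, h1, h2, h3, h4⟩
        refine ⟨⟨⟨hj, hw.1 _ hj⟩, h2⟩, ⟨h1, fun k hk => ?_⟩, fun hh => ?_⟩
        · rw [hact' _ hk]; exact h3 k hk
        · rw [hact' _ hh]; exact h4 hh
      · rintro ⟨⟨_, h2⟩, ⟨h1, h3⟩, h4⟩
        refine ⟨hfl, h1, h2, fun k hk => ?_, fun hh => ?_⟩
        · rw [← hact' _ hk]; exact h3 k hk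
        · rw [← hact' _ hh]; exact h4 hh
    · -- the row `r` must be the row of the first column of `l`
      have key1 : ∀ a l', l = a :: l' → f a = r →
          (Reads cond hc w l' f ↔ SatisfiesAlong key condS hcS (.row r :: w) l f) := by
        rintro a l' rfl har
        have hal : a ∉ l' := fun h => lt_irrefl _ ((List.pairwise_cons.1 hl).1 a h)
        have haw : .col a ∉ w := fun h => hd a (by simp) (by simp [h])
        rw [ih l' hw.2 hl.of_cons]
        · have hact : ∀ s ∈ w, activeSet key (.row r :: w) (a :: l') f s =
              activeSet key w l' f s := by
            intro s hs
            ext i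
            simp only [activeSet, Set.mem_ofPred_eq, List.mem_cons, reduceCtorEq, false_or,
              BorderStep.row.injEq]
            have h0 := hw.1 s hs
            constructor
            · rintro ⟨h1, h2, h3⟩
              have hir : f i ≠ r := by rintro h; rw [h] at h3; exact lt_asymm h0 h3
              refine ⟨?_, h2.resolve_left hir, h3⟩
              rcases h1 with (rfl | h1) | h1
              · exact absurd har hir
              · exact Or.inl h1
              · exact Or.inr h1
            · rintro ⟨h1, h2, h3⟩
              exact ⟨by tauto, Or.inr h2, h3⟩
          simp only [SatisfiesAlong, List.mem_cons, reduceCtorEq, false_or, BorderStep.row.injEq]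
          constructor
          · rintro ⟨h1, h2, h3⟩
            refine ⟨fun j hj => ⟨Or.inr (h1 j hj).1, (h1 j hj).2⟩, fun j hj => ?_, fun hh => ?_⟩
            · rw [hact _ hj]; exact h2 j hj
            · rw [hact _ hh]; exact h3 hh
          · rintro ⟨h1, h2, h3⟩
            refine ⟨fun j hj => ⟨(h1 j hj).1.resolve_left ?_, (h1 j hj).2⟩, fun j hj => ?_,
              fun hh => ?_⟩
            · intro h
              have := (h1 j hj).2
              rw [h] at this
              exact lt_asymm this (hw.1 _ hj)
            · rw [← hact _ hj]; exact h2 j hj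
            · rw [← hact _ hh]; exact h3 hh
        · intro s
          constructor
          · intro hs
            obtain ⟨b, hb1, hb2⟩ := (hb s).1 (by simp [hs])
            simp only [List.mem_cons, reduceCtorEq, false_or, or_assoc] at hb1
            rcases hb1 with rfl | hb1
            · rw [← hb2, har] at hs; exact absurd hs hsw
            · exact ⟨b, hb1, hb2⟩
          · rintro ⟨b, hb1, hb2⟩
            have h1 : BorderStep.row s ∈ BorderStep.row r :: w :=
              (hb s).2 ⟨b, by simp; tauto, hb2⟩
            rcases List.mem_cons.1 h1 with h1 | h1
            · rw [BorderStep.row.injEq] at h1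
              have : b = a := hinj b a (by simp; tauto) (by simp) (by rw [hb2, h1, har])
              subst this
              rcases hb1 with hb1 | hb1
              · exact absurd hb1 hal
              · exact absurd hb1 haw
            · exact h1
        · intro b c h1 h2
          exact hinj b c (by simp; tauto) (by simp; tauto)
        · intro b h1 h2
          exact hd b (by simp [h1]) (by simp [h2])
      constructor
      · rintro ⟨a, l', rfl, har, h⟩
        exact (key1 a l' rfl har).1 h
      · intro h
        obtain ⟨a, ha, har⟩ := (hb r).1 (by simp)
        have hal : a ∈ l := by
          rcases ha with ha | ha
          · exact ha
          · have h1 := (h.1 a ha).2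
            rw [har] at h1
            exact absurd (hw.1 (.col a) (by simpa using ha)) h1.asymm
        rcases l with _ | ⟨b, l'⟩
        · simp at hal
        have hba : b = a := by
          rcases List.mem_cons.1 hal with h1 | h1
          · exact h1.symm
          · exfalso
            have h2 := (List.pairwise_cons.1 hl).1 a h1
            have h3 : BorderStep.row (f b) ∈ BorderStep.row r :: w :=
              (hb (f b)).2 ⟨b, by simp, rfl⟩
            rcases List.mem_cons.1 h3 with h3 | h3
            · rw [BorderStep.row.injEq] at h3; omega
            · have := (hrow _ _).1 (hw.1 _ h3); omega
        subst hba
        exact ⟨b, l', rfl, har, (key1 b l' rfl har).2 h⟩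
    · -- the hole-column does not change the list
      have ih' := ih l hw.2 hl (by simpa using hb) (by simpa using hinj) (by simpa using hd)
      have hact : activeSet key (.hole :: w) l f .hole = {a | a ∈ l} := by
        ext i
        simp only [activeSet, Set.mem_ofPred_eq, List.mem_cons, reduceCtorEq, false_or]
        constructor
        · rintro ⟨h | ⟨h, h'⟩, _⟩
          · exact h
          · exact absurd h' (hw.1 _ h).asymm
        · intro h
          have h2 : BorderStep.row (f i) ∈ w := by simpa using (hb (f i)).2 ⟨i, Or.inl h, rfl⟩
          exact ⟨Or.inl h, h2, hw.1 _ h2⟩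
      have hact' : ∀ s, activeSet key (.hole :: w) l f s = activeSet key w l f s := by
        intro s
        ext i
        simp [activeSet]
      rw [Reads, ih', hhole l hl]
      simp only [SatisfiesAlong, List.mem_cons, reduceCtorEq, false_or, true_or, true_imp_iff,
        hact, hact']
      tauto

/-- The columns of a border word. -/
def BorderStep.cols (w : List (BorderStep α)) : List α :=
  w.filterMap (fun s => match s with | .col j => some j | _ => none)

/-- The rows of a border word. -/
def BorderStep.rows (w : List (BorderStep α)) : List ℕ :=
  w.filterMap (fun s => match s with | .row r => some r | _ => none)

theorem BorderStep.mem_cols {w : List (BorderStep α)} {j : α} : j ∈ cols w ↔ .col j ∈ w := by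
  rw [cols, List.mem_filterMap]
  constructor
  · rintro ⟨s, hs, h⟩
    rcases s with k | r | _ <;> simp at h
    subst h; exact hs
  · intro h; exact ⟨_, h, rfl⟩

theorem BorderStep.mem_rows {w : List (BorderStep α)} {r : ℕ} : r ∈ rows w ↔ .row r ∈ w := by
  rw [rows, List.mem_filterMap]
  constructor
  · rintro ⟨s, hs, h⟩
    rcases s with k | r | _ <;> simp at h
    subst h; exact hs
  · intro h; exact ⟨_, h, rfl⟩

theorem BorderStep.nodup_rows {w : List (BorderStep α)} (hw : w.Nodup) : (rows w).Nodup := by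
  refine hw.filterMap ?_
  intro a b c hb hc
  rcases a with k | r | _ <;> rcases b with k' | r' | _ <;> simp at hb hc
  rw [hb, hc]

theorem Reads.perm {cond : α → List α → List α → Prop} {hc : List α → Prop}
    {w : List (BorderStep α)} : ∀ {l : List α} {f : α → ℕ}, Reads cond hc w l f →
      (BorderStep.rows w).Perm ((l ++ BorderStep.cols w).map f) := by
  induction w with
  | nil => intro l f h; rw [Reads] at h; simp [h, BorderStep.rows, BorderStep.cols]
  | cons s w ih =>
    intro l f h
    rcases s with j | r | _
    · obtain ⟨h1, _, h3⟩ := h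
      have := ih h3
      rw [show BorderStep.rows (.col j :: w) = BorderStep.rows w from rfl,
        show BorderStep.cols (.col j :: w) = j :: BorderStep.cols w from rfl]
      refine this.trans (List.Perm.map f ?_)
      conv_rhs => rw [← h1]
      exact (List.perm_middle.append_right _).trans (List.perm_middle.symm)
    · obtain ⟨a, l', rfl, rfl, h3⟩ := h
      exact (ih h3).cons _
    · exact ih h.2

end

/-! ### Transversals of Ferrers shapes with one hole-column -/

section

variable {n : ℕ}

/-- The fillings `f` of the columns in `C` that are transversals of the rows in `R` below the
heights `h`, and agree with `f₀` outside `C`. -/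
def transversals (C : Finset (Fin n)) (R : Finset ℕ) (h f₀ : Fin n → ℕ) : Set (Fin n → ℕ) :=
  {f | (∀ j, j ∉ C → f j = f₀ j) ∧ Set.BijOn f C R ∧ ∀ j ∈ C, f j < h j}

/-- No occurrence of `312`, where in addition there is a hole-column of height `t` between the
columns to the left of `q` and the others. -/
def Avoids312At (C : Finset (Fin n)) (h : Fin n → ℕ) (q t : ℕ) (f : Fin n → ℕ) : Prop :=
  (∀ i ∈ C, ∀ j ∈ C, ∀ k ∈ C, i < j → j < k → f j < f k → f k < f i → h k ≤ f i) ∧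
  (∀ j ∈ C, ∀ k ∈ C, q ≤ j → j < k → ¬ f j < f k) ∧
  (∀ i ∈ C, ∀ k ∈ C, (i : ℕ) < q → q ≤ k → f k < f i → h k ≤ f i) ∧
  (∀ i ∈ C, ∀ j ∈ C, i < j → (j : ℕ) < q → f j < f i → t ≤ f i)

/-- No occurrence of `231`, where in addition there is a hole-column of height `t` between the
columns to the left of `q` and the others. -/
def Avoids231At (C : Finset (Fin n)) (h : Fin n → ℕ) (q t : ℕ) (f : Fin n → ℕ) : Prop :=
  (∀ i ∈ C, ∀ j ∈ C, ∀ k ∈ C, i < j → j < k → f k < f i → f i < f j → h k ≤ f j) ∧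
  (∀ j ∈ C, ∀ k ∈ C, q ≤ j → j < k → f k < f j → h k ≤ f j) ∧
  (∀ i ∈ C, ∀ k ∈ C, (i : ℕ) < q → q ≤ k → f k < f i → h k ≤ f i) ∧
  (∀ i ∈ C, ∀ j ∈ C, i < j → (j : ℕ) < q → f i < f j → t ≤ f j)

/-- The place of a step on the border: a column of height `h` ends above the row `r` if and only if
`r < h`; columns that end at the same height are ordered from left to right. -/
def borderKey (h : Fin n → ℕ) (q t : ℕ) : BorderStep (Fin n) → ℤ ×ₗ ℕ
  | .col j => toLex (-(2 * (h j : ℤ)), 2 * (j : ℕ) + 2)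
  | .row r => toLex (-(2 * (r : ℤ) + 1), 0)
  | .hole => toLex (-(2 * (t : ℤ)), 2 * q + 1)

variable {h : Fin n → ℕ} {q t : ℕ}

theorem borderKey_col_col (hh : Antitone h) {i j : Fin n} :
    borderKey h q t (.col i) < borderKey h q t (.col j) ↔ i < j := by
  have key : ∀ i j : Fin n, i < j →
      borderKey h q t (.col i) < borderKey h q t (.col j) := by
    intro i j hij
    simp only [borderKey, Prod.Lex.toLex_lt_toLex]
    have := hh hij.le
    have h2 : (i : ℕ) < j := hij
    omega
  constructor
  · intro H
    rcases lt_trichotomy i j with h1 | rfl | h1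
    · exact h1
    · exact absurd H (lt_irrefl _)
    · exact absurd H (key _ _ h1).asymm
  · exact key i j

theorem borderKey_col_row {j : Fin n} {r : ℕ} :
    borderKey h q t (.col j) < borderKey h q t (.row r) ↔ r < h j := by
  simp only [borderKey, Prod.Lex.toLex_lt_toLex]; omega

theorem borderKey_row_row {r s : ℕ} :
    borderKey h q t (.row r) < borderKey h q t (.row s) ↔ s < r := by
  simp only [borderKey, Prod.Lex.toLex_lt_toLex]; omega

theorem borderKey_hole_row {r : ℕ} :
    borderKey h q t .hole < borderKey h q t (.row r) ↔ r < t := by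
  simp only [borderKey, Prod.Lex.toLex_lt_toLex]; omega

theorem borderKey_col_hole {j : Fin n} (h1 : (j : ℕ) < q → t ≤ h j) (h2 : q ≤ j → h j ≤ t) :
    borderKey h q t (.col j) < borderKey h q t .hole ↔ (j : ℕ) < q := by
  simp only [borderKey, Prod.Lex.toLex_lt_toLex]; omega

theorem borderKey_injective (hh : Antitone h) : Function.Injective (borderKey h q t) := by
  intro a b hab
  rcases a with i | r | _ <;> rcases b with j | s | _
  · rcases lt_trichotomy i j with h1 | rfl | h1
    · exact absurd ((borderKey_col_col hh).2 h1) (by rw [hab]; exact lt_irrefl _)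
    · rfl
    · exact absurd ((borderKey_col_col hh).2 h1) (by rw [hab]; exact lt_irrefl _)
  all_goals
    simp only [borderKey, EmbeddingLike.apply_eq_iff_eq, Prod.mk.injEq] at hab
    first | rfl | (exfalso; omega) | (congr 1; omega)

/-- The border word of a set of columns and a set of rows, with one hole-column. -/
theorem exists_borderWord (C : Finset (Fin n)) (R : Finset ℕ) (hh : Antitone h) :
    ∃ w : List (BorderStep (Fin n)), w.Pairwise (fun a b => borderKey h q t a < borderKey h q t b) ∧
      (∀ j, .col j ∈ w ↔ j ∈ C) ∧ (∀ r, .row r ∈ w ↔ r ∈ R) ∧ .hole ∈ w := by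
  classical
  let L : List (BorderStep (Fin n)) :=
    ((C.toList.map BorderStep.col ++ R.toList.map BorderStep.row) ++ [BorderStep.hole]).dedup
  let r : BorderStep (Fin n) → BorderStep (Fin n) → Prop :=
    fun a b => borderKey h q t a ≤ borderKey h q t b
  have : Std.Total r := ⟨fun a b => le_total _ _⟩
  have : IsTrans _ r := ⟨fun a b c => le_trans⟩
  have hperm := List.perm_insertionSort r L
  refine ⟨L.insertionSort r, ?_, ?_, ?_, ?_⟩
  · have h1 : (L.insertionSort r).Pairwise r := List.pairwise_insertionSort r L
    have h2 : (L.insertionSort r).Nodup := hperm.nodup_iff.2 (List.nodup_dedup _)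
    refine (h1.and h2).imp ?_
    rintro a b ⟨h3, h4⟩
    exact lt_of_le_of_ne h3 fun h5 => h4 (borderKey_injective hh h5)
  · intro j; rw [hperm.mem_iff]; simp [L]
  · intro j; rw [hperm.mem_iff]; simp [L]
  · rw [hperm.mem_iff]; simp [L]

theorem before_of_borderKey_lt (hh : Antitone h) {a b : BorderStep (Fin n)}
    (hab : borderKey h q t a < borderKey h q t b) : BorderStep.Before a b := by
  rcases a with i | r | _ <;> rcases b with j | s | _
  · exact (borderKey_col_col hh).1 hab
  all_goals first | trivial | exact borderKey_row_row.1 hab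

/-- The transversals that satisfy conditions on the sets of active columns are those that can be
read along the border word. -/
theorem transversals_inter_eq_readable {cond : Fin n → List (Fin n) → List (Fin n) → Prop}
    {hc : List (Fin n) → Prop} {condS : (Fin n → ℕ) → Fin n → Set (Fin n) → Prop}
    {hcS : (Fin n → ℕ) → Set (Fin n) → Prop}
    (hcond : ∀ (f : Fin n → ℕ) (l : List (Fin n)) (j : Fin n), l.Pairwise (fun a b => f b < f a) →
      (cond j (l.filter (f j < f ·)) (l.filter (f · < f j)) ↔ condS f j {a | a ∈ l}))
    (hhole : ∀ (f : Fin n → ℕ) (l : List (Fin n)), l.Pairwise (fun a b => f b < f a) →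
      (hc l ↔ hcS f {a | a ∈ l}))
    (C : Finset (Fin n)) (R : Finset ℕ) (hh : Antitone h) (f₀ : Fin n → ℕ)
    (hq1 : ∀ j ∈ C, (j : ℕ) < q → t ≤ h j) (hq2 : ∀ j ∈ C, q ≤ (j : ℕ) → h j ≤ t)
    {w : List (BorderStep (Fin n))}
    (hw : w.Pairwise (fun a b => borderKey h q t a < borderKey h q t b))
    (hcol : ∀ j, .col j ∈ w ↔ j ∈ C) (hrow : ∀ r, .row r ∈ w ↔ r ∈ R) (hhw : .hole ∈ w) :
    {f ∈ transversals C R h f₀ |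
      (∀ j ∈ C, condS f j {i | i ∈ C ∧ i < j ∧ f i < h j}) ∧
      hcS f {i | i ∈ C ∧ (i : ℕ) < q ∧ f i < t}} = readable cond hc w [] f₀ := by
  have hnd : w.Nodup := hw.imp fun h e => by rw [e] at h; exact lt_irrefl _ h
  have hreads : ∀ f : Fin n → ℕ, Set.BijOn f C R → (Reads cond hc w [] f ↔
      SatisfiesAlong (borderKey h q t) condS hcS w [] f) := by
    intro f hf
    refine reads_iff (borderKey h q t) (fun r s => borderKey_row_row) f (hcond f) (hhole f) w []
      hw (by simp) ?_ ?_ (by simp)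
    · intro r
      simp only [List.not_mem_nil, false_or, hcol, hrow]
      constructor
      · intro hr; obtain ⟨a, ha, h⟩ := hf.2.2 hr; exact ⟨a, ha, h⟩
      · rintro ⟨a, ha, rfl⟩; exact hf.1 ha
    · intro a b ha hb hab
      simp only [List.not_mem_nil, false_or, hcol] at ha hb
      exact hf.2.1 ha hb hab
  have hsat : ∀ f : Fin n → ℕ, Set.BijOn f C R →
      (SatisfiesAlong (borderKey h q t) condS hcS w [] f ↔ (∀ j ∈ C, f j < h j) ∧
        (∀ j ∈ C, condS f j {i | i ∈ C ∧ i < j ∧ f i < h j}) ∧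
        hcS f {i | i ∈ C ∧ (i : ℕ) < q ∧ f i < t}) := by
    intro f hf
    have hR : ∀ i ∈ C, f i ∈ R := fun i hi => hf.1 hi
    have e1 : ∀ j, activeSet (borderKey h q t) w [] f (.col j) =
        {i | i ∈ C ∧ i < j ∧ f i < h j} := by
      intro j
      ext i
      simp only [activeSet, List.not_mem_nil, false_or, hcol, hrow, borderKey_col_col hh,
        borderKey_col_row, Set.mem_ofPred_eq]
      exact ⟨fun h => ⟨h.1.1, h.1.2, h.2.2⟩, fun h => ⟨⟨h.1, h.2.1⟩, hR i h.1, h.2.2⟩⟩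
    have e2 : activeSet (borderKey h q t) w [] f .hole =
        {i | i ∈ C ∧ (i : ℕ) < q ∧ f i < t} := by
      ext i
      simp only [activeSet, List.not_mem_nil, false_or, hcol, hrow, borderKey_hole_row,
        Set.mem_ofPred_eq]
      constructor
      · rintro ⟨⟨h1, h2⟩, _, h4⟩
        exact ⟨h1, (borderKey_col_hole (hq1 i h1) (hq2 i h1)).1 h2, h4⟩
      · rintro ⟨h1, h2, h4⟩
        exact ⟨⟨h1, (borderKey_col_hole (hq1 i h1) (hq2 i h1)).2 h2⟩, hR i h1, h4⟩
    simp only [SatisfiesAlong, hcol, hrow, hhw, e1, e2, borderKey_col_row, true_imp_iff]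
    constructor
    · rintro ⟨h1, h2⟩; exact ⟨fun j hj => (h1 j hj).2, h2⟩
    · rintro ⟨h1, h2⟩; exact ⟨fun j hj => ⟨hR j hj, h1 j hj⟩, h2⟩
  ext f
  constructor
  · rintro ⟨⟨h1, h2, h3⟩, h4⟩
    exact ⟨fun j _ hj => h1 j (by rwa [hcol] at hj), by simp, (hreads f h2).2 ((hsat f h2).2
      ⟨h3, h4⟩)⟩
  · rintro ⟨h1, _, h3⟩
    have hperm := h3.perm
    rw [List.nil_append] at hperm
    have hnd' : ((BorderStep.cols w).map f).Nodup :=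
      hperm.nodup_iff.1 (BorderStep.nodup_rows hnd)
    have hb : Set.BijOn f C R := by
      refine ⟨fun j hj => ?_, fun i hi j hj hij => ?_, fun r hr => ?_⟩
      · have : f j ∈ (BorderStep.cols w).map f :=
          List.mem_map_of_mem (BorderStep.mem_cols.2 ((hcol j).2 hj))
        exact (hrow _).1 (BorderStep.mem_rows.1 (hperm.mem_iff.2 this))
      · exact List.inj_on_of_nodup_map hnd' (BorderStep.mem_cols.2 ((hcol i).2 hi))
          (BorderStep.mem_cols.2 ((hcol j).2 hj)) hij
      · obtain ⟨j, hj, rfl⟩ := List.mem_map.1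
          (hperm.mem_iff.1 (BorderStep.mem_rows.2 ((hrow r).2 hr)))
        exact ⟨j, (hcol j).1 (BorderStep.mem_cols.1 hj), rfl⟩
    obtain ⟨h4, h5⟩ := (hsat f hb).1 ((hreads f hb).1 h3)
    exact ⟨⟨fun j hj => h1 j (by simp) (by rwa [hcol]), hb, h4⟩, h5⟩

theorem pairwise_iff_of_pairwise_lt {α : Type} {f : α → ℕ} {P : α → α → Prop} {l : List α}
    (hl : l.Pairwise (fun a b => f b < f a)) :
    l.Pairwise P ↔ ∀ a ∈ l, ∀ b ∈ l, f b < f a → P a b := by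
  induction l with
  | nil => simp
  | cons c l ih =>
    rw [List.pairwise_cons] at hl
    rw [List.pairwise_cons, ih hl.2]
    constructor
    · rintro ⟨h1, h2⟩ a ha b hb hab
      rcases List.mem_cons.1 ha with rfl | ha' <;> rcases List.mem_cons.1 hb with rfl | hb'
      · exact absurd hab (lt_irrefl _)
      · exact h1 b hb'
      · exact absurd hab (hl.1 a ha').asymm
      · exact h2 a ha' b hb' hab
    · intro H
      exact ⟨fun b hb => H c (by simp) b (by simp [hb]) (hl.1 b hb),
        fun a ha b hb => H a (by simp [ha]) b (by simp [hb])⟩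

/-- For one hole-column, as many transversals avoid `312` as avoid `231`. -/
theorem encard_avoidsAt_eq (C : Finset (Fin n)) (R : Finset ℕ) (hh : Antitone h)
    (f₀ : Fin n → ℕ)
    (hq1 : ∀ j ∈ C, (j : ℕ) < q → t ≤ h j) (hq2 : ∀ j ∈ C, q ≤ (j : ℕ) → h j ≤ t) :
    {f ∈ transversals C R h f₀ | Avoids312At C h q t f}.encard =
      {f ∈ transversals C R h f₀ | Avoids231At C h q t f}.encard := by
  obtain ⟨w, hw, hcol, hrow, hhw⟩ := exists_borderWord (q := q) (t := t) C R hh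
  have h312 : {f ∈ transversals C R h f₀ | Avoids312At C h q t f} =
      readable (cond312 (fun j : Fin n => (j : ℕ) < q)) (fun l => l.Pairwise fun a b => b < a)
        w [] f₀ := by
    -- the splitting conditions, with prefix and suffix given by the rows of their 1-cells
    rw [← transversals_inter_eq_readable
      (condS := fun f j A =>
        ((j : ℕ) < q → ∀ a ∈ A, f j < f a → ∀ b ∈ A, f b < f j → b < a) ∧
        (¬ (j : ℕ) < q → (∀ a ∈ A, f j < f a → ¬ (a : ℕ) < q) ∧ ∀ b ∈ A, f b < f j → (b : ℕ) < q))
      (hcS := fun f A => ∀ a ∈ A, ∀ b ∈ A, f b < f a → b < a)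
      ?_ ?_ C R hh f₀ hq1 hq2 hw hcol hrow hhw]
    · ext f
      refine and_congr_right ?_
      rintro ⟨_, hb, hlt⟩
      have hne : ∀ a ∈ C, ∀ b ∈ C, f a < f b → a ≠ b := by rintro a _ b _ h rfl; omega
      simp only [Set.mem_ofPred_eq, and_imp]
      constructor
      · rintro ⟨ha, hb, hc, hd⟩
        refine ⟨fun j hj => ⟨fun hjq a h1 h2 h3 h4 b h5 h6 h7 h8 => ?_, fun hjq =>
          ⟨fun a h1 h2 h3 h4 h5 => ?_, fun b h1 h2 h3 h4 => ?_⟩⟩,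
          fun a h1 h2 h3 b h4 h5 h6 h7 => ?_⟩
        · by_contra hba
          have hab : a < b := lt_of_le_of_ne (not_lt.1 hba) (hne b h5 a h1 (by omega)).symm
          have := ha a h1 b h5 j hj hab h6 h8 h4
          omega
        · have := hc a h1 j hj h5 (by omega) h4; omega
        · by_contra hbq
          exact hb b h1 j hj (by omega) h2 h4
        · by_contra hba
          have hab : a < b := lt_of_le_of_ne (not_lt.1 hba) (hne b h4 a h1 h7).symm
          have := hd a h1 b h4 hab h5 h7
          omega
      · rintro ⟨h1, h2⟩
        refine ⟨fun i hi j hj k hk hij hjk h3 h4 => ?_, fun j hj k hk h3 h4 h5 => ?_,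
          fun i hi k hk h3 h4 h5 => ?_, fun i hi j hj hij h3 h4 => ?_⟩
        · by_contra h5
          rw [not_le] at h5
          by_cases hkq : (k : ℕ) < q
          · have := (h1 k hk).1 hkq i hi (hij.trans hjk) h5 h4 j hj hjk (by omega) h3
            exact lt_asymm this hij
          · have h6 := ((h1 k hk).2 hkq).1 i hi (hij.trans hjk) h5 h4
            have h7 := ((h1 k hk).2 hkq).2 j hj hjk (by omega) h3
            have : (i : ℕ) < j := hij
            omega
        · have h7 : (j : ℕ) < k := h4
          have := ((h1 k hk).2 (by omega)).2 j hj h4 (h5.trans (hlt k hk)) h5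
          omega
        · by_contra h6
          rw [not_le] at h6
          have hik : i < k := by rw [Fin.lt_def]; omega
          exact ((h1 k hk).2 (by omega)).1 i hi hik h6 h5 h3
        · by_contra h6
          rw [not_le] at h6
          have : (i : ℕ) < j := hij
          exact lt_asymm hij (h2 i hi (by omega) h6 j hj h3 (by omega) h4)
    · intro f l j hl
      simp only [cond312, List.mem_filter, decide_eq_true_eq, and_imp, Set.mem_ofPred_eq]
    · intro f l hl
      exact pairwise_iff_of_pairwise_lt hl
  have h231 : {f ∈ transversals C R h f₀ | Avoids231At C h q t f} =
      readable (cond231 (fun j : Fin n => (j : ℕ) < q)) (fun l => l.Pairwise (· < ·))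
        w [] f₀ := by
    rw [← transversals_inter_eq_readable
      (condS := fun f j A =>
        ((j : ℕ) < q → ∀ a ∈ A, f j < f a → ∀ b ∈ A, f j < f b → f b < f a → a < b) ∧
        (¬ (j : ℕ) < q → ∀ a ∈ A, ¬ f j < f a))
      (hcS := fun f A => ∀ a ∈ A, ∀ b ∈ A, f b < f a → a < b)
      ?_ ?_ C R hh f₀ hq1 hq2 hw hcol hrow hhw]
    · ext f
      refine and_congr_right ?_
      rintro ⟨_, hb, hlt⟩
      have hne : ∀ a ∈ C, ∀ b ∈ C, f a < f b → a ≠ b := by rintro a _ b _ h rfl; omega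
      simp only [Set.mem_ofPred_eq, and_imp]
      constructor
      · rintro ⟨ha, hb, hc, hd⟩
        refine ⟨fun j hj => ⟨fun hjq a h1 h2 h3 h4 b h5 h6 h7 h8 h9 => ?_, fun hjq a h1 h2 h3 h4 =>
          ?_⟩, fun a h1 h2 h3 b h4 h5 h6 h7 => ?_⟩
        · by_contra hab
          have hba : b < a := lt_of_le_of_ne (not_lt.1 hab) (hne b h5 a h1 h9)
          have := ha b h5 a h1 j hj hba h2 h8 h9
          omega
        · by_cases haq : (a : ℕ) < q
          · have := hc a h1 j hj haq (by omega) h4; omega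
          · have := hb a h1 j hj (by omega) h2 h4; omega
        · by_contra hab
          have hba : b < a := lt_of_le_of_ne (not_lt.1 hab) (hne b h4 a h1 h7)
          have := hd b h4 a h1 hba h2 h7
          omega
      · rintro ⟨h1, h2⟩
        refine ⟨fun i hi j hj k hk hij hjk h3 h4 => ?_, fun j hj k hk h3 h4 h5 => ?_,
          fun i hi k hk h3 h4 h5 => ?_, fun i hi j hj hij h3 h4 => ?_⟩
        · by_contra h5
          rw [not_le] at h5
          by_cases hkq : (k : ℕ) < q
          · have := (h1 k hk).1 hkq j hj hjk h5 (by omega) i hi (hij.trans hjk) (by omega) h3 h4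
            exact lt_asymm this hij
          · exact (h1 k hk).2 hkq j hj hjk h5 (by omega)
        · by_contra h6
          rw [not_le] at h6
          have h7 : (j : ℕ) < k := h4
          exact (h1 k hk).2 (by omega) j hj h4 h6 h5
        · by_contra h6
          rw [not_le] at h6
          have hik : i < k := by rw [Fin.lt_def]; omega
          exact (h1 k hk).2 (by omega) i hi hik h6 h5
        · by_contra h6
          rw [not_le] at h6
          have : (i : ℕ) < j := hij
          exact lt_asymm hij (h2 j hj h3 h6 i hi (by omega) (by omega) h4)
    · intro f l j hl
      simp only [cond231, Set.mem_ofPred_eq]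
      apply and_congr
      · apply imp_congr_right
        intro _
        rw [pairwise_iff_of_pairwise_lt (hl.filter _)]
        simp only [List.mem_filter, decide_eq_true_eq, and_imp]
      · apply imp_congr_right
        intro _
        rw [List.filter_eq_nil_iff]
        simp
    · intro f l hl
      exact pairwise_iff_of_pairwise_lt hl
  obtain ⟨w₁, w₂, rfl⟩ := List.append_of_mem hhw
  have hw' := hw
  rw [List.pairwise_append, List.pairwise_cons] at hw'
  obtain ⟨_, ⟨hw2, _⟩, hw1⟩ := hw'
  rw [h312, h231]
  have hcolh : ∀ j, j ∈ C → (borderKey h q t (.col j) < borderKey h q t .hole ↔ (j : ℕ) < q) :=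
    fun j hj => borderKey_col_hole (hq1 j hj) (hq2 j hj)
  refine encard_readable_eq _ w₁ w₂ ?_ ?_ ?_ ?_ f₀ ?_
  · intro j hj
    exact (hcolh j ((hcol j).1 (by simp [hj]))).1 (hw1 _ hj _ (by simp))
  · intro j hj h
    exact lt_asymm ((hcolh j ((hcol j).1 (by simp [hj]))).2 h) (hw2 _ hj)
  · intro h; exact lt_irrefl _ (hw1 _ h _ (by simp))
  · intro h; exact lt_irrefl _ (hw2 _ h)
  · exact hw.imp fun h => before_of_borderKey_lt hh h

end

/-! ### Occurrences of patterns with the help of holes -/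

section

variable {n l : ℕ}

/-- The levels that an entry in column `j` may have: an entry in a standard column (in `C`) lies at
the level `2 r + 1` of its row `r`, and an entry that is inserted in a hole-column (in `H`) lies at
any even level, the level `2 i` being the gap below row `i`. -/
def HasLevel (C H : Finset (Fin n)) (f : Fin n → ℕ) (j : Fin n) (v : ℕ) : Prop :=
  (j ∈ C ∧ v = 2 * f j + 1) ∨ (j ∈ H ∧ Even v)

/-- The pattern `p` occurs in the columns in `C ∪ H` below the heights `h`, after suitable rows
have been inserted. Entries inserted in the same gap can be put in any order, hence the weak
inequality between levels. -/
def Occurs (C H : Finset (Fin n)) (h f : Fin n → ℕ) (p : Equiv.Perm (Fin l)) : Prop :=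
  ∃ (c : Fin l → Fin n) (v : Fin l → ℕ), StrictMono c ∧ (∀ b, HasLevel C H f (c b) (v b)) ∧
    (∀ a b, p a < p b → v a ≤ v b) ∧ ∀ a b, v a ≤ 2 * h (c b)

variable {C H : Finset (Fin n)} {h f : Fin n → ℕ}

theorem strictMono_fin_three {c : Fin 3 → Fin n} (h01 : c 0 < c 1) (h12 : c 1 < c 2) :
    StrictMono c := by
  rw [Fin.strictMono_iff_lt_succ]
  intro i
  fin_cases i
  · exact h01
  · exact h12

theorem occurs312_iff (hh : Antitone h) :
    Occurs C H h f perm312 ↔ ∃ (i j k : Fin n) (u v w : ℕ), i < j ∧ j < k ∧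
      HasLevel C H f i u ∧ HasLevel C H f j v ∧ HasLevel C H f k w ∧
      v ≤ w ∧ w ≤ u ∧ u ≤ 2 * h k := by
  constructor
  · rintro ⟨c, v, hc, hl, hp, hb⟩
    exact ⟨c 0, c 1, c 2, v 0, v 1, v 2, hc (by decide), hc (by decide), hl 0, hl 1, hl 2,
      hp 1 2 (by decide), hp 2 0 (by decide), hb 0 2⟩
  · rintro ⟨i, j, k, u, v, w, hij, hjk, hu, hv, hw, hvw, hwu, huk⟩
    have h1 := hh hij.le
    have h2 := hh hjk.le
    refine ⟨![i, j, k], ![u, v, w], strictMono_fin_three hij hjk, ?_, ?_, ?_⟩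
    · intro b; fin_cases b <;> assumption
    · intro a b
      fin_cases a <;> fin_cases b <;> simp [perm312] <;> omega
    · intro a b
      fin_cases a <;> fin_cases b <;> simp <;> omega

theorem occurs231_iff (hh : Antitone h) :
    Occurs C H h f perm231 ↔ ∃ (i j k : Fin n) (u v w : ℕ), i < j ∧ j < k ∧
      HasLevel C H f i u ∧ HasLevel C H f j v ∧ HasLevel C H f k w ∧
      w ≤ u ∧ u ≤ v ∧ v ≤ 2 * h k := by
  constructor
  · rintro ⟨c, v, hc, hl, hp, hb⟩
    exact ⟨c 0, c 1, c 2, v 0, v 1, v 2, hc (by decide), hc (by decide), hl 0, hl 1, hl 2,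
      hp 2 0 (by decide), hp 0 1 (by decide), hb 1 2⟩
  · rintro ⟨i, j, k, u, v, w, hij, hjk, hu, hv, hw, hvw, hwu, huk⟩
    have h1 := hh hij.le
    have h2 := hh hjk.le
    refine ⟨![i, j, k], ![u, v, w], strictMono_fin_three hij hjk, ?_, ?_, ?_⟩
    · intro b; fin_cases b <;> assumption
    · intro a b
      fin_cases a <;> fin_cases b <;> simp [perm231] <;> omega
    · intro a b
      fin_cases a <;> fin_cases b <;> simp <;> omega

/-- The hole-columns consist of at most one hole-column `q`, of height `t`, and of at most one
further hole-column that lies to the right of all standard columns and below all their 1-cells.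
Without the former, `q` lies to the right of all standard columns and `t = 0`. -/
structure EssentiallyOneHole (C H : Finset (Fin n)) (h f : Fin n → ℕ) (q t : ℕ) : Prop where
  cases : ∀ x ∈ H, ((x : ℕ) = q ∧ h x = t) ∨ (q < x ∧ ∀ c ∈ C, c < x ∧ h x ≤ f c)
  unique : ∀ x ∈ H, ∀ y ∈ H, q < x → q < y → x = y
  exists_hole : (∃ x ∈ H, (x : ℕ) = q ∧ h x = t) ∨ (t = 0 ∧ ∀ c ∈ C, (c : ℕ) < q)

variable {q t : ℕ}

/-- Only the hole-column `q` can take part in an occurrence of a pattern of length three. -/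
theorem EssentiallyOneHole.mem_of_triple (hE : EssentiallyOneHole C H h f q t)
    {i j k : Fin n} {u v w : ℕ} (hij : i < j) (hjk : j < k) (hu : HasLevel C H f i u)
    (hv : HasLevel C H f j v) (hw : HasLevel C H f k w) (huk : u ≤ 2 * h k) (hvk : v ≤ 2 * h k) :
    ((i ∈ C ∧ u = 2 * f i + 1) ∨ ((i : ℕ) = q ∧ h i = t ∧ Even u)) ∧
    ((j ∈ C ∧ v = 2 * f j + 1) ∨ ((j : ℕ) = q ∧ h j = t ∧ Even v)) ∧
    ((k ∈ C ∧ w = 2 * f k + 1) ∨ ((k : ℕ) = q ∧ h k = t ∧ Even w)) := by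
  have key : ∀ x y : Fin n, ∀ u' w', x < y → HasLevel C H f x u' → HasLevel C H f y w' →
      ((x ∈ C ∧ u' = 2 * f x + 1) ∨ ((x : ℕ) = q ∧ h x = t ∧ Even u')) := by
    rintro x y u' w' hxy (hx | ⟨hx, hx'⟩) hy
    · exact Or.inl hx
    · rcases hE.cases x hx with h1 | h1
      · exact Or.inr ⟨h1.1, h1.2, hx'⟩
      · exfalso
        have hxy' : (x : ℕ) < y := hxy
        rcases hy with hy | ⟨hy, _⟩
        · exact lt_asymm hxy (h1.2 y hy.1).1
        · exact hxy.ne (hE.unique x hx y hy h1.1 (h1.1.trans hxy'))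
  have hi := key i j u v hij hu hv
  have hj := key j k v w hjk hv hw
  refine ⟨hi, hj, ?_⟩
  rcases hw with hk | ⟨hk, hk'⟩
  · exact Or.inl hk
  · rcases hE.cases k hk with h1 | h1
    · exact Or.inr ⟨h1.1, h1.2, hk'⟩
    · exfalso
      have hij' : (i : ℕ) < j := hij
      rcases hi with hi | hi
      · have := (h1.2 i hi.1).2; omega
      · rcases hj with hj | hj
        · have := (h1.2 j hj.1).2; omega
        · omega

theorem occurs312_iff_not_avoidsAt (hh : Antitone h) (hCH : Disjoint C H)
    (hinj : Set.InjOn f C) (hlt : ∀ j ∈ C, f j < h j) (hE : EssentiallyOneHole C H h f q t) :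
    Occurs C H h f perm312 ↔ ¬ Avoids312At C h q t f := by
  rw [occurs312_iff hh]
  have hne : ∀ x ∈ C, ∀ y ∈ C, x < y → f x ≠ f y := fun x hx y hy hxy e =>
    hxy.ne (hinj hx hy e)
  constructor
  · rintro ⟨i, j, k, u, v, w, hij, hjk, hu, hv, hw, hvw, hwu, huk⟩ ⟨ha, hb, hc, hd⟩
    obtain ⟨hi, hj, hk⟩ := hE.mem_of_triple hij hjk hu hv hw huk ((hvw.trans hwu).trans huk)
    have hij' : (i : ℕ) < j := hij
    have hjk' : (j : ℕ) < k := hjk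
    rcases hi with ⟨hi, rfl⟩ | ⟨hi, hi', ⟨a, rfl⟩⟩ <;>
      rcases hj with ⟨hj, rfl⟩ | ⟨hj, hj', ⟨b, rfl⟩⟩ <;>
      rcases hk with ⟨hk, rfl⟩ | ⟨hk, hk', ⟨c, rfl⟩⟩ <;> try omega
    · have h1 := hne j hj k hk hjk
      have h2 := hne i hi k hk (hij.trans hjk)
      have := ha i hi j hj k hk hij hjk (by omega) (by omega)
      omega
    · have := hd i hi j hj hij (by omega) (by omega)
      omega
    · have h2 := hne i hi k hk (hij.trans hjk)
      have := hc i hi k hk (by omega) (by omega) (by omega)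
      omega
    · have h1 := hne j hj k hk hjk
      exact hb j hj k hk (by omega) hjk (by omega)
  · intro hA
    by_contra hO
    refine hA ⟨fun i hi j hj k hk hij hjk h1 h2 => ?_, fun j hj k hk hqj hjk h1 => ?_,
      fun i hi k hk hiq hqk h1 => ?_, fun i hi j hj hij hjq h1 => ?_⟩
    · by_contra h3
      exact hO ⟨i, j, k, _, _, _, hij, hjk, Or.inl ⟨hi, rfl⟩, Or.inl ⟨hj, rfl⟩, Or.inl ⟨hk, rfl⟩,
        by omega, by omega, by omega⟩
    · rcases hE.exists_hole with ⟨x, hx, hxq, hxt⟩ | ⟨_, h2⟩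
      · have hxj : x ≠ j := fun e => Finset.disjoint_left.1 hCH hj (e ▸ hx)
        have := hlt k hk
        refine hO ⟨x, j, k, 2 * f k + 2, _, _, ?_, hjk, Or.inr ⟨hx, by simp [parity_simps]⟩,
          Or.inl ⟨hj, rfl⟩, Or.inl ⟨hk, rfl⟩, by omega, by omega, by omega⟩
        exact lt_of_le_of_ne (Fin.le_def.2 (by omega)) hxj
      · have := h2 j hj; omega
    · by_contra h3
      rcases hE.exists_hole with ⟨x, hx, hxq, hxt⟩ | ⟨_, h2⟩
      · have hxk : x ≠ k := fun e => Finset.disjoint_left.1 hCH hk (e ▸ hx)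
        refine hO ⟨i, x, k, _, 0, _, Fin.lt_def.2 (by omega), ?_, Or.inl ⟨hi, rfl⟩,
          Or.inr ⟨hx, by simp⟩, Or.inl ⟨hk, rfl⟩, by omega, by omega, by omega⟩
        exact lt_of_le_of_ne (Fin.le_def.2 (by omega)) hxk
      · have := h2 k hk; omega
    · by_contra h3
      rcases hE.exists_hole with ⟨x, hx, hxq, hxt⟩ | ⟨h2, _⟩
      · exact hO ⟨i, j, x, _, _, 2 * f j + 2, hij, Fin.lt_def.2 (by omega), Or.inl ⟨hi, rfl⟩,
          Or.inl ⟨hj, rfl⟩, Or.inr ⟨hx, by simp [parity_simps]⟩, by omega, by omega, by omega⟩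
      · omega

theorem occurs231_iff_not_avoidsAt (hh : Antitone h) (hCH : Disjoint C H)
    (hinj : Set.InjOn f C) (hE : EssentiallyOneHole C H h f q t) :
    Occurs C H h f perm231 ↔ ¬ Avoids231At C h q t f := by
  rw [occurs231_iff hh]
  have hne : ∀ x ∈ C, ∀ y ∈ C, x < y → f x ≠ f y := fun x hx y hy hxy e =>
    hxy.ne (hinj hx hy e)
  constructor
  · rintro ⟨i, j, k, u, v, w, hij, hjk, hu, hv, hw, hwu, huv, hvk⟩ ⟨ha, hb, hc, hd⟩
    obtain ⟨hi, hj, hk⟩ := hE.mem_of_triple hij hjk hu hv hw (huv.trans hvk) hvk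
    have hij' : (i : ℕ) < j := hij
    have hjk' : (j : ℕ) < k := hjk
    rcases hi with ⟨hi, rfl⟩ | ⟨hi, hi', ⟨a, rfl⟩⟩ <;>
      rcases hj with ⟨hj, rfl⟩ | ⟨hj, hj', ⟨b, rfl⟩⟩ <;>
      rcases hk with ⟨hk, rfl⟩ | ⟨hk, hk', ⟨c, rfl⟩⟩ <;> try omega
    · have h1 := hne i hi j hj hij
      have h2 := hne i hi k hk (hij.trans hjk)
      have := ha i hi j hj k hk hij hjk (by omega) (by omega)
      omega
    · have h1 := hne i hi j hj hij
      have := hd i hi j hj hij (by omega) (by omega)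
      omega
    · have h2 := hne i hi k hk (hij.trans hjk)
      have := hc i hi k hk (by omega) (by omega) (by omega)
      omega
    · have h1 := hne j hj k hk hjk
      have := hb j hj k hk (by omega) hjk (by omega)
      omega
  · intro hA
    by_contra hO
    refine hA ⟨fun i hi j hj k hk hij hjk h1 h2 => ?_, fun j hj k hk hqj hjk h1 => ?_,
      fun i hi k hk hiq hqk h1 => ?_, fun i hi j hj hij hjq h1 => ?_⟩
    · by_contra h3
      exact hO ⟨i, j, k, _, _, _, hij, hjk, Or.inl ⟨hi, rfl⟩, Or.inl ⟨hj, rfl⟩, Or.inl ⟨hk, rfl⟩,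
        by omega, by omega, by omega⟩
    · by_contra h3
      rcases hE.exists_hole with ⟨x, hx, hxq, hxt⟩ | ⟨_, h2⟩
      · have hxj : x ≠ j := fun e => Finset.disjoint_left.1 hCH hj (e ▸ hx)
        refine hO ⟨x, j, k, 2 * f k + 2, _, _, ?_, hjk, Or.inr ⟨hx, by simp [parity_simps]⟩,
          Or.inl ⟨hj, rfl⟩, Or.inl ⟨hk, rfl⟩, by omega, by omega, by omega⟩
        exact lt_of_le_of_ne (Fin.le_def.2 (by omega)) hxj
      · have := h2 j hj; omega
    · by_contra h3
      rcases hE.exists_hole with ⟨x, hx, hxq, hxt⟩ | ⟨_, h2⟩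
      · have hxk : x ≠ k := fun e => Finset.disjoint_left.1 hCH hk (e ▸ hx)
        refine hO ⟨i, x, k, _, 2 * f i + 2, _, Fin.lt_def.2 (by omega), ?_, Or.inl ⟨hi, rfl⟩,
          Or.inr ⟨hx, by simp [parity_simps]⟩, Or.inl ⟨hk, rfl⟩, by omega, by omega, by omega⟩
        exact lt_of_le_of_ne (Fin.le_def.2 (by omega)) hxk
      · have := h2 k hk; omega
    · by_contra h3
      rcases hE.exists_hole with ⟨x, hx, hxq, hxt⟩ | ⟨h2, _⟩
      · exact hO ⟨i, j, x, _, _, 0, hij, Fin.lt_def.2 (by omega), Or.inl ⟨hi, rfl⟩,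
          Or.inl ⟨hj, rfl⟩, Or.inr ⟨hx, by simp⟩, by omega, by omega, by omega⟩
      · omega

/-- Three hole-columns force an occurrence. -/
theorem occurs_of_three_holes (hh : Antitone h) {x y z : Fin n} (hx : x ∈ H) (hy : y ∈ H)
    (hz : z ∈ H) (hxy : x < y) (hyz : y < z) :
    Occurs C H h f perm312 ∧ Occurs C H h f perm231 := by
  rw [occurs312_iff hh, occurs231_iff hh]
  constructor <;>
  exact ⟨x, y, z, 0, 0, 0, hxy, hyz, Or.inr ⟨hx, by simp⟩, Or.inr ⟨hy, by simp⟩,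
    Or.inr ⟨hz, by simp⟩, by omega, by omega, by omega⟩

/-- Two hole-columns force an occurrence, unless the second one lies to the right of all standard
columns and below all their 1-cells. -/
theorem occurs_of_two_holes (hh : Antitone h) (hCH : Disjoint C H) {x y c : Fin n} (hx : x ∈ H)
    (hy : y ∈ H) (hc : c ∈ C) (hxy : x < y) (hlt : f c < h c) (hcy : ¬ (c < y ∧ h y ≤ f c)) :
    Occurs C H h f perm312 ∧ Occurs C H h f perm231 := by
  have hcx : c ≠ x := fun e => Finset.disjoint_left.1 hCH hc (e ▸ hx)
  have hcy' : c ≠ y := fun e => Finset.disjoint_left.1 hCH hc (e ▸ hy)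
  have hxl : ∀ v, Even v → HasLevel C H f x v := fun v hv => Or.inr ⟨hx, hv⟩
  have hyl : ∀ v, Even v → HasLevel C H f y v := fun v hv => Or.inr ⟨hy, hv⟩
  have hcl : HasLevel C H f c (2 * f c + 1) := Or.inl ⟨hc, rfl⟩
  have e2 : Even (2 * f c + 2) := by simp [parity_simps]
  rw [occurs312_iff hh, occurs231_iff hh]
  rcases lt_or_gt_of_ne hcy' with h1 | h1
  · have h2 : f c < h y := by by_contra h2; exact hcy ⟨h1, by omega⟩
    rcases lt_or_gt_of_ne hcx with h3 | h3
    · exact ⟨⟨c, x, y, _, 0, 0, h3, hxy, hcl, hxl _ (by simp), hyl _ (by simp), by omega,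
        by omega, by omega⟩, ⟨c, x, y, _, 2 * f c + 2, 0, h3, hxy, hcl, hxl _ e2,
        hyl _ (by simp), by omega, by omega, by omega⟩⟩
    · exact ⟨⟨x, c, y, 2 * f c + 2, _, 2 * f c + 2, h3, h1, hxl _ e2, hcl, hyl _ e2, by omega,
        by omega, by omega⟩, ⟨x, c, y, 0, _, 0, h3, h1, hxl _ (by simp), hcl,
        hyl _ (by simp), by omega, by omega, by omega⟩⟩
  · exact ⟨⟨x, y, c, 2 * f c + 2, 0, _, hxy, h1, hxl _ e2, hyl _ (by simp), hcl, by omega,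
      by omega, by omega⟩, ⟨x, y, c, 2 * f c + 2, 2 * f c + 2, _, hxy, h1, hxl _ e2,
      hyl _ e2, hcl, by omega, by omega, by omega⟩⟩

/-- With essentially one hole-column, the counts agree by reading along the border. -/
theorem encard_not_occurs_eq_of_essentiallyOneHole {R : Finset ℕ} {f₀ : Fin n → ℕ}
    (hh : Antitone h) (hCH : Disjoint C H)
    (hE : ∀ f ∈ transversals C R h f₀, EssentiallyOneHole C H h f q t)
    (hq1 : ∀ j ∈ C, (j : ℕ) < q → t ≤ h j) (hq2 : ∀ j ∈ C, q ≤ (j : ℕ) → h j ≤ t) :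
    {f ∈ transversals C R h f₀ | ¬ Occurs C H h f perm312}.encard =
      {f ∈ transversals C R h f₀ | ¬ Occurs C H h f perm231}.encard := by
  have h1 : {f ∈ transversals C R h f₀ | ¬ Occurs C H h f perm312} =
      {f ∈ transversals C R h f₀ | Avoids312At C h q t f} := by
    ext f
    refine and_congr_right fun hf => ?_
    rw [occurs312_iff_not_avoidsAt hh hCH hf.2.1.injOn hf.2.2 (hE f hf), not_not]
  have h2 : {f ∈ transversals C R h f₀ | ¬ Occurs C H h f perm231} =
      {f ∈ transversals C R h f₀ | Avoids231At C h q t f} := by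
    ext f
    refine and_congr_right fun hf => ?_
    rw [occurs231_iff_not_avoidsAt hh hCH hf.2.1.injOn (hE f hf), not_not]
  rw [h1, h2, encard_avoidsAt_eq C R hh f₀ hq1 hq2]

/-- As many transversals of a Ferrers shape with hole-columns avoid `312` as avoid `231`. -/
theorem encard_not_occurs_eq (C H : Finset (Fin n)) (hCH : Disjoint C H) (R : Finset ℕ)
    (hh : Antitone h) (f₀ : Fin n → ℕ) :
    {f ∈ transversals C R h f₀ | ¬ Occurs C H h f perm312}.encard =
      {f ∈ transversals C R h f₀ | ¬ Occurs C H h f perm231}.encard := by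
  have hempty : (∀ f ∈ transversals C R h f₀,
      Occurs C H h f perm312 ∧ Occurs C H h f perm231) →
      {f ∈ transversals C R h f₀ | ¬ Occurs C H h f perm312}.encard =
      {f ∈ transversals C R h f₀ | ¬ Occurs C H h f perm231}.encard := by
    intro hocc
    congr 1
    ext f
    refine and_congr_right fun hf => ?_
    simp [hocc f hf]
  by_cases h3 : 3 ≤ H.card
  · refine hempty fun f _ => ?_
    let e := H.orderEmbOfCardLe h3
    exact occurs_of_three_holes hh (H.orderEmbOfCardLe_mem h3 0) (H.orderEmbOfCardLe_mem h3 1)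
      (H.orderEmbOfCardLe_mem h3 2) (e.strictMono (by decide)) (e.strictMono (by decide))
  by_cases h2 : H.card = 2
  · have h2' : 2 ≤ H.card := h2.ge
    have hx := H.orderEmbOfCardLe_mem h2' 0
    have hy := H.orderEmbOfCardLe_mem h2' 1
    have hxy : H.orderEmbOfCardLe h2' 0 < H.orderEmbOfCardLe h2' 1 :=
      (H.orderEmbOfCardLe h2').strictMono (by decide)
    generalize H.orderEmbOfCardLe h2' 0 = x at hx hxy
    generalize H.orderEmbOfCardLe h2' 1 = y at hy hxy
    have hH : H = {x, y} := by
      symm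
      apply Finset.eq_of_subset_of_card_le
      · intro z hz
        simp only [Finset.mem_insert, Finset.mem_singleton] at hz
        rcases hz with rfl | rfl <;> assumption
      · rw [h2, Finset.card_pair hxy.ne]
    -- this case does not depend on the transversal, because the rows in `R` are all used
    by_cases hR : (∀ c ∈ C, c < y) ∧ ∀ r ∈ R, h y ≤ r
    · refine encard_not_occurs_eq_of_essentiallyOneHole (q := x) (t := h x) hh hCH
        (fun f hf => ⟨?_, ?_, Or.inl ⟨x, hx, rfl, rfl⟩⟩)
        (fun j _ hj => hh (Fin.le_def.2 hj.le)) (fun j _ hj => hh (Fin.le_def.2 hj))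
      · intro z hz
        rw [hH, Finset.mem_insert, Finset.mem_singleton] at hz
        rcases hz with rfl | rfl
        · exact Or.inl ⟨rfl, rfl⟩
        · exact Or.inr ⟨hxy, fun c hc => ⟨hR.1 c hc, hR.2 _ (hf.2.1.mapsTo hc)⟩⟩
      · intro z hz z' hz' h1 h2
        rw [hH, Finset.mem_insert, Finset.mem_singleton] at hz hz'
        rcases hz with rfl | rfl
        · exact absurd h1 (lt_irrefl _)
        · rcases hz' with rfl | rfl
          · exact absurd h2 (lt_irrefl _)
          · rfl
    · refine hempty fun f hf => ?_
      have : ∃ c ∈ C, ¬ (c < y ∧ h y ≤ f c) := by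
        by_contra hcon
        push Not at hcon
        refine hR ⟨fun c hc => (hcon c hc).1, fun r hr => ?_⟩
        obtain ⟨c, hc, rfl⟩ := hf.2.1.surjOn hr
        exact (hcon c hc).2
      obtain ⟨c, hc, hcy⟩ := this
      exact occurs_of_two_holes hh hCH hx hy hc hxy (hf.2.2 c hc) hcy
  by_cases h1 : H.card = 1
  · obtain ⟨x, rfl⟩ := Finset.card_eq_one.1 h1
    refine encard_not_occurs_eq_of_essentiallyOneHole (q := x) (t := h x) hh hCH
        (fun f hf => ⟨?_, ?_, Or.inl ⟨x, by simp, rfl, rfl⟩⟩)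
        (fun j _ hj => hh (Fin.le_def.2 hj.le)) (fun j _ hj => hh (Fin.le_def.2 hj))
    · intro z hz
      rw [Finset.mem_singleton] at hz
      subst hz
      exact Or.inl ⟨rfl, rfl⟩
    · intro z hz z' hz' _ _
      rw [Finset.mem_singleton] at hz hz'
      rw [hz, hz']
  · have h0 : H = ∅ := Finset.card_eq_zero.1 (by omega)
    -- a virtual hole-column of height `0` behind all columns imposes no condition
    subst h0
    refine encard_not_occurs_eq_of_essentiallyOneHole (q := n) (t := 0) hh hCH
        (fun f hf => ⟨by simp, by simp, Or.inr ⟨rfl, fun c _ => c.2⟩⟩)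
        (fun j _ _ => Nat.zero_le _) (fun j _ hj => ?_)
    have := j.2
    omega

end

/-! ### Avoidance for partial fillings -/

theorem FerrersDiagram.lt_rowLength_iff {m : ℕ} (D : FerrersDiagram m) (i : ℕ) (c : Fin m) :
    (c : ℕ) < D.rowLength i ↔ i < D.height c := by
  have hsub : ∀ a : Fin m, i < D.height a → ∀ b ≤ a, i < D.height b := fun a ha b hb =>
    ha.trans_le (D.antitone_height hb)
  constructor
  · intro hc
    by_contra hi
    have : (Finset.univ.filter fun j => i < D.height j) ⊆ Finset.Iio c := by
      intro a ha
      rw [Finset.mem_filter] at ha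
      rw [Finset.mem_Iio]
      by_contra hac
      exact hi (hsub a ha.2 c (not_lt.1 hac))
    have := Finset.card_le_card this
    rw [Fin.card_Iio] at this
    exact absurd hc (not_lt.2 this)
  · intro hi
    have : Finset.Iic c ⊆ (Finset.univ.filter fun j => i < D.height j) := by
      intro a ha
      rw [Finset.mem_Iic] at ha
      rw [Finset.mem_filter]
      exact ⟨Finset.mem_univ _, hsub c hi a ha⟩
    have := Finset.card_le_card this
    rw [Fin.card_Iic] at this
    exact this

theorem FerrersDiagram.rowLength_le {m : ℕ} (D : FerrersDiagram m) (i : ℕ) :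
    D.rowLength i ≤ m := by
  have := Finset.card_filter_le (Finset.univ : Finset (Fin m)) (fun j => i < D.height j)
  rwa [Finset.card_univ, Fintype.card_fin] at this

theorem FerrersDiagram.rowLength_anti {m : ℕ} (D : FerrersDiagram m) {i i' : ℕ} (h : i ≤ i') :
    D.rowLength i' ≤ D.rowLength i :=
  Finset.card_le_card fun a ha => by
    rw [Finset.mem_filter] at ha ⊢
    exact ⟨ha.1, h.trans_lt ha.2⟩

namespace PartialFilling

variable {m l : ℕ}

/-- The levels that an entry in column `j` of a partial filling may have: the level `2 r + 1` if the
1-cell of the column is in row `r`, and any even level if `j` is a hole-column. -/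
def HasLevel (F : PartialFilling m) (j : Fin m) (v : ℕ) : Prop :=
  (∃ r, (r, j) ∈ F.ones ∧ v = 2 * r + 1) ∨ (j ∈ F.holes ∧ Even v)

/-- The pattern `p` occurs in the partial filling `F`, after suitable substitutions. -/
def HasOccurrence (F : PartialFilling m) (p : Equiv.Perm (Fin l)) : Prop :=
  ∃ (c : Fin l → Fin m) (v : Fin l → ℕ), StrictMono c ∧ (∀ b, F.HasLevel (c b) (v b)) ∧
    (∀ a b, p a < p b → v a ≤ v b) ∧ ∀ a b, v a ≤ 2 * F.diagram.height (c b)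

/-- No row contains two 1-cells. -/
def RowsUnique (F : PartialFilling m) : Prop :=
  ∀ r c c', (r, c) ∈ F.ones → (r, c') ∈ F.ones → c = c'

theorem RowsUnique.of_isSubstitution {F G : PartialFilling m} {j : Fin m} (hF : F.RowsUnique)
    (h : F.IsSubstitution j G) : G.RowsUnique := by
  obtain ⟨_, i, len, _, _, _, _, _, _, _, hones⟩ := h
  intro r c c' h1 h2
  rw [hones] at h1 h2
  rcases h1 with ⟨h1, rfl⟩ | ⟨h1, h1'⟩ | ⟨h1, h1'⟩ <;>
    rcases h2 with ⟨h2, rfl⟩ | ⟨h2, h2'⟩ | ⟨h2, h2'⟩ <;>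
      first | rfl | omega | exact hF _ _ _ h1' h2'

/-- An occurrence in the result of a substitution comes from an occurrence before the substitution:
the new row becomes a gap again. -/
theorem HasOccurrence.of_isSubstitution {F G : PartialFilling m} {j : Fin m}
    {p : Equiv.Perm (Fin l)} (h : F.IsSubstitution j G) (hG : G.HasOccurrence p) :
    F.HasOccurrence p := by
  obtain ⟨hj, i, len, hij, hjl, hil, h0, h1, hht, hholes, hones⟩ := h
  obtain ⟨c, v, hc, hv, hp, hb⟩ := hG
  refine ⟨c, fun b => if v b ≤ 2 * i then v b else if v b ≤ 2 * i + 2 then 2 * i else v b - 2,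
    hc, fun b => ?_, fun a b hab => ?_, fun a b => ?_⟩
  · beta_reduce
    rcases hv b with ⟨r, hr, hvr⟩ | ⟨hb1, hb2⟩
    · rw [hones] at hr
      rcases hr with ⟨rfl, hcj⟩ | ⟨hr, hr'⟩ | ⟨hr, hr'⟩
      · right
        rw [hcj, if_neg (by omega), if_pos (by omega)]
        exact ⟨hj, by simp⟩
      · left
        rw [if_pos (by omega)]
        exact ⟨r, hr', hvr⟩
      · left
        rw [if_neg (by omega), if_neg (by omega)]
        exact ⟨r - 1, hr', by omega⟩
    · right
      rw [hholes] at hb1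
      refine ⟨Finset.mem_of_mem_erase hb1, ?_⟩
      obtain ⟨k, hk⟩ := hb2
      split_ifs
      · exact ⟨k, hk⟩
      · simp
      · exact ⟨k - 1, by omega⟩
  · have := hp a b hab
    simp only
    split_ifs <;> omega
  · have h2 := hb a b
    rw [hht] at h2
    simp only
    by_cases hcl : (c b : ℕ) < len
    · rw [if_pos hcl] at h2
      have h3 : i ≤ F.diagram.height (c b) := by
        rcases Nat.eq_zero_or_pos i with rfl | hi
        · exact Nat.zero_le _
        · have := (F.diagram.lt_rowLength_iff (i - 1) (c b)).1 (hcl.trans_le (h1 hi))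
          omega
      split_ifs <;> omega
    · rw [if_neg hcl] at h2
      have h3 : ¬ i < F.diagram.height (c b) := by
        rw [← F.diagram.lt_rowLength_iff]
        omega
      split_ifs <;> omega

/-- The result of inserting a row of length `len` below row `i`, for the hole-column `j`. -/
def substitute (F : PartialFilling m) (j : Fin m) (i len : ℕ) (hj : j ∈ F.holes)
    (hij : i ≤ F.diagram.height j) (hjl : (j : ℕ) < len) (hil : F.diagram.rowLength i ≤ len) :
    PartialFilling m where
  diagram :=
    { height := fun c => if (c : ℕ) < len then F.diagram.height c + 1 else F.diagram.height c
      antitone_height := by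
        intro a b hab
        have := F.diagram.antitone_height hab
        have hab' : (a : ℕ) ≤ b := hab
        simp only
        split_ifs <;> omega }
  holes := F.holes.erase j
  ones := insert (i, j) (F.ones.image fun x => if x.1 < i then x else (x.1 + 1, x.2))
  mem_diagram := by
    intro r c h
    rw [Finset.mem_insert, Finset.mem_image] at h
    simp only
    rcases h with h | ⟨⟨r', c'⟩, h1, h2⟩
    · rw [Prod.mk.injEq] at h
      obtain ⟨rfl, rfl⟩ := h
      rw [if_pos hjl]; omega
    · have h3 := F.mem_diagram r' c' h1
      simp only at h2
      split_ifs at h2 with h4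
      · rw [Prod.mk.injEq] at h2
        obtain ⟨rfl, rfl⟩ := h2
        split_ifs <;> omega
      · rw [Prod.mk.injEq] at h2
        obtain ⟨rfl, rfl⟩ := h2
        have : (c' : ℕ) < F.diagram.rowLength i := (F.diagram.lt_rowLength_iff _ _).2 (by omega)
        rw [if_pos (by omega)]
        omega
  not_mem_holes := by
    intro r c h
    rw [Finset.mem_insert, Finset.mem_image] at h
    rw [Finset.mem_erase, not_and]
    rcases h with h | ⟨⟨r', c'⟩, h1, h2⟩
    · rw [Prod.mk.injEq] at h
      exact fun h' => absurd h.2 h'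
    · have h3 := F.not_mem_holes r' c' h1
      intro _
      simp only at h2
      split_ifs at h2 with h4 <;> rw [Prod.mk.injEq] at h2 <;> rwa [← h2.2]

theorem mem_ones_substitute (F : PartialFilling m) {j : Fin m} {i len : ℕ} (hj : j ∈ F.holes)
    (hij : i ≤ F.diagram.height j) (hjl : (j : ℕ) < len) (hil : F.diagram.rowLength i ≤ len)
    (r : ℕ) (c : Fin m) : (r, c) ∈ (F.substitute j i len hj hij hjl hil).ones ↔
      (r = i ∧ c = j) ∨ (r < i ∧ (r, c) ∈ F.ones) ∨ (i < r ∧ (r - 1, c) ∈ F.ones) := by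
  simp only [substitute, Finset.mem_insert, Finset.mem_image, Prod.mk.injEq, Prod.exists]
  apply or_congr_right
  constructor
  · rintro ⟨a, b, h1, h2⟩
    split_ifs at h2 with h3
    · rw [Prod.mk.injEq] at h2
      obtain ⟨rfl, rfl⟩ := h2
      exact Or.inl ⟨h3, h1⟩
    · rw [Prod.mk.injEq] at h2
      obtain ⟨rfl, rfl⟩ := h2
      exact Or.inr ⟨by omega, by simpa using h1⟩
  · rintro (⟨h1, h2⟩ | ⟨h1, h2⟩)
    · exact ⟨r, c, h2, by rw [if_pos h1]⟩
    · refine ⟨r - 1, c, h2, ?_⟩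
      rw [if_neg (by omega)]
      congr 1
      omega

/-- As long as there are hole-columns, an occurrence survives a suitable substitution: the new row
is inserted, as long as possible, in the gap of the entry in the hole-column. -/
theorem HasOccurrence.exists_isSubstitution {F : PartialFilling m} {p : Equiv.Perm (Fin l)}
    {j : Fin m} (hj : j ∈ F.holes) (hF : F.HasOccurrence p) :
    ∃ G, F.IsSubstitution j G ∧ G.HasOccurrence p := by
  classical
  obtain ⟨c, v, hc, hv, hp, hb⟩ := hF
  have hjo : ∀ r, (r, j) ∉ F.ones := fun r h => F.not_mem_holes r j h hj
  -- if the hole-column is not used by the occurrence, any gap will do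
  have hi : ∃ i ≤ F.diagram.height j, ∀ b, c b = j → v b = 2 * i := by
    by_cases hcj : ∃ b, c b = j
    · obtain ⟨b, hbj⟩ := hcj
      rcases hv b with ⟨r, hr, _⟩ | ⟨_, k, hk⟩
      · rw [hbj] at hr; exact absurd hr (hjo r)
      · refine ⟨k, ?_, fun b' hb' => ?_⟩
        · have := hb b b; rw [hbj] at this; omega
        · rw [hc.injective (hb'.trans hbj.symm)]; omega
    · exact ⟨0, Nat.zero_le _, fun b hbj => absurd ⟨b, hbj⟩ hcj⟩
  obtain ⟨i, hij, hvi⟩ := hi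
  -- the longest row that fits, so that all columns of height at least `i` meet it
  let len := if i = 0 then m else F.diagram.rowLength (i - 1)
  have hlen : ∀ x : Fin m, i ≤ F.diagram.height x → (x : ℕ) < len := by
    intro x hx
    simp only [len]
    split_ifs with h
    · exact x.2
    · rw [F.diagram.lt_rowLength_iff]; omega
  have hil : F.diagram.rowLength i ≤ len := by
    simp only [len]
    split_ifs with h
    · exact F.diagram.rowLength_le i
    · exact F.diagram.rowLength_anti (Nat.sub_le _ _)
  -- the gap `2 i` splits into two gaps around the new row; its other entries go above or below the
  -- new row according to the pattern
  refine ⟨F.substitute j i len hj hij (hlen j hij) hil, ⟨hj, i, len, hij, hlen j hij, hil, ?_, ?_,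
    fun c => rfl, rfl, F.mem_ones_substitute hj hij (hlen j hij) hil⟩, c,
    fun b => if v b < 2 * i then v b else if v b = 2 * i then
      (if c b = j then 2 * i + 1 else if ∃ b₀, c b₀ = j ∧ p b₀ < p b then 2 * i + 2 else 2 * i)
      else v b + 2, hc, fun b => ?_, fun a b hab => ?_, fun a b => ?_⟩
  · intro h; simp [len, h]
  · intro h; simp only [len]; rw [if_neg (by omega)]
  · beta_reduce
    rcases hv b with ⟨r, hr, hvr⟩ | ⟨hb1, hb2⟩
    · left
      by_cases hri : r < i
      · rw [if_pos (by omega)]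
        exact ⟨r, (F.mem_ones_substitute ..).2 (Or.inr (Or.inl ⟨hri, hr⟩)), hvr⟩
      · rw [if_neg (by omega), if_neg (by omega)]
        exact ⟨r + 1, (F.mem_ones_substitute ..).2 (Or.inr (Or.inr ⟨by omega, hr⟩)), by omega⟩
    · by_cases hbj : c b = j
      · left
        have := hvi b hbj
        rw [if_neg (by omega), if_pos this, if_pos hbj]
        exact ⟨i, (F.mem_ones_substitute ..).2 (Or.inl ⟨rfl, hbj⟩), rfl⟩
      · right
        refine ⟨Finset.mem_erase.2 ⟨hbj, hb1⟩, ?_⟩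
        rw [if_neg hbj]
        split_ifs
        · exact hb2
        · simp [parity_simps]
        · simp
        · exact hb2.add even_two
  · have h1 := hp a b hab
    simp only
    by_cases ha : v a = 2 * i
    · by_cases hb' : v b = 2 * i
      · have h2 : ∀ b₀, c b₀ = j → c a = j → p b₀ = p a := fun b₀ h h' => by
          rw [hc.injective (h.trans h'.symm)]
        simp only [ha, hb', lt_irrefl, if_false, if_true]
        by_cases haj : c a = j
        · have hbj : c b ≠ j := fun h => hab.ne (h2 b h haj).symm
          rw [if_pos haj, if_neg hbj, if_pos ⟨a, haj, hab⟩]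
          omega
        · rw [if_neg haj]
          by_cases hbj : c b = j
          · rw [if_pos hbj, if_neg]
            · omega
            · rintro ⟨b₀, h3, h4⟩
              rw [hc.injective (h3.trans hbj.symm)] at h4
              exact lt_asymm h4 hab
          · rw [if_neg hbj]
            by_cases h5 : ∃ b₀, c b₀ = j ∧ p b₀ < p a
            · rw [if_pos h5, if_pos]
              obtain ⟨b₀, h6, h7⟩ := h5
              exact ⟨b₀, h6, h7.trans hab⟩
            · rw [if_neg h5]
              split_ifs <;> omega
      · simp only [ha, hb', lt_irrefl, if_false, if_true, show ¬ v b < 2 * i by omega]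
        split_ifs <;> omega
    · split_ifs <;> omega
  · have h1 := hb a b
    show _ ≤ 2 * (if (c b : ℕ) < len then F.diagram.height (c b) + 1 else F.diagram.height (c b))
    beta_reduce
    by_cases ha : v a < 2 * i
    · rw [if_pos ha]
      split_ifs <;> omega
    · rw [if_pos (hlen (c b) (by omega))]
      split_ifs <;> omega

/-- Without hole-columns, distinct entries have distinct levels, and weak order means strict
order. -/
theorem contains_iff_hasOccurrence {G : PartialFilling m} (hG : G.RowsUnique)
    (hholes : G.holes = ∅) (p : Equiv.Perm (Fin l)) : G.Contains p ↔ G.HasOccurrence p := by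
  constructor
  · rintro ⟨r, c, hr, hc, hcell, hones⟩
    refine ⟨c, fun b => 2 * r (p b) + 1, hc, fun b => Or.inl ⟨r (p b), (hones _ _).2 rfl, rfl⟩,
      fun a b hab => ?_, fun a b => ?_⟩
    · have := hr hab; beta_reduce; omega
    · have := hcell (p a) b; beta_reduce; omega
  · rintro ⟨c, v, hc, hv, hp, hb⟩
    have : ∀ b, ∃ r, (r, c b) ∈ G.ones ∧ v b = 2 * r + 1 := by
      intro b
      rcases hv b with h | ⟨h, _⟩
      · exact h
      · simp [hholes] at h
    choose r hr hvr using this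
    have hcell : ∀ a b, r a < G.diagram.height (c b) := by
      intro a b
      have := hb a b
      have := hvr a
      omega
    refine ⟨fun a => r (p.symm a), c, fun a a' haa' => ?_, hc, fun a b => hcell _ b,
      fun a b => ?_⟩
    · have h1 := hp (p.symm a) (p.symm a') (by simpa using haa')
      have h2 := hvr (p.symm a)
      have h3 := hvr (p.symm a')
      have h4 : r (p.symm a) ≠ r (p.symm a') := by
        intro h
        have h5 := hr (p.symm a)
        rw [h] at h5
        have := hc.injective (hG _ _ _ h5 (hr _))
        exact haa'.ne (p.symm.injective this)
      simp only
      omega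
    · constructor
      · intro h
        have := hc.injective (hG _ _ _ h (hr _))
        rw [this, Equiv.apply_symm_apply]
      · rintro rfl
        simpa using hr b

/-- Some extension contains `p` if and only if `p` occurs with weakly ordered levels, as occurrences
can be transported back and forth along substitutions. -/
theorem avoids_iff_not_hasOccurrence {F : PartialFilling m} (hF : F.RowsUnique)
    (p : Equiv.Perm (Fin l)) : F.Avoids p ↔ ¬ F.HasOccurrence p := by
  have back : ∀ G, Relation.ReflTransGen (fun A B => ∃ j, IsSubstitution A j B) F G →
      G.RowsUnique ∧ (G.HasOccurrence p → F.HasOccurrence p) := by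
    intro G hG
    induction hG with
    | refl => exact ⟨hF, id⟩
    | tail _ h ih =>
      obtain ⟨j, hj⟩ := h
      exact ⟨ih.1.of_isSubstitution hj, fun h => ih.2 (h.of_isSubstitution hj)⟩
  constructor
  · intro hav hocc
    have forth : ∀ k (A : PartialFilling m), A.holes.card = k →
        Relation.ReflTransGen (fun A B => ∃ j, IsSubstitution A j B) F A →
        A.HasOccurrence p → False := by
      intro k
      induction k with
      | zero =>
        intro A hA hFA hocc
        have h0 : A.holes = ∅ := Finset.card_eq_zero.1 hA
        exact hav A ⟨hFA, h0⟩ ((contains_iff_hasOccurrence (back A hFA).1 h0 p).2 hocc)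
      | succ k ih =>
        intro A hA hFA hocc
        obtain ⟨j, hj⟩ := Finset.card_pos.1 (by omega : 0 < A.holes.card)
        obtain ⟨G, hG, hoccG⟩ := hocc.exists_isSubstitution hj
        refine ih G ?_ (hFA.tail ⟨j, hG⟩) hoccG
        obtain ⟨_, _, _, _, _, _, _, _, _, hh, _⟩ := hG
        rw [hh, Finset.card_erase_of_mem hj, hA]
        rfl
    exact forth _ F rfl .refl hocc
  · rintro hocc G ⟨hG, hh⟩ hcon
    obtain ⟨h1, h2⟩ := back G hG
    exact hocc (h2 ((contains_iff_hasOccurrence h1 hh p).1 hcon))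

open Classical in
/-- The row of the 1-cell of column `j`, and `0` if there is none. -/
noncomputable def rowOf (F : PartialFilling m) (j : Fin m) : ℕ :=
  if h : ∃ i, (i, j) ∈ F.ones then h.choose else 0

theorem IsTransversal.mem_ones_iff {F : PartialFilling m} (hF : F.IsTransversal) {i : ℕ}
    {j : Fin m} : (i, j) ∈ F.ones ↔ j ∉ F.holes ∧ i = F.rowOf j := by
  constructor
  · intro h
    have hj := F.not_mem_holes i j h
    have hex : ∃ i, (i, j) ∈ F.ones := ⟨i, h⟩
    refine ⟨hj, ?_⟩
    rw [rowOf, dif_pos hex]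
    exact (hF.2 j hj).unique h hex.choose_spec
  · rintro ⟨hj, rfl⟩
    have hex : ∃ i, (i, j) ∈ F.ones := (hF.2 j hj).exists
    rw [rowOf, dif_pos hex]
    exact hex.choose_spec

theorem IsTransversal.rowsUnique {F : PartialFilling m} (hF : F.IsTransversal) :
    F.RowsUnique := fun r c _ h h' =>
  (hF.1 r ⟨c, F.mem_diagram r c h⟩).unique h h'

theorem IsTransversal.avoids_iff {F : PartialFilling m} (hF : F.IsTransversal)
    (p : Equiv.Perm (Fin l)) :
    F.Avoids p ↔ ¬ Occurs F.holesᶜ F.holes F.diagram.height F.rowOf p := by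
  rw [avoids_iff_not_hasOccurrence hF.rowsUnique, HasOccurrence, Occurs]
  have : ∀ j v, F.HasLevel j v ↔ _root_.HasLevel F.holesᶜ F.holes F.rowOf j v := by
    intro j v
    rw [HasLevel, _root_.HasLevel]
    apply or_congr_left
    simp only [hF.mem_ones_iff, Finset.mem_compl]
    constructor
    · rintro ⟨r, ⟨h, rfl⟩, h'⟩; exact ⟨h, h'⟩
    · rintro ⟨h, h'⟩; exact ⟨_, ⟨h, rfl⟩, h'⟩
  simp only [this]

theorem ext_fields {F G : PartialFilling m} (h1 : F.diagram = G.diagram) (h2 : F.holes = G.holes)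
    (h3 : F.ones = G.ones) : F = G := by
  cases F; cases G
  simp only at h1 h2 h3
  subst h1 h2 h3
  rfl

/-- The rows of a Ferrers diagram. -/
def _root_.FerrersDiagram.rows (D : FerrersDiagram m) : Finset ℕ :=
  Finset.range (Finset.univ.sup D.height)

theorem _root_.FerrersDiagram.mem_rows {D : FerrersDiagram m} {i : ℕ} :
    i ∈ D.rows ↔ ∃ j, i < D.height j := by
  rw [FerrersDiagram.rows, Finset.mem_range, Finset.lt_sup_iff]
  simp

/-- Partial transversals correspond to the functions that give the rows of their 1-cells. -/
theorem image_rowOf (D : FerrersDiagram m) (H : Finset (Fin m)) (p : Equiv.Perm (Fin l)) :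
    rowOf '' {F : PartialFilling m | F.diagram = D ∧ F.IsTransversal ∧ F.Avoids p ∧ F.holes = H} =
      {f ∈ transversals Hᶜ D.rows D.height (fun _ => 0) | ¬ Occurs Hᶜ H D.height f p} := by
  ext f
  constructor
  · rintro ⟨F, ⟨rfl, hF, hav, rfl⟩, rfl⟩
    refine ⟨⟨fun j hj => ?_, ⟨fun j hj => ?_, fun i hi j hj hij => ?_, fun r hr => ?_⟩,
      fun j hj => ?_⟩, (hF.avoids_iff p).1 hav⟩
    · rw [rowOf, dif_neg]
      rintro ⟨i, hi⟩
      exact hj (Finset.mem_compl.2 (F.not_mem_holes i j hi))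
    · have := hF.mem_ones_iff.2 ⟨Finset.mem_compl.1 hj, rfl⟩
      exact FerrersDiagram.mem_rows.2 ⟨j, F.mem_diagram _ _ this⟩
    · have h1 := hF.mem_ones_iff.2 ⟨Finset.mem_compl.1 hi, rfl⟩
      have h2 := hF.mem_ones_iff.2 ⟨Finset.mem_compl.1 hj, rfl⟩
      rw [hij] at h1
      exact hF.rowsUnique _ _ _ h1 h2
    · obtain ⟨j, hj, _⟩ := hF.1 r (FerrersDiagram.mem_rows.1 hr)
      rw [hF.mem_ones_iff] at hj
      exact ⟨j, Finset.mem_compl.2 hj.1, hj.2.symm⟩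
    · exact F.mem_diagram _ _ (hF.mem_ones_iff.2 ⟨Finset.mem_compl.1 hj, rfl⟩)
  · rintro ⟨⟨h0, hb, hlt⟩, hocc⟩
    let F : PartialFilling m :=
      { diagram := D
        holes := H
        ones := Hᶜ.image fun j => (f j, j)
        mem_diagram := by
          intro i j h
          obtain ⟨k, hk, hkj⟩ := Finset.mem_image.1 h
          obtain ⟨rfl, rfl⟩ := Prod.mk.inj hkj
          exact hlt k hk
        not_mem_holes := by
          intro i j h
          obtain ⟨k, hk, hkj⟩ := Finset.mem_image.1 h
          obtain ⟨rfl, rfl⟩ := Prod.mk.inj hkj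
          exact Finset.mem_compl.1 hk }
    have hones : ∀ i j, (i, j) ∈ F.ones ↔ j ∈ Hᶜ ∧ i = f j := by
      intro i j
      simp only [F, Finset.mem_image, Prod.mk.injEq]
      constructor
      · rintro ⟨k, hk, rfl, rfl⟩; exact ⟨hk, rfl⟩
      · rintro ⟨hj, rfl⟩; exact ⟨j, hj, rfl, rfl⟩
    have hF : F.IsTransversal := by
      constructor
      · intro i hi
        obtain ⟨j, hj, rfl⟩ := hb.surjOn (FerrersDiagram.mem_rows.2 hi)
        exact ⟨j, (hones _ _).2 ⟨hj, rfl⟩, fun k hk => hb.injOn ((hones _ _).1 hk).1 hj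
          ((hones _ _).1 hk).2.symm⟩
      · intro j hj
        exact ⟨f j, (hones _ _).2 ⟨Finset.mem_compl.2 hj, rfl⟩, fun i hi => ((hones _ _).1 hi).2⟩
    have hrow : F.rowOf = f := by
      funext j
      by_cases hj : j ∈ H
      · rw [rowOf, dif_neg]
        · exact (h0 j (by simpa using hj)).symm
        · rintro ⟨i, hi⟩
          exact F.not_mem_holes i j hi hj
      · exact (hF.mem_ones_iff.1 ((hones _ _).2 ⟨Finset.mem_compl.2 hj, rfl⟩)).2.symm
    refine ⟨F, ⟨rfl, hF, ?_, rfl⟩, hrow⟩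
    rw [hF.avoids_iff, hrow]
    exact hocc

theorem injOn_rowOf (D : FerrersDiagram m) (H : Finset (Fin m)) (p : Equiv.Perm (Fin l)) :
    Set.InjOn rowOf
      {F : PartialFilling m | F.diagram = D ∧ F.IsTransversal ∧ F.Avoids p ∧ F.holes = H} := by
  rintro F ⟨rfl, hF, _, rfl⟩ G ⟨h1, hG, _, h2⟩ h
  refine ext_fields h1.symm h2.symm ?_
  ext ⟨i, j⟩
  rw [hF.mem_ones_iff, hG.mem_ones_iff, h2, h]

end PartialFilling

theorem finite_transversals {n : ℕ} (C : Finset (Fin n)) (R : Finset ℕ) (h f₀ : Fin n → ℕ) :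
    (transversals C R h f₀).Finite := by
  refine (Set.finite_Iic (fun j => max (h j) (f₀ j))).subset fun f hf j => ?_
  by_cases hj : j ∈ C
  · exact le_max_of_le_left (hf.2.2 j hj).le
  · exact le_max_of_le_right (hf.1 j hj).le

theorem shapeStarWilfEquivalent_312_231 : ShapeStarWilfEquivalent perm312 perm231 := by
  intro m D
  have hfib : ∀ H : Finset (Fin m), Nonempty
      ({F : AvoidingTransversal D perm312 // F.1.holes = H} ≃
        {F : AvoidingTransversal D perm231 // F.1.holes = H}) := by
    intro H
    let S : ∀ _ : Equiv.Perm (Fin 3), Set (PartialFilling m) := fun p =>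
      {F | F.diagram = D ∧ F.IsTransversal ∧ F.Avoids p ∧ F.holes = H}
    have e : ∀ p : Equiv.Perm (Fin 3),
        {F : AvoidingTransversal D p // F.1.holes = H} ≃ S p := fun p =>
      { toFun := fun F => ⟨F.1.1, F.1.2.1, F.1.2.2.1, F.1.2.2.2, F.2⟩
        invFun := fun F => ⟨⟨F.1, F.2.1, F.2.2.1, F.2.2.2.1⟩, F.2.2.2.2⟩
        left_inv := fun _ => rfl
        right_inv := fun _ => rfl }
    have hcard : (S perm312).encard = (S perm231).encard := by
      rw [← (PartialFilling.injOn_rowOf D H perm312).encard_image,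
        ← (PartialFilling.injOn_rowOf D H perm231).encard_image,
        PartialFilling.image_rowOf, PartialFilling.image_rowOf]
      exact encard_not_occurs_eq _ _ disjoint_compl_left _ D.antitone_height _
    have hfin : ∀ p, (S p).Finite := by
      intro p
      refine Set.Finite.of_finite_image ?_ (PartialFilling.injOn_rowOf D H p)
      rw [PartialFilling.image_rowOf]
      exact (finite_transversals _ _ _ _).subset fun f hf => hf.1
    have := (hfin perm312).to_subtype
    have := (hfin perm231).to_subtype
    obtain ⟨e'⟩ := Finite.card_eq.1
      (show Nat.card (S perm312) = Nat.card (S perm231) from congrArg ENat.toNat hcard)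
    exact ⟨(e _).trans (e'.trans (e _).symm)⟩
  let φ := fun (p : Equiv.Perm (Fin 3)) (F : AvoidingTransversal D p) => F.1.holes
  let e := (Equiv.sigmaFiberEquiv (φ perm312)).symm.trans
    ((Equiv.sigmaCongrRight fun H => (hfib H).some).trans (Equiv.sigmaFiberEquiv (φ perm231)))
  exact ⟨e, fun F => ((hfib F.1.holes).some ⟨F, rfl⟩).2⟩

/-! ### Patterns with an appended part -/

section

variable {n x l : ℕ}

/-- The pattern `X` occurs, with levels at most `2 N`, to the right of column `j` and above the gap
below row `g`. -/
def OccursAbove (C H : Finset (Fin n)) (N : ℕ) (X : Equiv.Perm (Fin x)) (f : Fin n → ℕ)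
    (g : ℕ) (j : Fin n) : Prop :=
  ∃ (c : Fin x → Fin n) (v : Fin x → ℕ), StrictMono c ∧ (∀ b, HasLevel C H f (c b) (v b)) ∧
    (∀ a b, X a < X b → v a ≤ v b) ∧ (∀ b, v b ≤ 2 * N) ∧ (∀ b, j < c b) ∧ ∀ b, 2 * g ≤ v b

open Classical in
/-- The height of the part of column `j` that consists of the cells with an occurrence of `X` above
and to the right. -/
noncomputable def supportHeight (C H : Finset (Fin n)) (N : ℕ) (X : Equiv.Perm (Fin x))
    (f : Fin n → ℕ) (j : Fin n) : ℕ :=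
  Nat.findGreatest (fun g => OccursAbove C H N X f g j) N

open Classical in
/-- The standard columns whose 1-cell has an occurrence of `X` above and to the right. -/
noncomputable def supportCols (C H : Finset (Fin n)) (N : ℕ) (X : Equiv.Perm (Fin x))
    (f : Fin n → ℕ) : Finset (Fin n) :=
  C.filter fun j => f j < supportHeight C H N X f j

open Classical in
/-- The hole-columns with an occurrence of `X` to the right. -/
noncomputable def supportHoles (C H : Finset (Fin n)) (N : ℕ) (X : Equiv.Perm (Fin x))
    (f : Fin n → ℕ) : Finset (Fin n) :=
  H.filter fun j => OccursAbove C H N X f 0 j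

variable {C H : Finset (Fin n)} {N : ℕ} {X : Equiv.Perm (Fin x)} {f f' : Fin n → ℕ}

theorem OccursAbove.mono {g g' : ℕ} {j j' : Fin n} (h : OccursAbove C H N X f g j) (hg : g' ≤ g)
    (hj : j' ≤ j) : OccursAbove C H N X f g' j' := by
  obtain ⟨c, v, h1, h2, h3, h4, h5, h6⟩ := h
  exact ⟨c, v, h1, h2, h3, h4, fun b => hj.trans_lt (h5 b), fun b => le_trans (by omega) (h6 b)⟩

theorem supportHeight_le (j : Fin n) : supportHeight C H N X f j ≤ N := by
  classical
  exact Nat.findGreatest_le N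

theorem le_supportHeight {g : ℕ} {j : Fin n} (hg : g ≤ N) (h : OccursAbove C H N X f g j) :
    g ≤ supportHeight C H N X f j := by
  classical
  exact Nat.le_findGreatest hg h

theorem mem_supportCols {j : Fin n} :
    j ∈ supportCols C H N X f ↔ j ∈ C ∧ f j < supportHeight C H N X f j := by
  classical
  exact Finset.mem_filter

theorem mem_supportHoles {j : Fin n} :
    j ∈ supportHoles C H N X f ↔ j ∈ H ∧ OccursAbove C H N X f 0 j := by
  classical
  exact Finset.mem_filter

theorem occursAbove_supportHeight {g : ℕ} {j : Fin n} (h : OccursAbove C H N X f g j)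
    (hg : g ≤ N) : OccursAbove C H N X f (supportHeight C H N X f j) j := by
  classical
  exact Nat.findGreatest_spec (P := fun g => OccursAbove C H N X f g j) hg h

theorem occursAbove_of_lt_supportHeight {r : ℕ} {j : Fin n}
    (h : r < supportHeight C H N X f j) : OccursAbove C H N X f (r + 1) j := by
  classical
  have : OccursAbove C H N X f (supportHeight C H N X f j) j :=
    Nat.findGreatest_of_ne_zero (P := fun g => OccursAbove C H N X f g j) rfl
      (show supportHeight C H N X f j ≠ 0 by omega)
  exact this.mono h le_rfl

theorem antitone_supportHeight : Antitone (supportHeight C H N X f) := by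
  intro i j hij
  by_cases h0 : supportHeight C H N X f j = 0
  · omega
  · have h1 : supportHeight C H N X f j - 1 < supportHeight C H N X f j := by omega
    have h2 := occursAbove_of_lt_supportHeight h1
    have h3 := supportHeight_le (C := C) (H := H) (N := N) (X := X) (f := f) j
    have := le_supportHeight (by omega) (h2.mono le_rfl hij)
    omega

theorem castAdd_lt_natAdd {a b : ℕ} (i : Fin a) (j : Fin b) :
    Fin.castAdd b i < Fin.natAdd a j := by
  have := i.2
  rw [Fin.lt_def, Fin.val_castAdd, Fin.val_natAdd]
  omega

theorem appendShift_castAdd {a b : ℕ} (p : Equiv.Perm (Fin a)) (X : Equiv.Perm (Fin b))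
    (i : Fin a) : appendShift p X (Fin.castAdd b i) = Fin.castAdd b (p i) := by
  simp [appendShift, Equiv.permCongr_apply]

theorem appendShift_natAdd {a b : ℕ} (p : Equiv.Perm (Fin a)) (X : Equiv.Perm (Fin b))
    (i : Fin b) : appendShift p X (Fin.natAdd a i) = Fin.natAdd a (X i) := by
  simp [appendShift, Equiv.permCongr_apply]

/-- The pattern `p X` occurs if and only if `p` occurs in the region of the cells with an
occurrence of `X` above and to the right. -/
theorem occurs_appendShift_iff {p : Equiv.Perm (Fin l)} (last : Fin l) (hlast : ∀ b, b ≤ last)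
    (hinj : Set.InjOn f C) :
    Occurs C H (fun _ => N) f (appendShift p X) ↔
      Occurs (supportCols C H N X f) (supportHoles C H N X f) (supportHeight C H N X f) f p := by
  constructor
  · rintro ⟨c, v, hc, hv, hp, hb⟩
    have hbN : ∀ a, v a ≤ 2 * N := fun a => hb a (Fin.castAdd x last)
    have habove : ∀ a b : Fin l, OccursAbove C H N X f ((v (Fin.castAdd x a) + 1) / 2)
        (c (Fin.castAdd x b)) := by
      intro a b
      refine ⟨fun i => c (Fin.natAdd l i), fun i => v (Fin.natAdd l i), ?_, fun i => hv _, ?_,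
        fun i => hbN _, ?_, ?_⟩
      · intro i j hij
        exact hc ((Fin.strictMono_natAdd l) hij)
      · intro i j hij
        apply hp
        rw [appendShift_natAdd, appendShift_natAdd]
        exact (Fin.strictMono_natAdd l) hij
      · intro i
        exact hc (castAdd_lt_natAdd _ _)
      · intro i
        have hlt : Fin.castAdd x a < Fin.natAdd l i := castAdd_lt_natAdd _ _
        have h1 : v (Fin.castAdd x a) ≤ v (Fin.natAdd l i) := by
          apply hp
          rw [appendShift_natAdd, appendShift_castAdd]
          exact castAdd_lt_natAdd _ _
        -- two entries at the same odd level would lie in the same row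
        have h2 : ∀ r, v (Fin.castAdd x a) = 2 * r + 1 → v (Fin.natAdd l i) ≠ 2 * r + 1 := by
          intro r h3 h4
          rcases hv (Fin.castAdd x a) with ⟨h5, h6⟩ | ⟨_, h6⟩
          · rcases hv (Fin.natAdd l i) with ⟨h7, h8⟩ | ⟨_, h8⟩
            · have : f (c (Fin.castAdd x a)) = f (c (Fin.natAdd l i)) := by omega
              exact hlt.ne (hc.injective (hinj h5 h7 this))
            · obtain ⟨k, hk⟩ := h8; omega
          · obtain ⟨k, hk⟩ := h6; omega
        have h3 := h2 (v (Fin.castAdd x a) / 2)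
        beta_reduce
        omega
    have hle : ∀ a b : Fin l, v (Fin.castAdd x a) ≤
        2 * supportHeight C H N X f (c (Fin.castAdd x b)) := by
      intro a b
      have h1 := hbN (Fin.castAdd x a)
      have h2 := le_supportHeight (by omega) (habove a b)
      omega
    refine ⟨fun i => c (Fin.castAdd x i), fun i => v (Fin.castAdd x i), ?_, ?_, ?_, hle⟩
    · intro i j hij
      exact hc ((Fin.strictMono_castAdd x) hij)
    · intro b
      rcases hv (Fin.castAdd x b) with ⟨h1, h2⟩ | ⟨h1, h2⟩
      · refine Or.inl ⟨mem_supportCols.2 ⟨h1, ?_⟩, h2⟩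
        have := hle b b
        beta_reduce at h2 ⊢
        omega
      · exact Or.inr ⟨mem_supportHoles.2 ⟨h1, (habove b b).mono (Nat.zero_le _) le_rfl⟩, h2⟩
    · intro a b hab
      apply hp
      rw [appendShift_castAdd, appendShift_castAdd]
      exact (Fin.strictMono_castAdd x) hab
  · rintro ⟨c, v, hc, hv, hp, hb⟩
    have h0 : OccursAbove C H N X f (supportHeight C H N X f (c last)) (c last) := by
      rcases hv last with ⟨h1, h2⟩ | ⟨h1, h2⟩
      · have := occursAbove_of_lt_supportHeight (mem_supportCols.1 h1).2
        exact occursAbove_supportHeight (this.mono (Nat.zero_le _) le_rfl) (Nat.zero_le _)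
      · exact occursAbove_supportHeight (mem_supportHoles.1 h1).2 (Nat.zero_le _)
    obtain ⟨c', v', h1, h2, h3, h4, h5, h6⟩ := h0
    have hv' : ∀ b, HasLevel C H f (c b) (v b) := fun b =>
      (hv b).imp (fun h => ⟨(mem_supportCols.1 h.1).1, h.2⟩)
        (fun h => ⟨(mem_supportHoles.1 h.1).1, h.2⟩)
    refine ⟨Fin.addCases c c', Fin.addCases v v', ?_, ?_, ?_, ?_⟩
    · intro i j
      refine Fin.addCases (fun i => ?_) (fun i => ?_) i <;>
        refine Fin.addCases (fun j => ?_) (fun j => ?_) j <;> intro hij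
      · simpa using hc ((Fin.strictMono_castAdd x).lt_iff_lt.1 hij)
      · simpa using (hc.monotone (hlast i)).trans_lt (h5 j)
      · exact absurd hij (castAdd_lt_natAdd _ _).asymm
      · simpa using h1 ((Fin.strictMono_natAdd l).lt_iff_lt.1 hij)
    · intro b
      refine Fin.addCases (fun i => ?_) (fun i => ?_) b
      · simpa using hv' i
      · simpa using h2 i
    · intro i j
      refine Fin.addCases (fun i => ?_) (fun i => ?_) i <;>
        refine Fin.addCases (fun j => ?_) (fun j => ?_) j <;> intro hij
      · rw [appendShift_castAdd, appendShift_castAdd] at hij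
        simpa using hp i j ((Fin.strictMono_castAdd x).lt_iff_lt.1 hij)
      · simpa using (hb i last).trans (h6 j)
      · rw [appendShift_castAdd, appendShift_natAdd] at hij
        exact absurd hij (castAdd_lt_natAdd _ _).asymm
      · rw [appendShift_natAdd, appendShift_natAdd] at hij
        simpa using h3 i j ((Fin.strictMono_natAdd l).lt_iff_lt.1 hij)
    · intro i _
      refine Fin.addCases (fun i => ?_) (fun i => ?_) i
      · simpa using (hb i last).trans (Nat.mul_le_mul_left 2 (supportHeight_le _))
      · simpa using h4 i

/-- Rearranging the 1-cells that have an occurrence of `X` above and to the right, inside the region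
of these cells, does not change this region. -/
theorem occursAbove_congr (hCH : Disjoint C H) (hf' : f' ∈ transversals (supportCols C H N X f)
    ((supportCols C H N X f).image f) (supportHeight C H N X f) f) (g : ℕ) (j : Fin n) :
    OccursAbove C H N X f' g j ↔ OccursAbove C H N X f g j := by
  obtain ⟨hoff, -, hlt⟩ := hf'
  have hlev : ∀ (j : Fin n) (v : ℕ), j ∉ supportCols C H N X f →
      (HasLevel C H f' j v ↔ HasLevel C H f j v) := by
    intro j v hj
    rw [HasLevel, HasLevel, hoff j hj]
  have hcol : ∀ (h : Fin n → ℕ) (j : Fin n) (v : ℕ), HasLevel C H h j v →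
      j ∈ supportCols C H N X f → v = 2 * h j + 1 := by
    rintro h j v (h1 | h1) h2
    · exact h1.2
    · exact absurd h1.1 (Finset.disjoint_left.1 hCH (mem_supportCols.1 h2).1)
  -- an entry in a column of the region can be replaced by an occurrence of `X` above and to the
  -- right of it
  constructor
  · rintro ⟨c, v, h1, h2, h3, h4, h5, h6⟩
    by_cases hb : ∃ b, c b ∈ supportCols C H N X f
    · obtain ⟨b, hb⟩ := hb
      have h7 := hcol f' _ _ (h2 b) hb
      have h8 := h6 b
      exact (occursAbove_of_lt_supportHeight (hlt _ hb)).mono (by omega) (h5 b).le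
    · push Not at hb
      exact ⟨c, v, h1, fun b => (hlev _ _ (hb b)).1 (h2 b), h3, h4, h5, h6⟩
  · induction hk : n - (j : ℕ) using Nat.strong_induction_on generalizing j g with
    | _ k ih =>
      rintro ⟨c, v, h1, h2, h3, h4, h5, h6⟩
      by_cases hb : ∃ b, c b ∈ supportCols C H N X f
      · obtain ⟨b, hb⟩ := hb
        have h7 := hcol f _ _ (h2 b) hb
        have h8 := h6 b
        have h9 : (j : ℕ) < c b := h5 b
        have h10 := (c b).2
        have h11 := ih (n - c b) (by omega) _ _ rfl
          (occursAbove_of_lt_supportHeight (mem_supportCols.1 hb).2)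
        exact h11.mono (by omega) (h5 b).le
      · push Not at hb
        exact ⟨c, v, h1, fun b => (hlev _ _ (hb b)).2 (h2 b), h3, h4, h5, h6⟩

theorem supportHeight_congr (h : ∀ g j, OccursAbove C H N X f' g j ↔ OccursAbove C H N X f g j) :
    supportHeight C H N X f' = supportHeight C H N X f := by
  have h' : OccursAbove C H N X f' = OccursAbove C H N X f :=
    funext fun g => funext fun j => propext (h g j)
  funext j
  rw [supportHeight, supportHeight, h']

theorem supportHoles_congr (h : ∀ g j, OccursAbove C H N X f' g j ↔ OccursAbove C H N X f g j) :
    supportHoles C H N X f' = supportHoles C H N X f := by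
  ext j
  rw [mem_supportHoles, mem_supportHoles, h]

theorem supportCols_eq_of_mem (hCH : Disjoint C H)
    (hf' : f' ∈ transversals (supportCols C H N X f)
      ((supportCols C H N X f).image f) (supportHeight C H N X f) f) :
    supportCols C H N X f' = supportCols C H N X f := by
  have h := supportHeight_congr (occursAbove_congr hCH hf')
  ext j
  by_cases hj : j ∈ supportCols C H N X f
  · simp only [hj, iff_true]
    rw [mem_supportCols, h]
    exact ⟨(mem_supportCols.1 hj).1, hf'.2.2 j hj⟩
  · rw [mem_supportCols, mem_supportCols, h, hf'.1 j hj]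

/-- The data that are preserved when the 1-cells that have an occurrence of `X` above and to the
right are rearranged inside the region of these cells: the region, the columns and the rows of these
1-cells, and the other 1-cells. -/
noncomputable def supportData (C H : Finset (Fin n)) (N : ℕ) (X : Equiv.Perm (Fin x))
    (f : Fin n → ℕ) : (Fin n → ℕ) × Finset (Fin n) × Finset ℕ × (Fin n → ℕ) :=
  (supportHeight C H N X f, supportCols C H N X f, (supportCols C H N X f).image f,
    fun j => if j ∈ supportCols C H N X f then 0 else f j)

/-- The fibres of `supportData` consist of the transversals of the region, extended by the 1-cells
outside it. -/
theorem supportData_fiber (hCH : Disjoint C H) {R : Finset ℕ} {f₀ : Fin n → ℕ}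
    (hf : f ∈ transversals C R (fun _ => N) f₀) :
    {f' ∈ transversals C R (fun _ => N) f₀ | supportData C H N X f' = supportData C H N X f} =
      transversals (supportCols C H N X f) ((supportCols C H N X f).image f)
        (supportHeight C H N X f) f := by
  ext f'
  constructor
  · rintro ⟨h1, h2⟩
    simp only [supportData, Prod.mk.injEq] at h2
    obtain ⟨h3, h4, h5, h6⟩ := h2
    rw [h4] at h5 h6
    refine ⟨fun j hj => ?_, ?_, fun j hj => ?_⟩
    · have := congrFun h6 j
      simpa [hj] using this
    · rw [← h5, Finset.coe_image]
      refine Set.InjOn.bijOn_image (h1.2.1.injOn.mono fun j hj => ?_)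
      exact (mem_supportCols.1 (Finset.mem_coe.1 hj)).1
    · rw [← h4] at hj
      rw [← h3]
      exact (mem_supportCols.1 hj).2
  · intro h1
    have h2 := supportCols_eq_of_mem hCH h1
    have h3 := supportHeight_congr (occursAbove_congr hCH h1)
    have hsub : supportCols C H N X f ⊆ C := fun j hj => (mem_supportCols.1 hj).1
    have hD := h1.2.1
    refine ⟨⟨fun j hj => ?_, ?_, fun j hj => ?_⟩, ?_⟩
    · rw [h1.1 j fun h => hj (hsub h), hf.1 j hj]
    · have h4 : Set.BijOn f' ((C : Set (Fin n)) \ supportCols C H N X f)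
          ((R : Set ℕ) \ (supportCols C H N X f).image f) := by
        refine Set.BijOn.congr (f₁ := f) ?_ fun j hj => (h1.1 j hj.2).symm
        have h5 : Set.BijOn f (supportCols C H N X f) ((supportCols C H N X f).image f) := by
          rw [Finset.coe_image]
          exact (hf.2.1.injOn.mono (Finset.coe_subset.2 hsub)).bijOn_image
        refine ⟨fun j hj => ⟨hf.2.1.mapsTo hj.1, fun h6 => ?_⟩, hf.2.1.injOn.mono Set.sdiff_subset,
          fun r hr => ?_⟩
        · obtain ⟨i, hi, hij⟩ := h5.surjOn h6
          exact hj.2 (hf.2.1.injOn (hsub hi) hj.1 hij ▸ hi)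
        · obtain ⟨i, hi, rfl⟩ := hf.2.1.surjOn hr.1
          exact ⟨i, ⟨hi, fun h6 => hr.2 (h5.mapsTo h6)⟩, rfl⟩
      have h7 := hD.union h4 ?_
      · rw [Set.union_sdiff_cancel (Finset.coe_subset.2 hsub), Set.union_sdiff_cancel] at h7
        · exact h7
        · rw [Finset.coe_image]
          exact (Set.image_mono (Finset.coe_subset.2 hsub)).trans hf.2.1.mapsTo.image_subset
      · have h8 : Disjoint (f' '' supportCols C H N X f)
            (f' '' ((C : Set (Fin n)) \ supportCols C H N X f)) := by
          rw [hD.image_eq, h4.image_eq]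
          exact Set.disjoint_sdiff_right
        rw [Set.injOn_union Set.disjoint_sdiff_right]
        exact ⟨hD.injOn, h4.injOn, fun a ha b hb e =>
          Set.disjoint_left.1 h8 ⟨a, ha, rfl⟩ ⟨b, hb, e.symm⟩⟩
    · by_cases hj' : j ∈ supportCols C H N X f
      · exact (h1.2.2 j hj').trans_le (supportHeight_le j)
      · rw [h1.1 j hj']
        exact hf.2.2 j hj
    · have h9 : (supportCols C H N X f).image f' = (supportCols C H N X f).image f := by
        rw [← Finset.coe_inj, Finset.coe_image]
        exact hD.image_eq
      simp only [supportData, h2, h3, h9, Prod.mk.injEq, true_and]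
      funext j
      split_ifs with hj
      · rfl
      · exact h1.1 j hj

/-- On a fibre of `supportData`, the pattern `p X` is avoided if and only if `p` is avoided in the
region that the fibre determines. -/
theorem supportData_fiber_avoids {p : Equiv.Perm (Fin l)} (last : Fin l) (hlast : ∀ b, b ≤ last)
    (hCH : Disjoint C H) {R : Finset ℕ} {f₀ : Fin n → ℕ}
    (hf : f ∈ transversals C R (fun _ => N) f₀) :
    {f' ∈ {f' ∈ transversals C R (fun _ => N) f₀ |
        ¬ Occurs C H (fun _ => N) f' (appendShift p X)} |
        supportData C H N X f' = supportData C H N X f} =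
      {f' ∈ transversals (supportCols C H N X f) ((supportCols C H N X f).image f)
        (supportHeight C H N X f) f | ¬ Occurs (supportCols C H N X f) (supportHoles C H N X f)
          (supportHeight C H N X f) f' p} := by
  have hfib := supportData_fiber (X := X) hCH hf
  have key : ∀ f' ∈ transversals C R (fun _ => N) f₀,
      supportData C H N X f' = supportData C H N X f →
      (Occurs C H (fun _ => N) f' (appendShift p X) ↔ Occurs (supportCols C H N X f)
        (supportHoles C H N X f) (supportHeight C H N X f) f' p) := by
    intro f' h1 h2
    have h3 := hfib.subset ⟨h1, h2⟩
    rw [occurs_appendShift_iff last hlast h1.2.1.injOn, supportCols_eq_of_mem hCH h3,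
      supportHeight_congr (occursAbove_congr hCH h3), supportHoles_congr (occursAbove_congr hCH h3)]
  ext f'
  constructor
  · rintro ⟨⟨h1, h2⟩, h3⟩
    exact ⟨hfib.subset ⟨h1, h3⟩, fun h4 => h2 ((key f' h1 h3).2 h4)⟩
  · rintro ⟨h1, h2⟩
    obtain ⟨h3, h4⟩ := hfib.superset h1
    exact ⟨⟨h3, fun h5 => h2 ((key f' h3 h4).1 h5)⟩, h4⟩

/-- In rectangles with hole-columns, the patterns `312X` and `231X` are avoided by equally many
transversals. -/
theorem encard_not_occurs_appendShift_eq (C H : Finset (Fin n)) (hCH : Disjoint C H)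
    (R : Finset ℕ) (N : ℕ) (f₀ : Fin n → ℕ) (X : Equiv.Perm (Fin x)) :
    {f ∈ transversals C R (fun _ => N) f₀ |
        ¬ Occurs C H (fun _ => N) f (appendShift perm312 X)}.encard =
      {f ∈ transversals C R (fun _ => N) f₀ |
        ¬ Occurs C H (fun _ => N) f (appendShift perm231 X)}.encard := by
  classical
  have hfin := finite_transversals C R (fun _ => N) f₀
  set L := (hfin.toFinset.image (supportData C H N X)).toList with hL
  have hmem : ∀ (p : Equiv.Perm (Fin (3 + x))), ∀ f ∈ {f ∈ transversals C R (fun _ => N) f₀ |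
      ¬ Occurs C H (fun _ => N) f p}, supportData C H N X f ∈ L := by
    intro p f hf
    rw [hL, Finset.mem_toList]
    exact Finset.mem_image_of_mem _ (hfin.mem_toFinset.2 hf.1)
  rw [encard_eq_sum_fibers _ (supportData C H N X) L (Finset.nodup_toList _) (hmem _),
    encard_eq_sum_fibers _ (supportData C H N X) L (Finset.nodup_toList _) (hmem _)]
  congr 1
  refine List.map_congr_left fun d hd => ?_
  rw [hL, Finset.mem_toList, Finset.mem_image] at hd
  obtain ⟨f, hf, rfl⟩ := hd
  rw [hfin.mem_toFinset] at hf
  have hlast : ∀ b : Fin 3, b ≤ 2 := by decide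
  rw [supportData_fiber_avoids 2 hlast hCH hf, supportData_fiber_avoids 2 hlast hCH hf]
  refine encard_not_occurs_eq _ _ ?_ _ antitone_supportHeight _
  exact Finset.disjoint_left.2 fun j hj hj' =>
    Finset.disjoint_left.1 hCH (mem_supportCols.1 hj).1 (mem_supportHoles.1 hj').1

end

/-! ### Partial permutations as transversals of rectangles -/

section

theorem standardization_congr {ι α β : Type} [Fintype ι] [LinearOrder α] [LinearOrder β]
    {w : ι → α} {w' : ι → β} (h : ∀ a b, w a < w b ↔ w' a < w' b) :
    standardization w = standardization w' := by
  funext i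
  unfold standardization
  congr 1
  ext j
  simp [h]

theorem standardization_lt_iff {ι α : Type} [Fintype ι] [LinearOrder α] (w : ι → α) {a b : ι} :
    standardization w a < standardization w b ↔ w a < w b := by
  have hle : ∀ {a b : ι}, w a ≤ w b → standardization w a ≤ standardization w b := by
    intro a b hab
    refine Finset.card_le_card fun i hi => ?_
    simp only [Finset.mem_filter, Finset.mem_univ, true_and] at hi ⊢
    exact hi.trans_le hab
  refine ⟨fun h => ?_, fun h => ?_⟩
  · by_contra h'
    exact absurd (hle (not_lt.1 h')) (not_le.2 h)
  · refine Finset.card_lt_card ((Finset.ssubset_iff_of_subset fun i hi => ?_).2 ⟨a, ?_, ?_⟩)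
    · simp only [Finset.mem_filter, Finset.mem_univ, true_and] at hi ⊢
      exact hi.trans h
    · simpa using h
    · simp

theorem standardization_lt_card {ι α : Type} [Fintype ι] [LinearOrder α] (w : ι → α) (a : ι) :
    standardization w a < Fintype.card ι := by
  refine Finset.card_lt_univ_of_notMem (x := a) ?_
  simp

theorem standardization_injective {ι α : Type} [Fintype ι] [LinearOrder α] {w : ι → α}
    (hw : Function.Injective w) : Function.Injective (standardization w) := by
  intro a b hab
  rcases lt_trichotomy (w a) (w b) with h | h | h
  · exact absurd hab ((standardization_lt_iff w).2 h).ne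
  · exact hw h
  · exact absurd hab ((standardization_lt_iff w).2 h).ne'

theorem standardization_eq_self {ι : Type} [Fintype ι] {N : ℕ} {w : ι → ℕ}
    (hw : Function.Injective w) (hr : ∀ r, (∃ i, w i = r) ↔ r < N) : standardization w = w := by
  classical
  funext i
  unfold standardization
  rw [← Finset.card_image_of_injective _ hw]
  convert Finset.card_range (w i)
  ext r
  simp only [Finset.mem_image, Finset.mem_filter, Finset.mem_univ, true_and, Finset.mem_range]
  constructor
  · rintro ⟨j, h, rfl⟩
    exact h
  · intro h
    obtain ⟨j, rfl⟩ := (hr r).2 (h.trans ((hr _).1 ⟨i, rfl⟩))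
    exact ⟨j, h, rfl⟩

theorem standardization_perm {l : ℕ} (p : Equiv.Perm (Fin l)) :
    standardization p = fun a => (p a : ℕ) := by
  rw [standardization_congr (w := p) (w' := fun a => (p a : ℕ)) fun a b => Fin.lt_def]
  refine standardization_eq_self (N := l) (Fin.val_injective.comp p.injective) fun r => ?_
  constructor
  · rintro ⟨i, rfl⟩
    exact (p i).2
  · intro h
    exact ⟨p.symm ⟨r, h⟩, by simp⟩

/-- A subword standardizes to `p` if and only if its letters are ordered as those of `p`. -/
theorem standardization_eq_perm_iff {α : Type} [LinearOrder α] {l : ℕ} {w : Fin l → α}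
    (p : Equiv.Perm (Fin l)) :
    (standardization w = fun a => (p a : ℕ)) ↔ ∀ a b, p a < p b → w a < w b := by
  constructor
  · intro h a b hab
    rw [← standardization_lt_iff w, h]
    exact hab
  · intro h
    rw [← standardization_perm p]
    refine standardization_congr fun a b => ⟨fun h1 => ?_, h a b⟩
    rcases lt_trichotomy (p a) (p b) with h2 | h2 | h2
    · exact h2
    · rw [p.injective h2] at h1
      exact absurd h1 (lt_irrefl _)
    · exact absurd (h b a h2) h1.asymm

namespace PartialPerm

variable {n k l : ℕ}

/-- The letter of a partial permutation in a position; it is `0` at the holes. -/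
def letter (π : PartialPerm n k) (j : Fin n) : ℕ :=
  (π.word j).elim 0 Fin.val

variable {π : PartialPerm n k}

theorem word_map_val {j : Fin n} (h : π.word j ≠ none) :
    (π.word j).map Fin.val = some (π.letter j) := by
  obtain ⟨v, hv⟩ := Option.ne_none_iff_exists'.1 h
  simp [letter, hv]

theorem letter_lt {j : Fin n} (h : π.word j ≠ none) : π.letter j < n - k := by
  obtain ⟨v, hv⟩ := Option.ne_none_iff_exists'.1 h
  simp [letter, hv]

theorem letter_injective :
    Function.Injective fun j : {j : Fin n // π.word j ≠ none} => π.letter j := by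
  rintro ⟨i, hi⟩ ⟨j, hj⟩ h
  obtain ⟨v, hv⟩ := Option.ne_none_iff_exists'.1 hi
  obtain ⟨w, hw⟩ := Option.ne_none_iff_exists'.1 hj
  simp only [letter, hv, hw, Option.elim_some] at h
  rw [← Fin.ext h] at hw
  exact Subtype.ext ((π.existsUnique_symbol v).unique hv hw)

theorem exists_letter_iff (r : ℕ) :
    (∃ j : {j : Fin n // π.word j ≠ none}, π.letter j = r) ↔ r < n - k := by
  constructor
  · rintro ⟨j, rfl⟩
    exact letter_lt j.2
  · intro h
    obtain ⟨j, hj, -⟩ := π.existsUnique_symbol ⟨r, h⟩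
    exact ⟨⟨j, by simp [hj]⟩, by simp [letter, hj]⟩

theorem isExtension_iff (σ : Equiv.Perm (Fin n)) :
    π.IsExtension σ ↔ ∀ i : {i : Fin n // π.word i ≠ none},
      π.letter i = standardization (fun j : {j : Fin n // π.word j ≠ none} => σ j) i := by
  refine forall_congr' fun i => ?_
  rw [word_map_val i.2, Option.some_inj]

/-- A partial permutation avoids `p` if and only if `p` does not occur in the rectangular partial
transversal with the same letters and holes. An extension yields levels by counting the smaller
letters of the partial permutation; conversely, an occurrence prescribes an order of the letters in
its positions, which extends to all positions. -/
theorem avoids_iff_not_occurs {H : Finset (Fin n)} (hH : ∀ i, π.word i = none ↔ i ∈ H)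
    (p : Equiv.Perm (Fin l)) :
    π.Avoids p ↔ ¬ Occurs Hᶜ H (fun _ => n - k) π.letter p := by
  classical
  unfold Avoids
  rw [← not_iff_not, not_not]
  push Not
  constructor
  · rintro ⟨σ, hσ, c, hc, hp⟩
    rw [standardization_eq_perm_iff] at hp
    rw [isExtension_iff] at hσ
    -- the number of letters of the partial permutation below an entry gives its level
    set cnt : Fin n → ℕ := fun i =>
      (Finset.univ.filter fun j : {j : Fin n // π.word j ≠ none} => σ j < σ i).card with hcnt
    have hcnt_letter : ∀ i, i ∉ H → cnt i = π.letter i := by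
      intro i hi
      rw [hσ ⟨i, fun h => hi ((hH i).1 h)⟩]
      rfl
    have hmono : ∀ i j, σ i < σ j → cnt i ≤ cnt j := by
      intro i j hij
      refine Finset.card_le_card fun a ha => ?_
      simp only [Finset.mem_filter, Finset.mem_univ, true_and] at ha ⊢
      exact ha.trans hij
    have hstrict : ∀ i j, i ∉ H → σ i < σ j → cnt i < cnt j := by
      intro i j hi hij
      refine Finset.card_lt_card ((Finset.ssubset_iff_of_subset fun a ha => ?_).2
        ⟨⟨i, fun h => hi ((hH i).1 h)⟩, ?_, ?_⟩)
      · simp only [Finset.mem_filter, Finset.mem_univ, true_and] at ha ⊢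
        exact ha.trans hij
      · simpa using hij
      · simp
    have hle : ∀ i, cnt i ≤ n - k := by
      intro i
      refine (Finset.card_filter_le _ _).trans ?_
      rw [Finset.card_univ, Fintype.card_subtype_compl, Fintype.card_fin, Fintype.card_subtype,
        π.card_holes]
    refine ⟨c, fun b => 2 * cnt (c b) + if c b ∈ H then 0 else 1, hc, fun b => ?_,
      fun a b hab => ?_, fun a _ => ?_⟩
    · by_cases hb : c b ∈ H
      · right
        simp [hb]
      · left
        simp [hb, hcnt_letter]
    · have h1 := hmono _ _ (hp a b hab)
      by_cases ha : c a ∈ H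
      · simp only [ha, if_true]
        omega
      · have h2 := hstrict _ _ ha (hp a b hab)
        simp only [ha, if_false]
        omega
    · by_cases ha : c a ∈ H
      · simpa [ha] using hle (c a)
      · have h1 := hcnt_letter _ ha
        have h2 : π.letter (c a) < n - k := letter_lt fun h => ha ((hH _).1 h)
        simp only [ha, if_false]
        omega
  · rintro ⟨c, v, hc, hv, hp, -⟩
    set level : Fin n → ℕ := Function.extend c v fun i => 2 * π.letter i + 1 with hlevel
    set tie : Fin n → ℕ := Function.extend c (fun b => (p b : ℕ)) 0 with htie
    -- equal levels are ordered as in `p`, and the last component only makes the key injective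
    set key : Fin n → ℕ ×ₗ ℕ ×ₗ Fin n := fun i => toLex (level i, toLex (tie i, i)) with hkey
    have hkinj : Function.Injective key := by
      intro i j hij
      simp only [hkey, toLex_inj, Prod.mk.injEq] at hij
      exact hij.2.2
    have hlevel_std : ∀ i, i ∉ H → level i = 2 * π.letter i + 1 := by
      intro i hi
      by_cases hb : ∃ b, c b = i
      · obtain ⟨b, rfl⟩ := hb
        rw [hlevel, hc.injective.extend_apply]
        rcases hv b with h1 | h1
        · exact h1.2
        · exact absurd h1.1 hi
      · rw [hlevel, Function.extend_apply' _ _ _ hb]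
    have hkey_lt : ∀ i j, level i < level j → key i < key j := by
      intro i j hij
      exact Prod.Lex.toLex_lt_toLex.2 (Or.inl hij)
    have hkey_c : ∀ a b, p a < p b → key (c a) < key (c b) := by
      intro a b hab
      refine Prod.Lex.toLex_lt_toLex.2 ?_
      simp only [hlevel, htie, hc.injective.extend_apply]
      rcases (hp a b hab).lt_or_eq with h1 | h1
      · exact Or.inl h1
      · exact Or.inr ⟨h1, Prod.Lex.toLex_lt_toLex.2 (Or.inl hab)⟩
    have hst : ∀ i, standardization key i < n := fun i => by
      simpa using standardization_lt_card key i
    let σ : Equiv.Perm (Fin n) := Equiv.ofBijective (fun i => ⟨standardization key i, hst i⟩)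
      (Finite.injective_iff_bijective.1 fun i j hij =>
        standardization_injective hkinj (Fin.mk.inj_iff.1 hij))
    have hσ : ∀ i j, σ i < σ j ↔ key i < key j := fun i j => standardization_lt_iff key
    refine ⟨σ, ?_, c, hc, ?_⟩
    · rw [isExtension_iff]
      intro i
      have h1 := standardization_eq_self (letter_injective (π := π)) exists_letter_iff
      rw [← congrFun h1 i]
      refine congrFun (standardization_congr fun a b => ?_) i
      have ha : (a : Fin n) ∉ H := fun h => a.2 ((hH _).2 h)
      have hb : (b : Fin n) ∉ H := fun h => b.2 ((hH _).2 h)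
      rw [hσ]
      constructor
      · intro h2
        refine hkey_lt _ _ ?_
        rw [hlevel_std _ ha, hlevel_std _ hb]
        omega
      · intro h2
        by_contra h3
        rcases (not_lt.1 h3).lt_or_eq with h4 | h4
        · refine (hkey_lt b a ?_).asymm h2
          rw [hlevel_std _ ha, hlevel_std _ hb]
          omega
        · rw [letter_injective h4] at h2
          exact lt_irrefl _ h2
    · rw [standardization_eq_perm_iff]
      intro a b hab
      exact (hσ _ _).2 (hkey_c a b hab)

end PartialPerm

variable {n l : ℕ}

theorem PartialPerm.letter_mem_transversals {H : Finset (Fin n)} {π : PartialPerm n H.card}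
    (hH : ∀ i, π.word i = none ↔ i ∈ H) :
    π.letter ∈ transversals Hᶜ (Finset.range (n - H.card)) (fun _ => n - H.card) 0 := by
  have hH' : ∀ j, j ∈ Hᶜ → π.word j ≠ none := fun j hj h => Finset.mem_compl.1 hj ((hH j).1 h)
  refine ⟨fun j hj => ?_, ⟨fun j hj => ?_, fun i hi j hj hij => ?_, fun r hr => ?_⟩,
    fun j hj => letter_lt (hH' j hj)⟩
  · rw [Finset.mem_compl, not_not, ← hH] at hj
    simp [letter, hj]
  · exact Finset.mem_coe.2 (Finset.mem_range.2 (letter_lt (hH' j hj)))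
  · exact congrArg Subtype.val (@letter_injective _ _ π ⟨i, hH' i hi⟩ ⟨j, hH' j hj⟩ hij)
  · obtain ⟨j, hj⟩ := (exists_letter_iff r).2 (Finset.mem_range.1 hr)
    exact ⟨j, by simpa using fun h => j.2 ((hH _).2 h), hj⟩

/-- Partial permutations with hole set `H` correspond to the transversals of the rectangle with
`n - H.card` rows in which the columns in `H` are hole-columns. -/
theorem numAvoiding_eq (H : Finset (Fin n)) (p : Equiv.Perm (Fin l)) :
    numAvoiding H p =
      {f ∈ transversals Hᶜ (Finset.range (n - H.card)) (fun _ => n - H.card) 0 |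
        ¬ Occurs Hᶜ H (fun _ => n - H.card) f p}.encard.toNat := by
  classical
  rw [← Set.ncard_def, ← Nat.card_coe_set_eq]
  refine Nat.card_congr (Equiv.ofBijective (fun π => ⟨π.1.letter,
    PartialPerm.letter_mem_transversals π.2.1,
    (PartialPerm.avoids_iff_not_occurs π.2.1 p).1 π.2.2⟩) ⟨?_, ?_⟩)
  · rintro ⟨π, h1, h2⟩ ⟨π', h1', h2'⟩ h
    have h3 : π.letter = π'.letter := congrArg Subtype.val h
    have h4 : π.word = π'.word := by
      funext j
      by_cases hj : j ∈ H
      · rw [(h1 j).2 hj, (h1' j).2 hj]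
      · have h5 := PartialPerm.word_map_val fun h => hj ((h1 j).1 h)
        have h6 := PartialPerm.word_map_val fun h => hj ((h1' j).1 h)
        rw [h3, ← h6] at h5
        exact Option.map_injective Fin.val_injective h5
    obtain ⟨w, _, _⟩ := π
    obtain ⟨w', _, _⟩ := π'
    obtain rfl : w = w' := h4
    rfl
  · rintro ⟨f, ⟨hoff, hbij, hlt⟩, hf⟩
    have hlt' : ∀ j, j ∉ H → f j < n - H.card := fun j hj => hlt j (Finset.mem_compl.2 hj)
    let w : Fin n → Option (Fin (n - H.card)) := fun j =>
      if hj : j ∈ H then none else some ⟨f j, hlt' j hj⟩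
    have hw : ∀ j, w j = none ↔ j ∈ H := by
      intro j
      by_cases hj : j ∈ H <;> simp [w, hj]
    have hws : ∀ j v, w j = some v ↔ j ∉ H ∧ f j = v := by
      intro j v
      by_cases hj : j ∈ H <;> simp [w, hj, Fin.ext_iff]
    let π : PartialPerm n H.card :=
      { word := w
        existsUnique_symbol := by
          intro v
          obtain ⟨j, hj, hjv⟩ := hbij.surjOn (Finset.mem_coe.2 (Finset.mem_range.2 v.2))
          refine ⟨j, (hws j v).2 ⟨Finset.mem_compl.1 hj, hjv⟩, fun i hi => ?_⟩
          replace hi := (hws i v).1 hi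
          exact hbij.injOn (Finset.mem_coe.2 (Finset.mem_compl.2 hi.1)) hj (hi.2.trans hjv.symm)
        card_holes := by
          congr 1
          ext j
          simp [hw] }
    have hletter : π.letter = f := by
      funext j
      by_cases hj : j ∈ H
      · rw [hoff j (by simpa using hj)]
        simp [PartialPerm.letter, π, w, hj]
      · simp [PartialPerm.letter, π, w, hj]
    refine ⟨⟨π, hw, ?_⟩, Subtype.ext hletter⟩
    rw [PartialPerm.avoids_iff_not_occurs hw, hletter]
    exact hf

end

theorem theorem5p1 :
    ShapeStarWilfEquivalent perm312 perm231 ∧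
      ∀ (n : ℕ) (X : Equiv.Perm (Fin n)),
        StronglyStarWilfEquivalent (appendShift perm312 X) (appendShift perm231 X) := by
  refine ⟨shapeStarWilfEquivalent_312_231, fun _ X _ n H _ => ?_⟩
  rw [numAvoiding_eq, numAvoiding_eq,
    encard_not_occurs_appendShift_eq _ _ disjoint_compl_left _ _ _ X]
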